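/- \textbf{Setting.} Let $I_0\subset[-1,1]$ be a fixed closed interval of positive length and $I_1$ a fixed closed interval of positive length contained in the interior of $I_0$. Let $x_1<\dots<x_n$ be points of $[-1,1]$, let $P(z)=\prod_{i=1}^n(z-x_i)$, let $\ell_k$ be the Lagrange basis functions of these nodes, $\lambda(x)=\sum_k|\ell_k(x)|$, and assume $\int_{I_0}\lambda(x)\,dx\ll\log n$. Put $U_\mu(z)=\frac1n\sum_i\log\frac1{|z-x_i|}$, $\alpha=\frac1n\log\sum_k\frac1{|P'(x_k)|}$ and $$\rho(x)=-\frac1{\pi^2}\int_{\mathbb R\setminus I_0}\frac{U_\mu(v)-\alpha}{(x-v)^2}\,dv\qquad(x\in\operatorname{int} I_0).$$ Let $\varepsilon>0$ be sufficiently small, and let $J_0$ be a closed interval with centre $x_J\in I_1$ and length $n^{\varepsilon-1}\le|J_0|\le n^{-\varepsilon}$ such that $$\int_{J_0}\sum_{k:x_k\in J_0}\frac{|P(x)|}{|P'(x_k)|}\,dx\ll|J_0|^2 .$$ Let $P_0=|J_0|\big/\sum_k\frac1{\min(|P'(x_k)|,|P'(x_{k+1})|)}$, the sum being over the $k$ with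 $x_k,x_{k+1}\in J_0$, and let $J_i=(1-i\varepsilon)J_0$ be the interval with the same centre as $J_0$ and length $(1-i\varepsilon)|J_0|$. Let $\eta$ be a good ordinate, that is, $n^{\varepsilon^3/2-1}\le\eta\le n^{\varepsilon^3-1}$ and $$\int_{\eta/2}^{2\eta}\int_{J_3}\Big|\frac{P'}{P}(x+iy)+\pi i n\rho(x_J)\Big|^2dx\,dy\ll_\varepsilon\frac{|J_0|}{\eta\log n}.$$ Let $1=\sum_{j\in\mathbb Z}\varphi_j$ be a smooth partition of unity on $\mathbb R$, where $\varphi_j$ takes values in $[0,1]$, is supported in a closed interval $K_j$ of length $\eta\log^{1/6}n$, and satisfies $\varphi_j'\ll(\eta\log^{1/6}n)^{-1}$, and where every real number lies in $O(1)$ of the $K_j$. Call $j$ good if $K_j$ is contained in the interior of $J_4$ and $$\Big|\frac{P'}{P}(x+i\eta)+\pi i n\rho(x_J)\Big|<\frac1{\eta\log^{1/3}n}\quad\text{for all }x\in K_j .$$ \textbf{Lemma.} If $n$ is sufficiently large (depending on $\varepsilon$, $I_0$, $I_1$ and the implied constants in the hypotheses), then there are only finitely many good $j$, and, with all sums over $j$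 restricted to good $j$, $$\text{(i)}\quad \sum_j\int_{\mathbb R}\frac{|P(x)|}{P_0}\varphi_j(x)\,dx\ \ge\ \frac{4-O(\varepsilon)}{\pi}\int_{\mathbb R}\frac{|P(x+i\eta)|}{P_0e^{\pi n\eta\rho(x_J)}}\sum_j\varphi_j(x)\,dx-O_\varepsilon\big(|J_0|\log^{-1/6}n\big),$$ $$\text{(ii)}\quad \sum_j\sum_{k=1}^n\frac{P_0}{|P'(x_k)|}\varphi_j(x_k)\ \ge\ \frac1{2\pi}\int_{\mathbb R}\frac{e^{\pi n\eta\rho(x_J)}P_0}{|P(x+i\eta)|}\sum_j\varphi_j(x)\,dx-O_\varepsilon\big(|J_0|\log^{-1/6}n\big).$$ The constant in $O(\varepsilon)$, and how small $\varepsilon$ has to be, depend only on $I_0$, $I_1$ and the implied constants in the hypotheses on $\lambda$, $J_0$ and $(\varphi_j)$; the constants in $O_\varepsilon$ may depend also on $\varepsilon$ and on the implied constant in the condition on $\eta$. -/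

import Mathlib

open MeasureTheory
open scoped ContDiff

namespace LebesgueInterp

/-- The monic polynomial `P(z) = ∏ i, (z - x i)` with roots at the nodes. -/
noncomputable def nodePoly {n : ℕ} (x : Fin n → ℝ) : Polynomial ℝ :=
  Lagrange.nodal Finset.univ x

/-- The value `P(z)` at a complex point. -/
noncomputable def P {n : ℕ} (x : Fin n → ℝ) (z : ℂ) : ℂ :=
  Polynomial.aeval z (nodePoly x)

/-- The value `P'(z)` at a complex point. -/
noncomputable def P' {n : ℕ} (x : Fin n → ℝ) (z : ℂ) : ℂ :=
  Polynomial.aeval z (Polynomial.derivative (nodePoly x))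

/-- The Lebesgue function `λ(t) = ∑ k, |ℓ_k(t)|` of Lagrange interpolation at the nodes. -/
noncomputable def lebesgueFun {n : ℕ} (x : Fin n → ℝ) (t : ℝ) : ℝ :=
  ∑ k : Fin n, |(Lagrange.basis Finset.univ x k).eval t|

/-- The logarithmic potential `U_μ(z) = (1/n) ∑ i, log (1 / |z - x i|)` of the empirical measure
of the nodes. -/
noncomputable def logPotential {n : ℕ} (x : Fin n → ℝ) (z : ℂ) : ℝ :=
  (1 / (n : ℝ)) * ∑ i : Fin n, Real.log (1 / ‖z - (x i : ℂ)‖)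

/-- `α = (1/n) log (∑ k, 1 / |P'(x k)|)`. -/
noncomputable def alpha {n : ℕ} (x : Fin n → ℝ) : ℝ :=
  (1 / (n : ℝ)) * Real.log (∑ k : Fin n, 1 / ‖P' x (x k)‖)

/-- The density of states
`ρ(t) = -π⁻² ∫_{ℝ \ [a,b]} (U_μ(v) - α) / (t - v)² dv`, for `t` interior to `[a,b]`. -/
noncomputable def rho {n : ℕ} (x : Fin n → ℝ) (a b t : ℝ) : ℝ :=
  -(1 / Real.pi ^ 2) *
    ∫ v in (Set.Icc a b)ᶜ, (logPotential x (v : ℂ) - alpha x) / (t - v) ^ 2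

/-- The closed interval with the given centre and half-length. -/
def ball (y r : ℝ) : Set ℝ := Set.Icc (y - r) (y + r)

open Classical in
/-- The sum of `1 / p_k`, `p_k = min (|P'(x k)|, |P'(x (k+1))|)`, over all pairs of consecutive
nodes `x k < x (k+1)` that both lie in `J`. -/
noncomputable def invMinDerivSum {n : ℕ} (x : Fin n → ℝ) (J : Set ℝ) : ℝ :=
  ∑ k : Fin n, if h : k.val + 1 < n then
    (if x k ∈ J ∧ x ⟨k.val + 1, h⟩ ∈ J then
      1 / min ‖P' x (x k)‖ ‖P' x (x ⟨k.val + 1, h⟩)‖ else 0)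
    else 0

/-- The normalising constant `P₀ = |J₀| / ∑ 1 / p_k`, where `J₀ = [y - r, y + r]`. -/
noncomputable def P₀ {n : ℕ} (x : Fin n → ℝ) (y r : ℝ) : ℝ :=
  (2 * r) / invMinDerivSum x (ball y r)

open Classical in
/-- `∫_{J₀} ∑_{k : x k ∈ J₀} |P(t)| / |P'(x k)| dt`, where `J₀ = [y - r, y + r]`. -/
noncomputable def localIntegral {n : ℕ} (x : Fin n → ℝ) (y r : ℝ) : ℝ :=
  ∫ t in ball y r, ∑ k : Fin n with x k ∈ ball y r, ‖P x (t : ℂ)‖ / ‖P' x (x k)‖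

/-- `|P'/P(t + iη) + π i n ρ(x_J)|`, the deviation of the logarithmic derivative of `P` on the line
of height `η` from that of the plane wave `exp (- π i n ρ(x_J) t)`; here `y` is `x_J`. -/
noncomputable def waveDefect {n : ℕ} (x : Fin n → ℝ) (a b y t η : ℝ) : ℝ :=
  ‖P' x (t + η * Complex.I) / P x (t + η * Complex.I)
    + Real.pi * Complex.I * n * rho x a b y‖

/-- `η` is a good ordinate for `J₀ = [y - r, y + r]` (with implied constant `Cη`):
`n^(ε³/2 - 1) ≤ η ≤ n^(ε³ - 1)` and the mean square of the wave defect over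
`J₃ × [η/2, 2η]`, `J₃ = (1 - 3ε) J₀`, is bounded with a gain of `1 / log n`. -/
structure IsGoodOrdinate {n : ℕ} (x : Fin n → ℝ) (a b y r ε Cη η : ℝ) : Prop where
  lower : (n : ℝ) ^ (ε ^ 3 / 2 - 1) ≤ η
  upper : η ≤ (n : ℝ) ^ (ε ^ 3 - 1)
  meanSq : ∫ s in Set.Icc (η / 2) (2 * η), ∫ t in ball y ((1 - 3 * ε) * r),
      waveDefect x a b y t s ^ 2 ≤ Cη * (2 * r) / (η * Real.log n)

/-- `φ j` (`j ∈ ℤ`) is a smooth partition of unity on `ℝ`, with `0 ≤ φ j ≤ 1`, with `φ j` supported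
in the interval `K j = [s j, s j + L]` of length `L`, with `|φ j'| ≤ Cφ / L`, and such that every
point lies in at most `N` of the `K j`. -/
structure IsBumpPartition (φ : ℤ → ℝ → ℝ) (s : ℤ → ℝ) (L Cφ : ℝ) (N : ℕ) : Prop where
  smooth : ∀ j, ContDiff ℝ ∞ (φ j)
  mem_Icc : ∀ j t, φ j t ∈ Set.Icc (0 : ℝ) 1
  sum_eq_one : ∀ t, HasSum (fun j => φ j t) 1
  support_subset : ∀ j, Function.support (φ j) ⊆ Set.Icc (s j) (s j + L)
  deriv_le : ∀ j t, |deriv (φ j) t| ≤ Cφ / L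
  overlap : ∀ t, {j : ℤ | t ∈ Set.Icc (s j) (s j + L)}.encard ≤ N

/-- The good indices: those `j` for which `K j = [s j, s j + L]` lies in the interior of
`J₄ = (1 - 4ε) J₀` and `|P'/P(t + iη) + π i n ρ(x_J)| < 1 / (η log^{1/3} n)` for all `t ∈ K j`. -/
def goodIndices {n : ℕ} (x : Fin n → ℝ) (a b y r ε η : ℝ) (s : ℤ → ℝ) (L : ℝ) : Set ℤ :=
  {j | Set.Icc (s j) (s j + L) ⊆ interior (ball y ((1 - 4 * ε) * r)) ∧
    ∀ t ∈ Set.Icc (s j) (s j + L),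
      waveDefect x a b y t η < 1 / (η * Real.log n ^ (1 / 3 : ℝ))}

end LebesgueInterp

namespace LebesgueInterp
open Real

/-! ### The Poisson integral of `log |v - b|` -/

/-! Put `ω = π n ρ(x_J)` (`freq`). On the line of height `η` above a good interval the logarithmic
derivative of `P` is close to `-iω`, so `P(z) e^{iωz}` is almost constant there. With `lam =
log^{-1/6} n`, the defect is at most `lam²/η` and the interval has length `η/lam`. By Grönwall, a
single unimodular constant `τ_j` then makes `Re (τ_j P e^{iωz})` agree with its modulus up to a
factor `1 - O(lam)`, and likewise for the reciprocal. Both inequalities thus become statements about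
linear functionals of analytic functions, which can be moved from height `η` to the real line.

The move uses a Cauchy kernel localised by a Gaussian at a scale `H` with `η ≪ H ≪ |J₀|`. It has
mass close to 1 and first absolute moment `O(η)`. Since the bumps `φ_j` vary at scale `η/lam`,
replacing `φ_j` by its convolution with the kernel costs a relative error `O(lam)`
(`sum_norm_transfer_le`).

For (ii) the function is `e^{-iωz}/P(z)`. In the lower half plane it is exponentially small, so the
contour can be pushed down to height `-H`. What remains is a sum of residues at the nodes near `J₀`
(`norm_inv_add_sum_le`). Taking absolute values after pairing with `τ_j φ_j` gives the constant
`2π`.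

For (i), `P` is real on the real line, so `|P| ≥ Re (P S)` whenever `|Re S| ≤ 1`. The choice is `S =
(4/π) arctan q` with `q = (1-ε) τ_j e^{iωz}`, a smoothed square wave that is analytic in the upper
half plane. At height `η` the wave `q` is tiny, so `S ≈ (4/π) q` and `Re (P S) ≈ (4/π)(1-ε) |P|
e^{-ωη}`. The factor `4/π` is the first Fourier coefficient of the square wave.

Three facts about `P` support this. First, `log|P(p+iy)| + nα = ωy + small` near `x_J`
(`NodeConfig.abs_logSize_sub_le`): in the Poisson integral of `log|P| + nα`, the part outside `I₀`
gives `ωy`, and the part inside is `O(log n)` by the Lebesgue function bound and the partial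
fractions of `1/P`. Second, `ω ≫ n` (`NodeConfig.le_freq`), which makes `e^{-ωη}` negligible. Third,
zero-free intervals are short, so there are nodes in both outer quarters of `J₀`. Cauchy–Schwarz
over the gaps between nodes and the hypothesis on `J₀` then give `∫_{J₀}|P| ≪ |J₀| P₀` and `P₀
∑_{J₀} 1/|P'(x_k)| ≪ |J₀|` (`normalisation_bounds`), which turns relative errors `O(lam)` into the
stated `O(|J₀| lam)`. -/

theorem image_add_mul_tan (x : ℝ) {Y : ℝ} (hY : 0 < Y) :
    (fun φ => x + Y * tan φ) '' Set.Ioo (-(π / 2)) (π / 2) = Set.univ := by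
  refine Set.eq_univ_of_forall fun v => ?_
  obtain ⟨φ, hφ, h⟩ := Real.surjOn_tan (Set.mem_univ ((v - x) / Y))
  refine ⟨φ, hφ, ?_⟩
  simp only [h]
  field_simp
  ring

theorem hasDerivWithinAt_add_mul_tan (x Y : ℝ) :
    ∀ φ ∈ Set.Ioo (-(π / 2)) (π / 2), HasDerivWithinAt (fun φ => x + Y * tan φ)
      (Y * (1 / cos φ ^ 2)) (Set.Ioo (-(π / 2)) (π / 2)) φ := fun _ hφ =>
  (((Real.hasDerivAt_tan (cos_pos_of_mem_Ioo hφ).ne').const_mul Y).const_add x).hasDerivWithinAt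

theorem injOn_add_mul_tan (x : ℝ) {Y : ℝ} (hY : 0 < Y) :
    Set.InjOn (fun φ => x + Y * tan φ) (Set.Ioo (-(π / 2)) (π / 2)) := by
  intro s hs t ht h
  refine Real.injOn_tan hs ht ?_
  simpa [hY.ne'] using h

/-- The substitution `v = x + Y tan φ` flattens the Poisson weight: its Jacobian is exactly the
reciprocal of the kernel. -/
theorem poisson_tan_weight (x : ℝ) {Y : ℝ} (hY : 0 < Y) (g : ℝ → ℝ) {φ : ℝ}
    (hφ : φ ∈ Set.Ioo (-(π / 2)) (π / 2)) :
    |Y * (1 / cos φ ^ 2)| • (g (x + Y * tan φ) * (Y / ((x + Y * tan φ - x) ^ 2 + Y ^ 2)))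
      = g (x + Y * tan φ) := by
  have hc := cos_pos_of_mem_Ioo hφ
  rw [abs_of_pos (by positivity), tan_eq_sin_div_cos]
  have h1 : (x + Y * (sin φ / cos φ) - x) ^ 2 + Y ^ 2 = Y ^ 2 / cos φ ^ 2 := by
    field_simp
    nlinarith [sin_sq_add_cos_sq φ]
  rw [h1, smul_eq_mul]
  field_simp

theorem integrable_poisson_iff (x : ℝ) {Y : ℝ} (hY : 0 < Y) (g : ℝ → ℝ) :
    Integrable (fun v => g v * (Y / ((v - x) ^ 2 + Y ^ 2))) ↔
      IntegrableOn (fun φ => g (x + Y * tan φ)) (Set.Ioo (-(π / 2)) (π / 2)) := by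
  rw [← integrableOn_univ, ← image_add_mul_tan x hY,
    integrableOn_image_iff_integrableOn_abs_deriv_smul measurableSet_Ioo
      (hasDerivWithinAt_add_mul_tan x Y) (injOn_add_mul_tan x hY)]
  exact integrableOn_congr_fun (fun φ hφ => poisson_tan_weight x hY g hφ) measurableSet_Ioo

theorem integral_poisson_eq (x : ℝ) {Y : ℝ} (hY : 0 < Y) (g : ℝ → ℝ) :
    ∫ v, g v * (Y / ((v - x) ^ 2 + Y ^ 2)) =
      ∫ φ in Set.Ioo (-(π / 2)) (π / 2), g (x + Y * tan φ) := by
  rw [← setIntegral_univ, ← image_add_mul_tan x hY,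
    integral_image_eq_integral_abs_deriv_smul measurableSet_Ioo
      (hasDerivWithinAt_add_mul_tan x Y) (injOn_add_mul_tan x hY)]
  exact setIntegral_congr_fun measurableSet_Ioo (fun φ hφ => poisson_tan_weight x hY g hφ)

/-- As `φ` runs over an interval of length `π`, the angle `2φ` runs once around the circle. Poisson
integrals thus become circle averages, to which Jensen's formula applies. -/
theorem integral_Ioo_circle (g : ℂ → ℝ) :
    ∫ φ in Set.Ioo (-(π / 2)) (π / 2), g (Complex.exp (2 * φ * Complex.I)) =
      π * Real.circleAverage g 0 1 := by
  have hper : Function.Periodic (fun θ : ℝ => g (circleMap 0 1 θ)) (2 * π) :=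
    fun θ => by simp only [periodic_circleMap 0 1 θ]
  have h1 := hper.intervalIntegral_add_eq 0 (-π)
  rw [zero_add, show -π + 2 * π = π by ring] at h1
  rw [Real.circleAverage_def, h1, ← integral_Ioc_eq_integral_Ioo,
    ← intervalIntegral.integral_of_le (by linarith [pi_pos])]
  have h2 := intervalIntegral.integral_comp_mul_left
    (a := -(π / 2)) (b := π / 2) (fun θ : ℝ => g (circleMap 0 1 θ)) (two_ne_zero (α := ℝ))
  rw [show (2 : ℝ) * -(π / 2) = -π by ring, show (2 : ℝ) * (π / 2) = π by ring] at h2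
  simp only [circleMap_zero, Complex.ofReal_mul, Complex.ofReal_ofNat, Complex.ofReal_one,
    one_mul] at h2 ⊢
  rw [h2]
  simp only [smul_eq_mul]
  rw [mul_inv, ← mul_assoc, ← mul_assoc, mul_comm π 2⁻¹, mul_assoc 2⁻¹ π, mul_inv_cancel₀ pi_ne_zero,
    mul_one]

theorem integrableOn_Ioo_circle {g : ℂ → ℝ} (hg : CircleIntegrable g 0 1) :
    IntegrableOn (fun φ : ℝ => g (Complex.exp (2 * φ * Complex.I)))
      (Set.Ioo (-(π / 2)) (π / 2)) := by
  have hper : Function.Periodic (fun θ : ℝ => g (circleMap 0 1 θ)) (2 * π) :=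
    fun θ => by simp only [periodic_circleMap 0 1 θ]
  have h0 : IntervalIntegrable (fun θ : ℝ => g (circleMap 0 1 θ)) volume (-π) π :=
    hper.intervalIntegrable (t := 0) (by positivity) (by rw [zero_add]; exact hg) _ _
  have h2 := h0.comp_mul_left (c := 2)
  rw [show -π / 2 = -(π / 2) by ring] at h2
  rw [intervalIntegrable_iff_integrableOn_Ioo_of_le (by linarith [pi_pos])] at h2
  simpa [circleMap_zero] using h2

/-- Cayley transform: with `w = e^{2iφ}`, `A = x - iY - b` and `B = x + iY - b` one has `(v - b)(w +
1) = wA + B`. Since `|w| = 1`, the right side has modulus `|B| |w + conj (A/B)|`. -/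
theorem log_norm_tan (x Y : ℝ) (b : ℂ) (hB : (x : ℂ) + Y * Complex.I - b ≠ 0)
    {φ : ℝ} (hφ : φ ∈ Set.Ioo (-(π / 2)) (π / 2)) (hne : ((x + Y * tan φ : ℝ) : ℂ) ≠ b) :
    log ‖((x + Y * tan φ : ℝ) : ℂ) - b‖ = log ‖(x : ℂ) + Y * Complex.I - b‖ +
      log ‖Complex.exp (2 * φ * Complex.I) + (starRingEnd ℂ)
        (((x : ℂ) - Y * Complex.I - b) / ((x : ℂ) + Y * Complex.I - b))‖ -
      log ‖Complex.exp (2 * φ * Complex.I) + 1‖ := by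
  have hc := cos_pos_of_mem_Ioo hφ
  set B := (x : ℂ) + Y * Complex.I - b with hBdef
  set A := (x : ℂ) - Y * Complex.I - b with hAdef
  set E := Complex.exp (φ * Complex.I) with hE
  have hEE : Complex.exp (2 * φ * Complex.I) = E * E := by
    rw [hE, ← Complex.exp_add]; ring_nf
  have hEn : ‖E‖ = 1 := Complex.norm_exp_ofReal_mul_I φ
  have hE0 : E ≠ 0 := Complex.exp_ne_zero _
  have hconj : (starRingEnd ℂ) E = E⁻¹ := by
    rw [Complex.inv_def, Complex.normSq_eq_norm_sq, hEn]; simp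
  have hcos : (Real.cos φ : ℂ) * (2 * E) = E * E + 1 := by
    rw [Complex.ofReal_cos, Complex.cos, ← hE, neg_mul, Complex.exp_neg, ← hE]
    field_simp
  have hsin : (Real.sin φ : ℂ) * (2 * E) = -Complex.I * (E * E - 1) := by
    rw [Complex.ofReal_sin, Complex.sin, ← hE, neg_mul, Complex.exp_neg, ← hE]
    field_simp
    ring
  have hcC : (Real.cos φ : ℂ) ≠ 0 := by exact_mod_cast hc.ne'
  have key : (((x + Y * tan φ : ℝ) : ℂ) - b) * (E * E + 1) = E * E * A + B := by
    have : ((tan φ : ℝ) : ℂ) * (Real.cos φ * (2 * E)) = -Complex.I * (E * E - 1) := by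
      rw [← hsin, tan_eq_sin_div_cos]
      push_cast
      rw [Complex.ofReal_cos] at hcC
      field_simp
    rw [hcos] at this
    rw [hAdef, hBdef]
    push_cast at this ⊢
    linear_combination (Y : ℂ) * this
  have hE1 : E * E + 1 ≠ 0 := by
    rw [← hcos]; exact mul_ne_zero hcC (mul_ne_zero two_ne_zero hE0)
  have hB2 : ‖E * E * A + B‖ = ‖B‖ * ‖E * E + (starRingEnd ℂ) (A / B)‖ := by
    have e1 : E * E * A + B = B * (E * E) * ((A / B) + (starRingEnd ℂ) (E * E)) := by
      rw [map_mul, hconj]; field_simp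
    have e2 : (A / B) + (starRingEnd ℂ) (E * E) =
        (starRingEnd ℂ) (E * E + (starRingEnd ℂ) (A / B)) := by
      rw [map_add, Complex.conj_conj]; ring
    rw [e1, e2, norm_mul, norm_mul, norm_mul, hEn, Complex.norm_conj]; ring
  have h3 : ‖((x + Y * tan φ : ℝ) : ℂ) - b‖ * ‖E * E + 1‖ =
      ‖B‖ * ‖E * E + (starRingEnd ℂ) (A / B)‖ := by
    rw [← hB2, ← key, norm_mul]
  have hl : ‖((x + Y * tan φ : ℝ) : ℂ) - b‖ ≠ 0 := norm_ne_zero_iff.mpr (sub_ne_zero.mpr hne)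
  have hl2 : ‖E * E + 1‖ ≠ 0 := norm_ne_zero_iff.mpr hE1
  have hl3 : ‖B‖ ≠ 0 := norm_ne_zero_iff.mpr hB
  have hl4 : ‖E * E + (starRingEnd ℂ) (A / B)‖ ≠ 0 := by
    intro h; rw [h, mul_zero] at h3; exact mul_ne_zero hl hl2 h3
  have h4 := congrArg log h3
  rw [log_mul hl hl2, log_mul hl3 hl4] at h4
  rw [hEE]
  linarith

/-- For `Im b ≤ 0` the point `conj (A/B)` lies in the closed unit disc, so Jensen's formula makes
both circle averages vanish and only `log |B|` survives. The boundary case of real `b`, where `log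
|v - b|` is singular on the line, is the one needed for the nodes. -/
theorem poisson_log (x : ℝ) {Y : ℝ} (hY : 0 < Y) {b : ℂ} (hb : b.im ≤ 0) :
    Integrable (fun v : ℝ => log ‖(v : ℂ) - b‖ * (Y / ((v - x) ^ 2 + Y ^ 2))) ∧
    ∫ v : ℝ, log ‖(v : ℂ) - b‖ * (Y / ((v - x) ^ 2 + Y ^ 2)) =
      π * log ‖(x : ℂ) + Y * Complex.I - b‖ := by
  have hB : (x : ℂ) + Y * Complex.I - b ≠ 0 := by
    intro h
    have := congrArg Complex.im h
    simp at this
    linarith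
  set c := (starRingEnd ℂ) (((x : ℂ) - Y * Complex.I - b) / ((x : ℂ) + Y * Complex.I - b)) with hc
  have hcn : ‖c‖ ≤ 1 := by
    rw [hc, Complex.norm_conj, norm_div, div_le_one (norm_pos_iff.mpr hB)]
    rw [← sq_le_sq₀ (norm_nonneg _) (norm_nonneg _), ← Complex.normSq_eq_norm_sq,
      ← Complex.normSq_eq_norm_sq, Complex.normSq_apply, Complex.normSq_apply]
    simp
    nlinarith
  set h : ℂ → ℝ := fun z => log ‖(x : ℂ) + Y * Complex.I - b‖ + log ‖z - -c‖ - log ‖z - -1‖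
    with hh
  have hae : ∀ᵐ φ : ℝ ∂(volume.restrict (Set.Ioo (-(π / 2)) (π / 2))),
      (fun v : ℝ => log ‖(v : ℂ) - b‖) (x + Y * tan φ) =
        h (Complex.exp (2 * φ * Complex.I)) := by
    have hfin : {φ : ℝ | φ ∈ Set.Ioo (-(π / 2)) (π / 2) ∧
        ((x + Y * tan φ : ℝ) : ℂ) = b}.Subsingleton := by
      intro s hs t ht
      refine injOn_add_mul_tan x hY hs.1 ht.1 ?_
      exact_mod_cast hs.2.trans ht.2.symm
    have h0 := hfin.countable.ae_notMem volume
    rw [ae_restrict_iff' measurableSet_Ioo]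
    filter_upwards [h0] with φ h1 h2
    have hne : ((x + Y * tan φ : ℝ) : ℂ) ≠ b := fun he => h1 ⟨h2, he⟩
    simp only [hh, sub_neg_eq_add]
    exact log_norm_tan x Y b hB h2 hne
  have hci : ∀ a : ℂ, CircleIntegrable (fun z => log ‖z - a‖) 0 1 := fun a =>
    circleIntegrable_log_norm_sub_const 1
  have hconst : CircleIntegrable (fun _ : ℂ => log ‖(x : ℂ) + Y * Complex.I - b‖) 0 1 :=
    circleIntegrable_const _ _ _
  have h1i : CircleIntegrable
      (fun z => log ‖(x : ℂ) + Y * Complex.I - b‖ + log ‖z - -c‖) 0 1 :=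
    hconst.add (hci (-c))
  have hhi : CircleIntegrable h 0 1 := h1i.sub (hci (-1))
  have havg : Real.circleAverage h 0 1 = log ‖(x : ℂ) + Y * Complex.I - b‖ := by
    have e1 : Real.circleAverage h 0 1 = Real.circleAverage
        (fun z => log ‖(x : ℂ) + Y * Complex.I - b‖ + log ‖z - -c‖) 0 1 -
        Real.circleAverage (fun z => log ‖z - -1‖) 0 1 :=
      Real.circleAverage_sub h1i (hci (-1))
    have e2 : Real.circleAverage
        (fun z => log ‖(x : ℂ) + Y * Complex.I - b‖ + log ‖z - -c‖) 0 1 =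
        Real.circleAverage (fun _ => log ‖(x : ℂ) + Y * Complex.I - b‖) 0 1 +
        Real.circleAverage (fun z => log ‖z - -c‖) 0 1 :=
      Real.circleAverage_add hconst (hci (-c))
    rw [e1, e2, Real.circleAverage_const, circleAverage_log_norm_sub_const_eq_posLog,
      circleAverage_log_norm_sub_const_eq_posLog, norm_neg, norm_neg,
      posLog_eq_zero_iff _ |>.mpr (by simpa using hcn),
      posLog_eq_zero_iff _ |>.mpr (by simp)]
    ring
  constructor
  · rw [integrable_poisson_iff x hY (fun v : ℝ => log ‖(v : ℂ) - b‖)]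
    exact (integrableOn_Ioo_circle hhi).congr (hae.mono fun _ h => h.symm)
  · rw [integral_poisson_eq x hY (fun v : ℝ => log ‖(v : ℂ) - b‖), integral_congr_ae hae,
      integral_Ioo_circle, havg]

/-! ### The node polynomial -/

/-- The sum `∑ k, 1 / |P'(x k)| = exp (n α)`. -/
noncomputable def nodeMass {n : ℕ} (x : Fin n → ℝ) : ℝ := ∑ k : Fin n, 1 / ‖P' x (x k)‖

/-- The function `log |P| + n α = -n (U_μ - α)`. -/
noncomputable def logSize {n : ℕ} (x : Fin n → ℝ) (z : ℂ) : ℝ :=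
  ∑ i : Fin n, log ‖z - (x i : ℂ)‖ + n * alpha x

/-- Partial fractions, read off from Lagrange interpolation of the constant 1. -/
theorem inv_prod_sub_eq_sum {ι : Type*} [DecidableEq ι] (s : Finset ι) (hs : s.Nonempty)
    (v : ι → ℂ) (hv : Set.InjOn v s) {z : ℂ} (hz : ∀ i ∈ s, z ≠ v i) :
    (∏ i ∈ s, (z - v i))⁻¹ = ∑ i ∈ s, (∏ j ∈ s.erase i, (v i - v j))⁻¹ * (z - v i)⁻¹ := by
  have h1 := Lagrange.eval_interpolate_not_at_node (s := s) (v := v) (fun _ => (1 : ℂ)) hz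
  have h2 : Lagrange.interpolate s v (fun _ => (1 : ℂ)) = 1 := by
    rw [Lagrange.interpolate_apply]
    simp only [map_one, one_mul]
    exact Lagrange.sum_basis hv hs
  rw [h2, Polynomial.eval_one, Lagrange.eval_nodal] at h1
  simp only [mul_one] at h1
  have h3 : ∏ i ∈ s, (z - v i) ≠ 0 := Finset.prod_ne_zero_iff.mpr fun i hi => sub_ne_zero.mpr (hz i hi)
  rw [inv_eq_of_mul_eq_one_right h1.symm]
  refine Finset.sum_congr rfl fun i _ => ?_
  rw [Lagrange.nodalWeight, Finset.prod_inv_distrib]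

variable {n : ℕ} {x : Fin n → ℝ}

theorem P_eq_prod (x : Fin n → ℝ) (z : ℂ) : P x z = ∏ i, (z - x i) := by
  simp [P, nodePoly, Lagrange.nodal_eq, map_prod]

theorem P_ofReal (x : Fin n → ℝ) (t : ℝ) : P x t = ((∏ i, (t - x i) : ℝ) : ℂ) := by
  rw [P_eq_prod]; push_cast; rfl

theorem norm_P (x : Fin n → ℝ) (z : ℂ) : ‖P x z‖ = ∏ i, ‖z - x i‖ := by
  rw [P_eq_prod, norm_prod]

theorem P'_ofReal (x : Fin n → ℝ) (t : ℝ) :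
    P' x t = ((Polynomial.eval t (Polynomial.derivative (nodePoly x)) : ℝ) : ℂ) := by
  rw [P', ← Complex.coe_algebraMap, Polynomial.aeval_algebraMap_apply]
  simp

theorem eval_derivative_nodePoly (x : Fin n → ℝ) (k : Fin n) :
    Polynomial.eval (x k) (Polynomial.derivative (nodePoly x)) =
      ∏ i ∈ Finset.univ.erase k, (x k - x i) := by
  rw [nodePoly, Lagrange.eval_nodal_derivative_eval_node_eq (Finset.mem_univ k), Lagrange.eval_nodal]

theorem P'_node (x : Fin n → ℝ) (k : Fin n) :
    P' x (x k) = ∏ i ∈ Finset.univ.erase k, ((x k : ℂ) - x i) := by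
  rw [P'_ofReal, eval_derivative_nodePoly]
  push_cast; rfl

theorem norm_P'_node (x : Fin n → ℝ) (k : Fin n) :
    ‖P' x (x k)‖ = ∏ i ∈ Finset.univ.erase k, |x k - x i| := by
  rw [P'_ofReal, eval_derivative_nodePoly, Complex.norm_real, norm_prod]; rfl

theorem norm_P'_node_pos (hx : Function.Injective x) (k : Fin n) : 0 < ‖P' x (x k)‖ := by
  rw [norm_P'_node]
  refine Finset.prod_pos fun i hi => abs_pos.mpr (sub_ne_zero.mpr fun h => ?_)
  exact (Finset.mem_erase.mp hi).1 (hx h).symm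

theorem norm_P'_node_le (hx : ∀ i, x i ∈ Set.Icc (-1 : ℝ) 1) (k : Fin n) :
    ‖P' x (x k)‖ ≤ 2 ^ n := by
  rw [norm_P'_node]
  calc ∏ i ∈ Finset.univ.erase k, |x k - x i| ≤ ∏ _i ∈ Finset.univ.erase k, (2 : ℝ) := by
        refine Finset.prod_le_prod (fun _ _ => abs_nonneg _) fun i _ => ?_
        rw [abs_le]
        constructor <;> linarith [(hx k).1, (hx k).2, (hx i).1, (hx i).2]
    _ = 2 ^ (n - 1) := by simp
    _ ≤ 2 ^ n := pow_le_pow_right₀ (by norm_num) (by omega)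

theorem P_ne_zero {z : ℂ} (hz : ∀ i, z ≠ x i) : P x z ≠ 0 := by
  rw [P_eq_prod]
  exact Finset.prod_ne_zero_iff.mpr fun i _ => sub_ne_zero.mpr (hz i)

theorem ne_node_of_im_ne_zero {z : ℂ} (hz : z.im ≠ 0) (i : Fin n) : z ≠ x i := by
  rintro rfl; simp at hz

theorem hasDerivAt_P (x : Fin n → ℝ) (z : ℂ) : HasDerivAt (P x) (P' x z) z := by
  exact (nodePoly x).hasDerivAt_aeval z

theorem continuous_P (x : Fin n → ℝ) : Continuous (P x) :=
  (nodePoly x).continuous_aeval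

theorem inv_P_eq_sum (hn : 0 < n) (hx : Function.Injective x) {z : ℂ} (hz : ∀ i, z ≠ x i) :
    (P x z)⁻¹ = ∑ k, (P' x (x k))⁻¹ * (z - x k)⁻¹ := by
  have : Nonempty (Fin n) := ⟨⟨0, hn⟩⟩
  rw [P_eq_prod, inv_prod_sub_eq_sum Finset.univ Finset.univ_nonempty (fun i => (x i : ℂ))
    (fun i _ j _ h => hx (Complex.ofReal_injective h)) (fun i _ => hz i)]
  simp_rw [P'_node]

theorem nodeMass_pos (hn : 0 < n) (hx : Function.Injective x) : 0 < nodeMass x := by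
  have : Nonempty (Fin n) := ⟨⟨0, hn⟩⟩
  exact Finset.sum_pos (fun k _ => one_div_pos.mpr (norm_P'_node_pos hx k)) Finset.univ_nonempty

theorem nat_mul_alpha (hn : 0 < n) (x : Fin n → ℝ) : n * alpha x = log (nodeMass x) := by
  have : (n : ℝ) ≠ 0 := by positivity
  rw [alpha, nodeMass]; field_simp

theorem nodeMass_lower (hn : 0 < n) (hx : Function.Injective x)
    (hx1 : ∀ i, x i ∈ Set.Icc (-1 : ℝ) 1) : (2 ^ n)⁻¹ ≤ nodeMass x := by
  have h := Finset.single_le_sum (f := fun k => 1 / ‖P' x (x k)‖) (s := Finset.univ)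
    (fun k _ => by positivity) (Finset.mem_univ (⟨0, hn⟩ : Fin n))
  refine le_trans ?_ h
  rw [← one_div]
  exact one_div_le_one_div_of_le (norm_P'_node_pos hx _) (norm_P'_node_le hx1 _)

theorem exp_logSize (hn : 0 < n) (hx : Function.Injective x) {z : ℂ} (hz : ∀ i, z ≠ x i) :
    exp (logSize x z) = ‖P x z‖ * nodeMass x := by
  rw [logSize, exp_add, nat_mul_alpha hn, exp_log (nodeMass_pos hn hx), exp_sum, norm_P]
  congr 1
  exact Finset.prod_congr rfl fun i _ => exp_log (norm_pos_iff.mpr (sub_ne_zero.mpr (hz i)))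

/-- Only an inequality survives at the nodes: there `P` vanishes, whereas `log 0 = 0` keeps
`logSize` finite. -/
theorem norm_P_mul_le_exp_logSize (hn : 0 < n) (hx : Function.Injective x) (z : ℂ) :
    ‖P x z‖ * nodeMass x ≤ exp (logSize x z) := by
  by_cases hz : ∀ i, z ≠ x i
  · exact (exp_logSize hn hx hz).ge
  · push Not at hz
    obtain ⟨i, hi⟩ := hz
    have : P x z = 0 := by
      rw [P_eq_prod]; exact Finset.prod_eq_zero (Finset.mem_univ i) (by rw [hi, sub_self])
    rw [this]; simp [exp_nonneg]

/-- The partial fractions of `1/P` have total coefficient mass `nodeMass`, so `1/|P|` is at most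
`nodeMass` divided by the distance to the nodes. This is the lower bound for `|P|` used throughout.
-/
theorem le_norm_P_mul (hn : 0 < n) (hx : Function.Injective x) {z : ℂ} {δ : ℝ} (hδ : 0 < δ)
    (hz : ∀ i, δ ≤ ‖z - x i‖) : δ ≤ ‖P x z‖ * nodeMass x := by
  have hne : ∀ i, z ≠ x i := fun i h => by
    have := hz i; rw [h, sub_self, norm_zero] at this; linarith
  have h1 : ‖(P x z)⁻¹‖ ≤ nodeMass x * δ⁻¹ := by
    rw [inv_P_eq_sum hn hx hne, nodeMass, Finset.sum_mul]
    refine (norm_sum_le _ _).trans (Finset.sum_le_sum fun k _ => ?_)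
    rw [norm_mul, norm_inv, norm_inv, one_div]
    gcongr
    exact hz k
  have hP : 0 < ‖P x z‖ := norm_pos_iff.mpr (P_ne_zero hne)
  rw [norm_inv, ← div_eq_mul_inv, inv_le_iff_one_le_mul₀ hP, div_mul_eq_mul_div, le_div_iff₀ hδ] at h1
  linarith

theorem log_le_logSize (hn : 0 < n) (hx : Function.Injective x) {z : ℂ} {δ : ℝ} (hδ : 0 < δ)
    (hz : ∀ i, δ ≤ ‖z - x i‖) : log δ ≤ logSize x z := by
  have hne : ∀ i, z ≠ x i := fun i h => by
    have := hz i; rw [h, sub_self, norm_zero] at this; linarith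
  rw [← log_exp (logSize x z), exp_logSize hn hx hne]
  exact log_le_log hδ (le_norm_P_mul hn hx hδ hz)

/-- Termwise `|P(t)|/|P'(x_k)| = |t - x_k| |ℓ_k(t)|`, and points of `[-1, 1]` are at most 2 apart.
-/
theorem norm_P_mul_le_lebesgueFun (hx : Function.Injective x)
    (hx1 : ∀ i, x i ∈ Set.Icc (-1 : ℝ) 1) {t : ℝ} (ht : t ∈ Set.Icc (-1 : ℝ) 1) :
    ‖P x t‖ * nodeMass x ≤ 2 * lebesgueFun x t := by
  rw [nodeMass, lebesgueFun, Finset.mul_sum, Finset.mul_sum]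
  refine Finset.sum_le_sum fun k _ => ?_
  have hp := norm_P'_node_pos hx k
  rw [norm_P'_node] at hp
  have hb : |(Lagrange.basis Finset.univ x k).eval t| * ∏ i ∈ Finset.univ.erase k, |x k - x i| =
      ∏ i ∈ Finset.univ.erase k, |t - x i| := by
    rw [Lagrange.basis, Polynomial.eval_prod, Finset.abs_prod, ← Finset.prod_mul_distrib]
    refine Finset.prod_congr rfl fun i hi => ?_
    have hne : x k - x i ≠ 0 := sub_ne_zero.mpr fun h => (Finset.mem_erase.mp hi).1 (hx h).symm
    rw [Lagrange.basisDivisor]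
    simp only [Polynomial.eval_mul, Polynomial.eval_C, Polynomial.eval_sub, Polynomial.eval_X]
    rw [← abs_mul]
    congr 1
    field_simp
  have hP : ‖P x t‖ = |t - x k| * ∏ i ∈ Finset.univ.erase k, |t - x i| := by
    rw [P_ofReal, Complex.norm_real, norm_prod, ← Finset.mul_prod_erase _ _ (Finset.mem_univ k)]
    rfl
  have h2 : |t - x k| ≤ 2 := by
    rw [abs_le]; constructor <;> linarith [(hx1 k).1, (hx1 k).2, ht.1, ht.2]
  rw [hP, norm_P'_node, mul_one_div, div_le_iff₀ hp, mul_assoc, hb]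
  exact mul_le_mul_of_nonneg_right h2 (Finset.prod_nonneg fun _ _ => abs_nonneg _)

/-- The distance to the nearest node bounds `exp (logSize)` from below. Splitting its logarithm at
`n⁻³` leaves a `log n` term and a singular part whose integral is `O(n⁻²)`, small enough to survive
multiplication by a Poisson kernel as large as `n`. -/
theorem logSize_ofReal_lower (hn : 0 < n) (hx : Function.Injective x) {v : ℝ}
    (hv : ∀ i, v ≠ x i) :
    -(3 * log n) - ∑ i, posLog ((n ^ 3 * |v - x i|)⁻¹) ≤ logSize x v := by
  have : Nonempty (Fin n) := ⟨⟨0, hn⟩⟩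
  obtain ⟨k, -, hk⟩ := Finset.exists_min_image Finset.univ (fun i => |v - x i|)
    Finset.univ_nonempty
  have hd : 0 < |v - x k| := abs_pos.mpr (sub_ne_zero.mpr (hv k))
  have h1 : log |v - x k| ≤ logSize x v := by
    refine log_le_logSize hn hx hd fun i => ?_
    rw [← Complex.ofReal_sub, Complex.norm_real]
    exact hk i (Finset.mem_univ i)
  refine le_trans ?_ h1
  have h2 : posLog (((n : ℝ) ^ 3 * |v - x k|)⁻¹) ≤
      ∑ i, posLog (((n : ℝ) ^ 3 * |v - x i|)⁻¹) :=
    Finset.single_le_sum (f := fun i => posLog (((n : ℝ) ^ 3 * |v - x i|)⁻¹))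
      (fun i _ => posLog_nonneg) (Finset.mem_univ k)
  have h3 : log (((n : ℝ) ^ 3 * |v - x k|)⁻¹) ≤ posLog (((n : ℝ) ^ 3 * |v - x k|)⁻¹) :=
    le_max_right _ _
  have hn' : (0 : ℝ) < n := by exact_mod_cast hn
  rw [log_inv, log_mul (by positivity) hd.ne', log_pow] at h3
  push_cast at h3
  linarith

/-! ### Estimates for the potential -/

theorem poisson_one (x : ℝ) {Y : ℝ} (hY : 0 < Y) :
    Integrable (fun v : ℝ => Y / ((v - x) ^ 2 + Y ^ 2)) ∧
      ∫ v : ℝ, Y / ((v - x) ^ 2 + Y ^ 2) = π := by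
  have h1 := integrable_poisson_iff x hY (fun _ => 1)
  have h2 := integral_poisson_eq x hY (fun _ => 1)
  simp only [one_mul] at h1 h2
  refine ⟨h1.mpr (by simp), ?_⟩
  rw [h2, setIntegral_const]
  simp [measureReal_def, Real.volume_Ioo]
  exact pi_pos.le

theorem poisson_nonneg (x v : ℝ) {Y : ℝ} (hY : 0 < Y) : 0 ≤ Y / ((v - x) ^ 2 + Y ^ 2) := by
  positivity

theorem poisson_le (x v : ℝ) {Y : ℝ} (hY : 0 < Y) : Y / ((v - x) ^ 2 + Y ^ 2) ≤ 1 / Y := by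
  rw [div_le_div_iff₀ (by positivity) hY]
  nlinarith [sq_nonneg (v - x)]

theorem integral_posLog_inv {N : ℝ} (hN : 1 ≤ N) :
    Integrable (fun v : ℝ => posLog ((N * |v|)⁻¹)) ∧
      ∫ v : ℝ, posLog ((N * |v|)⁻¹) ≤ 2 / N := by
  have hN0 : 0 < N := by linarith
  have hi : (0 : ℝ) < N⁻¹ := by positivity
  have hae : (fun v : ℝ => posLog ((N * |v|)⁻¹)) =ᵐ[volume]
      (Set.Ioc (-N⁻¹) N⁻¹).indicator (fun v => -(log N + log v)) := by
    have h0 : ∀ᵐ v : ℝ, v ∉ ({0, -N⁻¹} : Set ℝ) :=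
      (Set.toFinite {0, -N⁻¹}).countable.ae_notMem volume
    filter_upwards [h0] with v hv
    simp only [Set.mem_insert_iff, Set.mem_singleton_iff, not_or] at hv
    have hv0 : 0 < |v| := abs_pos.mpr hv.1
    have hlog : log ((N * |v|)⁻¹) = -(log N + log v) := by
      rw [log_inv, log_mul hN0.ne' hv0.ne', log_abs]
    by_cases h : v ∈ Set.Ioc (-N⁻¹) N⁻¹
    · rw [Set.indicator_of_mem h, ← hlog]
      refine posLog_eq_log ?_
      have : |v| ≤ N⁻¹ := abs_le.mpr ⟨h.1.le, h.2⟩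
      rw [abs_of_pos (by positivity), one_le_inv₀ (by positivity)]
      calc N * |v| ≤ N * N⁻¹ := by gcongr
        _ = 1 := mul_inv_cancel₀ hN0.ne'
    · rw [Set.indicator_of_notMem h, posLog_eq_zero_iff, abs_of_pos (by positivity),
        inv_le_one₀ (by positivity)]
      have : N⁻¹ ≤ |v| := by
        by_contra! hlt
        exact h ⟨(abs_lt.mp hlt).1, (abs_lt.mp hlt).2.le⟩
      calc (1 : ℝ) = N * N⁻¹ := (mul_inv_cancel₀ hN0.ne').symm
        _ ≤ N * |v| := by gcongr
  have hint : IntervalIntegrable (fun v => -(log N + log v)) volume (-N⁻¹) N⁻¹ :=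
    ((intervalIntegrable_const).add intervalIntegral.intervalIntegrable_log').neg
  have hion : IntegrableOn (fun v => -(log N + log v)) (Set.Ioc (-N⁻¹) N⁻¹) :=
    (intervalIntegrable_iff_integrableOn_Ioc_of_le (by linarith)).mp hint
  refine ⟨((integrable_indicator_iff measurableSet_Ioc).mpr hion).congr hae.symm, ?_⟩
  rw [integral_congr_ae hae, integral_indicator measurableSet_Ioc,
    ← intervalIntegral.integral_of_le (by linarith), intervalIntegral.integral_neg,
    intervalIntegral.integral_add intervalIntegrable_const intervalIntegral.intervalIntegrable_log',
    intervalIntegral.integral_const, integral_log]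
  simp only [log_neg_eq_log, log_inv, smul_eq_mul]
  apply le_of_eq
  field_simp
  ring

theorem integral_posLog_inv_sub {N : ℝ} (hN : 1 ≤ N) (p : ℝ) :
    Integrable (fun v : ℝ => posLog ((N * |v - p|)⁻¹)) ∧
      ∫ v : ℝ, posLog ((N * |v - p|)⁻¹) ≤ 2 / N := by
  have h := integral_posLog_inv hN
  refine ⟨h.1.comp_sub_right p, ?_⟩
  rw [integral_sub_right_eq_self (fun v : ℝ => posLog ((N * |v|)⁻¹)) p]
  exact h.2

variable {n : ℕ} {x : Fin n → ℝ}

theorem integrable_sum_posLog (hn : 1 ≤ n) (x : Fin n → ℝ) :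
    Integrable (fun v : ℝ => ∑ i, posLog (((n : ℝ) ^ 3 * |v - x i|)⁻¹)) ∧
      ∫ v : ℝ, ∑ i, posLog (((n : ℝ) ^ 3 * |v - x i|)⁻¹) ≤ 2 / n ^ 2 := by
  have hn' : (1 : ℝ) ≤ n := by exact_mod_cast hn
  have hN : (1 : ℝ) ≤ (n : ℝ) ^ 3 := one_le_pow₀ hn'
  have h := fun i => integral_posLog_inv_sub hN (x i)
  refine ⟨integrable_finsetSum _ fun i _ => (h i).1, ?_⟩
  rw [integral_finsetSum _ fun i _ => (h i).1]
  calc _ ≤ ∑ _i : Fin n, 2 / (n : ℝ) ^ 3 := Finset.sum_le_sum fun i _ => (h i).2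
    _ = 2 / n ^ 2 := by
      rw [Finset.sum_const, Finset.card_univ, Fintype.card_fin, nsmul_eq_mul]
      field_simp

theorem poisson_logSize (x : Fin n → ℝ) (p : ℝ) {Y : ℝ} (hY : 0 < Y) :
    Integrable (fun v : ℝ => logSize x v * (Y / ((v - p) ^ 2 + Y ^ 2))) ∧
    ∫ v : ℝ, logSize x v * (Y / ((v - p) ^ 2 + Y ^ 2)) =
      π * logSize x (p + Y * Complex.I) := by
  have h := fun i => poisson_log p hY (b := (x i : ℂ)) (by simp)
  have h1 := poisson_one p hY
  have e : (fun v : ℝ => logSize x v * (Y / ((v - p) ^ 2 + Y ^ 2))) = fun v : ℝ =>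
      ∑ i, log ‖(v : ℂ) - x i‖ * (Y / ((v - p) ^ 2 + Y ^ 2)) +
        n * alpha x * (Y / ((v - p) ^ 2 + Y ^ 2)) := by
    funext v; rw [logSize, add_mul, Finset.sum_mul]
  rw [e]
  have hs := integrable_finsetSum Finset.univ fun i (_ : i ∈ Finset.univ) => (h i).1
  refine ⟨hs.add (h1.1.const_mul _), ?_⟩
  rw [integral_add hs (h1.1.const_mul _), integral_finsetSum _ fun i _ => (h i).1,
    integral_const_mul, h1.2]
  simp only [(h _).2, logSize]
  rw [← Finset.mul_sum]
  ring

/-- Shifting the singularity to `p - i` gives a majorant `B ≥ max (1, |v - p|)`, whence `|log |v-p||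
≤ 2 log B - log |v-p|`. The right side is integrated exactly by `poisson_log`. -/
theorem integral_abs_log_le {p q : ℝ} (hp : p ∈ Set.Icc (-1 : ℝ) 1) (hq : q ∈ Set.Icc (-1 : ℝ) 1) :
    Integrable (fun v : ℝ => |log ‖(v : ℂ) - p‖| * (1 / ((v - q) ^ 2 + 1 ^ 2))) ∧
      ∫ v : ℝ, |log ‖(v : ℂ) - p‖| * (1 / ((v - q) ^ 2 + 1 ^ 2)) ≤ 4 * π := by
  have h1 := poisson_log q one_pos (b := (p : ℂ)) (by simp)
  have h2 := poisson_log q one_pos (b := (p : ℂ) - Complex.I) (by simp)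
  have hi : Integrable (fun v : ℝ => |log ‖(v : ℂ) - p‖| * (1 / ((v - q) ^ 2 + 1 ^ 2))) := by
    refine h1.1.abs.congr (Filter.Eventually.of_forall fun v => ?_)
    simp only [abs_mul]
    rw [abs_of_nonneg (poisson_nonneg q v one_pos)]
  refine ⟨hi, ?_⟩
  have hle : ∀ v : ℝ, |log ‖(v : ℂ) - p‖| * (1 / ((v - q) ^ 2 + 1 ^ 2)) ≤
      2 * (log ‖(v : ℂ) - (p - Complex.I)‖ * (1 / ((v - q) ^ 2 + 1 ^ 2))) -
        log ‖(v : ℂ) - p‖ * (1 / ((v - q) ^ 2 + 1 ^ 2)) := by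
    intro v
    rw [← mul_assoc, ← sub_mul]
    refine mul_le_mul_of_nonneg_right ?_ (poisson_nonneg q v one_pos)
    set B := ‖(v : ℂ) - (p - Complex.I)‖
    have hB1 : 1 ≤ B := by
      have := Complex.abs_im_le_norm ((v : ℂ) - (p - Complex.I))
      simpa using this
    have hB2 : ‖(v : ℂ) - p‖ ≤ B := by
      have := Complex.abs_re_le_norm ((v : ℂ) - (p - Complex.I))
      rw [← Complex.ofReal_sub, Complex.norm_real]
      simpa using this
    have hlB : 0 ≤ log B := log_nonneg hB1
    have hle : log ‖(v : ℂ) - p‖ ≤ log B := by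
      rcases eq_or_lt_of_le (norm_nonneg ((v : ℂ) - p)) with h0 | h0
      · rw [← h0, log_zero]; exact hlB
      · exact log_le_log h0 hB2
    rw [abs_le]; constructor <;> linarith
  have hi2 : Integrable (fun v : ℝ =>
      2 * (log ‖(v : ℂ) - (p - Complex.I)‖ * (1 / ((v - q) ^ 2 + 1 ^ 2))) -
        log ‖(v : ℂ) - p‖ * (1 / ((v - q) ^ 2 + 1 ^ 2))) := (h2.1.const_mul 2).sub h1.1
  refine (integral_mono hi hi2 hle).trans ?_
  rw [integral_sub (h2.1.const_mul 2) h1.1, integral_const_mul, h1.2, h2.2]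
  have hn1 : 0 ≤ log ‖(q : ℂ) + (1 : ℝ) * Complex.I - p‖ := by
    refine log_nonneg ?_
    have := Complex.abs_im_le_norm ((q : ℂ) + (1 : ℝ) * Complex.I - p)
    simpa using this
  have hn2 : log ‖(q : ℂ) + (1 : ℝ) * Complex.I - (p - Complex.I)‖ ≤ 2 := by
    have hle4 : ‖(q : ℂ) + (1 : ℝ) * Complex.I - (p - Complex.I)‖ ≤ 4 := by
      refine (Complex.norm_le_abs_re_add_abs_im _).trans ?_
      have : |q - p| ≤ 2 := by
        rw [abs_le]; constructor <;> linarith [hp.1, hp.2, hq.1, hq.2]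
      simp
      norm_num
      linarith
    have hpos : 0 < ‖(q : ℂ) + (1 : ℝ) * Complex.I - (p - Complex.I)‖ := by
      refine norm_pos_iff.mpr fun h => ?_
      have := congrArg Complex.im h
      norm_num at this
    have h3 := log_le_log hpos hle4
    have : log (4 : ℝ) ≤ 2 := by
      rw [show (4 : ℝ) = 2 ^ 2 by norm_num, log_pow]
      have := log_two_lt_d9
      push_cast; linarith
    linarith
  nlinarith [pi_pos]

/-! ### Consequences of a small Lebesgue function: bounds for `α` and for the potential. -/

variable {n : ℕ} {x : Fin n → ℝ}

/-- Nodes in `[-1, 1]` whose Lebesgue function has mass at most `CL log n` on `[a, b]`, and a point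
`q` at distance at least `δ` from the complement of `[a, b]`. -/
structure NodeConfig {n : ℕ} (x : Fin n → ℝ) (a b q δ CL : ℝ) : Prop where
  three_le : 3 ≤ n
  inj : Function.Injective x
  mem : ∀ i, x i ∈ Set.Icc (-1 : ℝ) 1
  ha : -1 ≤ a
  hb : b ≤ 1
  δ_pos : 0 < δ
  left : a + δ ≤ q
  right : q + δ ≤ b
  CL_nonneg : 0 ≤ CL
  lebesgue : ∫ t in Set.Icc a b, lebesgueFun x t ≤ CL * log n

theorem integral_abs_logSize_le (x : Fin n → ℝ) (hx : ∀ i, x i ∈ Set.Icc (-1 : ℝ) 1)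
    {q : ℝ} (hq : q ∈ Set.Icc (-1 : ℝ) 1) :
    Integrable (fun v : ℝ => |logSize x v| * (1 / ((v - q) ^ 2 + 1 ^ 2))) ∧
      ∫ v : ℝ, |logSize x v| * (1 / ((v - q) ^ 2 + 1 ^ 2)) ≤ n * (4 + |alpha x|) * π := by
  have h1 := fun i => integral_abs_log_le (hx i) hq
  have h2 := poisson_one q one_pos
  have hi : Integrable (fun v : ℝ => |logSize x v| * (1 / ((v - q) ^ 2 + 1 ^ 2))) := by
    refine (poisson_logSize x q one_pos).1.abs.congr (Filter.Eventually.of_forall fun v => ?_)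
    simp only [abs_mul]
    rw [abs_of_nonneg (poisson_nonneg q v one_pos)]
  refine ⟨hi, ?_⟩
  have hs := integrable_finsetSum Finset.univ fun i (_ : i ∈ Finset.univ) => (h1 i).1
  have hi2 : Integrable (fun v : ℝ =>
      ∑ i, |log ‖(v : ℂ) - x i‖| * (1 / ((v - q) ^ 2 + 1 ^ 2)) +
        n * |alpha x| * (1 / ((v - q) ^ 2 + 1 ^ 2))) := hs.add (h2.1.const_mul _)
  refine (integral_mono hi hi2 fun v => ?_).trans ?_
  · simp only
    rw [← Finset.sum_mul, ← add_mul]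
    refine mul_le_mul_of_nonneg_right ?_ (poisson_nonneg q v one_pos)
    rw [logSize]
    refine (abs_add_le _ _).trans (add_le_add (Finset.abs_sum_le_sum_abs _ _) ?_)
    rw [abs_mul, Nat.abs_cast]
  · rw [integral_add hs (h2.1.const_mul _), integral_finsetSum _ fun i _ => (h1 i).1,
      integral_const_mul, h2.2]
    have : ∑ i, ∫ v : ℝ, |log ‖(v : ℂ) - x i‖| * (1 / ((v - q) ^ 2 + 1 ^ 2)) ≤
        ∑ _i : Fin n, 4 * π := Finset.sum_le_sum fun i _ => (h1 i).2
    simp only [Finset.sum_const, Finset.card_univ, Fintype.card_fin, nsmul_eq_mul] at this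
    linarith

theorem ae_ne_nodes (x : Fin n → ℝ) : ∀ᵐ v : ℝ, ∀ i, v ≠ x i := by
  have h := (Set.finite_range x).countable.ae_notMem volume
  filter_upwards [h] with v hv i hi
  exact hv ⟨i, hi.symm⟩

theorem continuous_lebesgueFun (x : Fin n → ℝ) : Continuous (lebesgueFun x) :=
  continuous_finsetSum _ fun _ _ => (Polynomial.continuous _).abs

theorem continuous_norm_P (x : Fin n → ℝ) : Continuous fun t : ℝ => ‖P x t‖ :=
  ((continuous_P x).comp Complex.continuous_ofReal).norm

theorem measurable_logSize (x : Fin n → ℝ) : Measurable fun v : ℝ => logSize x v := by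
  unfold logSize
  fun_prop

namespace NodeConfig

variable {a b q δ CL : ℝ}

theorem pos (h : NodeConfig x a b q δ CL) : 0 < n := by have := h.three_le; omega

theorem one_le_log (h : NodeConfig x a b q δ CL) : 1 ≤ log n := by
  have h3 : (3 : ℝ) ≤ n := by exact_mod_cast h.three_le
  rw [le_log_iff_exp_le (by linarith)]
  linarith [exp_one_lt_d9]

theorem log_le (_h : NodeConfig x a b q δ CL) : log n ≤ n := by
  have := log_le_self (Nat.cast_nonneg (α := ℝ) n)
  exact this

theorem mem_unit (h : NodeConfig x a b q δ CL) : q ∈ Set.Icc (-1 : ℝ) 1 := by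
  constructor <;> linarith [h.ha, h.hb, h.left, h.right, h.δ_pos]

theorem δ_le_one (h : NodeConfig x a b q δ CL) : δ ≤ 1 := by
  linarith [h.ha, h.hb, h.left, h.right]

theorem le_dist (h : NodeConfig x a b q δ CL) {v : ℝ} (hv : v ∈ (Set.Icc a b)ᶜ) :
    δ ≤ |v - q| := by
  rw [Set.mem_compl_iff, Set.mem_Icc, not_and_or, not_le, not_le] at hv
  rw [le_abs]
  rcases hv with hv | hv
  · right; linarith [h.left]
  · left; linarith [h.right]

theorem integral_norm_P_le (h : NodeConfig x a b q δ CL) :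
    ∫ t in Set.Icc a b, ‖P x t‖ * nodeMass x ≤ 2 * CL * log n := by
  have h1 : ∫ t in Set.Icc a b, ‖P x t‖ * nodeMass x ≤ ∫ t in Set.Icc a b, 2 * lebesgueFun x t := by
    refine setIntegral_mono_on ?_ ?_ measurableSet_Icc fun t ht => ?_
    · exact ((continuous_norm_P x).mul continuous_const).integrableOn_Icc
    · exact (continuous_const.mul (continuous_lebesgueFun x)).integrableOn_Icc
    · exact norm_P_mul_le_lebesgueFun h.inj h.mem ⟨h.ha.trans ht.1, ht.2.trans h.hb⟩
  rw [integral_const_mul] at h1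
  linarith [h.lebesgue]

theorem neg_le_nat_mul_alpha (h : NodeConfig x a b q δ CL) : -(n * log 2) ≤ n * alpha x := by
  rw [nat_mul_alpha h.pos]
  have := log_le_log (by positivity) (nodeMass_lower h.pos h.inj h.mem)
  rwa [log_inv, log_pow] at this

/-- Integrate `u ≤ e^u` with `u = log|P| + nα` over `[a, b]`. The exponential has integral `O(log
n)` by the Lebesgue function bound, and each `log |v - x_i|` has bounded integral, so `nα` cannot
exceed a constant multiple of `n`. -/
theorem alpha_le (h : NodeConfig x a b q δ CL) : alpha x ≤ (8 * π + 2 * CL) / (2 * δ) := by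
  have hn : (0 : ℝ) < n := by exact_mod_cast h.pos
  have hδ := h.δ_pos
  have hab : 2 * δ ≤ b - a := by linarith [h.left, h.right]
  by_cases hα : alpha x ≤ 0
  · exact hα.trans (by have := h.CL_nonneg; positivity)
  push Not at hα
  have hw : ∀ v ∈ Set.Icc a b, 1 / 2 ≤ 1 / ((v - 0) ^ 2 + 1 ^ 2) := fun v hv => by
    have h1 : |v| ≤ 1 := abs_le.mpr ⟨h.ha.trans hv.1, hv.2.trans h.hb⟩
    have h2 : v ^ 2 ≤ 1 := by nlinarith [sq_abs v, abs_nonneg v]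
    exact one_div_le_one_div_of_le (by positivity) (by nlinarith)
  have hlogm : ∀ i, Measurable fun v : ℝ => |log ‖(v : ℂ) - x i‖| := fun i => by fun_prop
  have hli : ∀ i, IntegrableOn (fun v : ℝ => |log ‖(v : ℂ) - x i‖|) (Set.Icc a b) ∧
      ∫ v in Set.Icc a b, |log ‖(v : ℂ) - x i‖| ≤ 8 * π := fun i => by
    have h1 := integral_abs_log_le (h.mem i) (q := 0) (by simp)
    have hb : ∀ v ∈ Set.Icc a b, |log ‖(v : ℂ) - x i‖| ≤
        2 * (|log ‖(v : ℂ) - x i‖| * (1 / ((v - 0) ^ 2 + 1 ^ 2))) := fun v hv => by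
      nlinarith [hw v hv, abs_nonneg (log ‖(v : ℂ) - x i‖)]
    have hI : IntegrableOn (fun v : ℝ => |log ‖(v : ℂ) - x i‖|) (Set.Icc a b) := by
      refine Integrable.mono' ((h1.1.const_mul 2).integrableOn (s := Set.Icc a b))
        (hlogm i).aestronglyMeasurable ?_
      refine (ae_restrict_iff' measurableSet_Icc).mpr (Filter.Eventually.of_forall fun v hv => ?_)
      rw [norm_eq_abs, abs_abs]
      exact hb v hv
    refine ⟨hI, ?_⟩
    calc ∫ v in Set.Icc a b, |log ‖(v : ℂ) - x i‖|
        ≤ ∫ v in Set.Icc a b, 2 * (|log ‖(v : ℂ) - x i‖| * (1 / ((v - 0) ^ 2 + 1 ^ 2))) :=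
          setIntegral_mono_on hI (h1.1.const_mul 2).integrableOn measurableSet_Icc hb
      _ ≤ ∫ v : ℝ, 2 * (|log ‖(v : ℂ) - x i‖| * (1 / ((v - 0) ^ 2 + 1 ^ 2))) :=
          setIntegral_le_integral (h1.1.const_mul 2)
            (Filter.Eventually.of_forall fun v => by positivity)
      _ ≤ 8 * π := by rw [integral_const_mul]; linarith [h1.2]
  have hPi : IntegrableOn (fun t : ℝ => ‖P x t‖ * nodeMass x) (Set.Icc a b) :=
    ((continuous_norm_P x).mul continuous_const).integrableOn_Icc
  have hsum : IntegrableOn (fun v : ℝ => ∑ i, |log ‖(v : ℂ) - x i‖|) (Set.Icc a b) :=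
    integrable_finsetSum _ fun i _ => (hli i).1
  have hconst : IntegrableOn (fun _ : ℝ => n * alpha x) (Set.Icc a b) :=
    integrableOn_const (by simp)
  have hmono : ∫ _v in Set.Icc a b, n * alpha x ≤
      ∫ v in Set.Icc a b, (‖P x v‖ * nodeMass x + ∑ i, |log ‖(v : ℂ) - x i‖|) := by
    refine integral_mono_ae hconst (hPi.add hsum) (ae_restrict_of_ae ?_)
    filter_upwards [ae_ne_nodes x] with v hv
    have hv' : ∀ i, (v : ℂ) ≠ x i := fun i hi => hv i (by exact_mod_cast hi)
    have h1 := add_one_le_exp (logSize x v)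
    rw [exp_logSize h.pos h.inj hv', logSize] at h1
    have h2 : -∑ i, |log ‖(v : ℂ) - x i‖| ≤ ∑ i, log ‖(v : ℂ) - x i‖ := by
      rw [← Finset.sum_neg_distrib]
      exact Finset.sum_le_sum fun i _ => neg_abs_le _
    linarith
  rw [integral_add hPi hsum, integral_finsetSum _ fun i _ => (hli i).1, setIntegral_const,
    measureReal_def, Real.volume_Icc, ENNReal.toReal_ofReal (by linarith), smul_eq_mul] at hmono
  have h3 : ∑ i, ∫ v in Set.Icc a b, |log ‖(v : ℂ) - x i‖| ≤ ∑ _i : Fin n, 8 * π :=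
    Finset.sum_le_sum fun i _ => (hli i).2
  simp only [Finset.sum_const, Finset.card_univ, Fintype.card_fin, nsmul_eq_mul] at h3
  have h4 := h.integral_norm_P_le
  have h5 : 2 * CL * log n ≤ 2 * CL * n := by
    have := h.log_le; have := h.CL_nonneg; gcongr
  rw [le_div_iff₀ (by positivity)]
  have h6 : 2 * δ * (n * alpha x) ≤ (b - a) * (n * alpha x) :=
    mul_le_mul_of_nonneg_right hab (by positivity)
  have h7 : (n : ℝ) * (alpha x * (2 * δ)) ≤ n * (8 * π + 2 * CL) := by linarith
  exact le_of_mul_le_mul_left h7 hn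

/-- A bound for `∫ |log |P| + n α| / ((v - q)² + 1) dv / n`. -/
noncomputable def potConst (δ CL : ℝ) : ℝ := (5 + (8 * π + 2 * CL) / (2 * δ)) * π

theorem abs_alpha_le (h : NodeConfig x a b q δ CL) :
    |alpha x| ≤ 1 + (8 * π + 2 * CL) / (2 * δ) := by
  have hn : (0 : ℝ) < n := by exact_mod_cast h.pos
  have hδ := h.δ_pos
  have hCL := h.CL_nonneg
  have h1 := h.neg_le_nat_mul_alpha
  have h2 : -log 2 ≤ alpha x := by
    rw [← mul_neg] at h1; exact le_of_mul_le_mul_left h1 hn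
  have h3 : 0 ≤ (8 * π + 2 * CL) / (2 * δ) := by positivity
  rw [abs_le]
  constructor
  · linarith [log_two_lt_d9]
  · linarith [h.alpha_le]

theorem integral_abs_logSize_le' (h : NodeConfig x a b q δ CL) :
    ∫ v : ℝ, |logSize x v| * (1 / ((v - q) ^ 2 + 1 ^ 2)) ≤ potConst δ CL * n := by
  refine (integral_abs_logSize_le x h.mem h.mem_unit).2.trans ?_
  have h1 := h.abs_alpha_le
  have : n * (4 + |alpha x|) * π ≤ n * (4 + (1 + (8 * π + 2 * CL) / (2 * δ))) * π := by
    have := pi_pos; gcongr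
  refine this.trans (le_of_eq ?_)
  rw [potConst]; ring

theorem potConst_pos (h : NodeConfig x a b q δ CL) : 0 < potConst δ CL := by
  have := h.δ_pos; have := h.CL_nonneg
  rw [potConst]; positivity

end NodeConfig

/-! ### The local frequency and the size of `P` above a point near `q`. -/

/-- The local frequency `π n ρ(q)`. -/
noncomputable def freq {n : ℕ} (x : Fin n → ℝ) (a b q : ℝ) : ℝ := π * n * rho x a b q

variable {n : ℕ} {x : Fin n → ℝ}

theorem freq_eq (hn : 0 < n) (x : Fin n → ℝ) (a b q : ℝ) :
    π * freq x a b q = ∫ v in (Set.Icc a b)ᶜ, logSize x v * (1 / (v - q) ^ 2) := by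
  have hn' : (n : ℝ) ≠ 0 := by positivity
  have e : ∀ v : ℝ, (logPotential x v - alpha x) / (q - v) ^ 2 =
      -(1 / (n : ℝ)) * (logSize x v * (1 / (v - q) ^ 2)) := by
    intro v
    have : logPotential x v = -(1 / (n : ℝ)) * ∑ i, log ‖(v : ℂ) - x i‖ := by
      rw [logPotential, neg_mul, ← mul_neg, ← Finset.sum_neg_distrib]
      congr 1
      exact Finset.sum_congr rfl fun i _ => by rw [one_div, log_inv]
    rw [this, logSize, sub_sq_comm q v]
    field_simp
    ring
  rw [freq, rho]
  simp_rw [e]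
  rw [integral_const_mul]
  have := pi_ne_zero
  field_simp

/-- Away from `q` the Poisson kernel at `p + iy`, divided by `y`, is the kernel `(v - q)⁻²` of `ρ`
up to first order in `p - q` and second order in `y`. The error is expressed through the unit
Poisson kernel because `|logSize|` has a known integral against that one. -/
theorem abs_poisson_sub_le {δ p q v y : ℝ} (hδ : 0 < δ) (hδ1 : δ ≤ 1) (hp : |p - q| ≤ δ / 2)
    (hv : δ ≤ |v - q|) :
    |1 / ((v - p) ^ 2 + y ^ 2) - 1 / (v - q) ^ 2| ≤
      24 / δ ^ 4 * (|p - q| + y ^ 2) * (1 / ((v - q) ^ 2 + 1 ^ 2)) := by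
  set s := |v - q| with hs
  set e := |p - q| with he
  have hs0 : 0 < s := hδ.trans_le hv
  have he0 : 0 ≤ e := abs_nonneg _
  have hsq : (v - q) ^ 2 = s ^ 2 := (sq_abs _).symm
  have hvp : s / 2 ≤ |v - p| := by
    have : |v - q| ≤ |v - p| + |p - q| := abs_sub_le v p q
    linarith
  have hvp2 : s ^ 2 / 4 ≤ (v - p) ^ 2 := by
    rw [← sq_abs (v - p)]; nlinarith
  have hnum : |(v - q) ^ 2 - ((v - p) ^ 2 + y ^ 2)| ≤ 3 * s * e + y ^ 2 := by
    have e1 : (v - q) ^ 2 - ((v - p) ^ 2 + y ^ 2) = (p - q) * (2 * (v - q) - (p - q)) - y ^ 2 := by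
      ring
    rw [e1]
    refine (abs_sub _ _).trans ?_
    rw [abs_mul, abs_of_nonneg (sq_nonneg y)]
    have : |2 * (v - q) - (p - q)| ≤ 3 * s := by
      refine (abs_sub _ _).trans ?_
      rw [abs_mul, abs_two]
      linarith
    nlinarith
  have hD1 : 0 < (v - p) ^ 2 + y ^ 2 := by
    have : 0 < s ^ 2 / 4 := by positivity
    nlinarith [sq_nonneg y]
  have hD2 : 0 < (v - q) ^ 2 := by rw [hsq]; positivity
  rw [div_sub_div _ _ hD1.ne' hD2.ne', one_mul, mul_one, abs_div,
    abs_of_pos (mul_pos hD1 hD2), hsq] at *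
  rw [div_le_iff₀ (by positivity)]
  have hden : s ^ 2 / 4 * s ^ 2 ≤ ((v - p) ^ 2 + y ^ 2) * s ^ 2 := by
    refine mul_le_mul_of_nonneg_right ?_ (sq_nonneg s)
    nlinarith [sq_nonneg y]
  refine hnum.trans ?_
  have h1 : 24 / δ ^ 4 * (e + y ^ 2) * (1 / (s ^ 2 + 1 ^ 2)) * (s ^ 2 / 4 * s ^ 2) ≤
      24 / δ ^ 4 * (e + y ^ 2) * (1 / (s ^ 2 + 1 ^ 2)) * (((v - p) ^ 2 + y ^ 2) * s ^ 2) :=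
    mul_le_mul_of_nonneg_left hden (by positivity)
  refine le_trans ?_ h1
  have e2 : 24 / δ ^ 4 * (e + y ^ 2) * (1 / (s ^ 2 + 1 ^ 2)) * (s ^ 2 / 4 * s ^ 2) =
      6 * (e + y ^ 2) * s ^ 4 / (δ ^ 4 * (s ^ 2 + 1)) := by
    field_simp; ring
  rw [e2, le_div_iff₀ (by positivity)]
  have hδs : δ ^ 2 ≤ s ^ 2 := by nlinarith
  have hδ2 : δ ^ 2 ≤ 1 := pow_le_one₀ hδ.le hδ1
  have hk : δ ^ 2 * (s ^ 2 + 1) ≤ 2 * s ^ 2 := by nlinarith [sq_nonneg s]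
  have hk2 : δ ^ 4 * (s ^ 2 + 1) ≤ 2 * s ^ 2 * δ ^ 2 := by nlinarith [sq_nonneg δ]
  have hsd : s * δ ^ 2 ≤ s ^ 2 := by nlinarith
  calc (3 * s * e + y ^ 2) * (δ ^ 4 * (s ^ 2 + 1))
      ≤ (3 * s * e + y ^ 2) * (2 * s ^ 2 * δ ^ 2) := by gcongr
    _ = 6 * e * s ^ 2 * (s * δ ^ 2) + 2 * y ^ 2 * s ^ 2 * δ ^ 2 := by ring
    _ ≤ 6 * e * s ^ 2 * s ^ 2 + 2 * y ^ 2 * s ^ 2 * s ^ 2 := by gcongr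
    _ ≤ 6 * (e + y ^ 2) * s ^ 4 := by
        have : 0 ≤ y ^ 2 * s ^ 4 := by positivity
        linarith

theorem inv_sq_le_mul {δ q v : ℝ} (hδ : 0 < δ) (hδ1 : δ ≤ 1) (hv : δ ≤ |v - q|) :
    1 / (v - q) ^ 2 ≤ 2 / δ ^ 2 * (1 / ((v - q) ^ 2 + 1 ^ 2)) := by
  have hsq : δ ^ 2 ≤ (v - q) ^ 2 := by rw [← sq_abs (v - q)]; nlinarith
  have h0 : 0 < (v - q) ^ 2 := lt_of_lt_of_le (by positivity) hsq
  have hδ2 : δ ^ 2 ≤ 1 := pow_le_one₀ hδ.le hδ1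
  rw [div_mul_div_comm, div_le_div_iff₀ h0 (by positivity)]
  nlinarith

namespace NodeConfig

variable {a b q δ CL : ℝ}

theorem integrableOn_outer (h : NodeConfig x a b q δ CL) :
    IntegrableOn (fun v : ℝ => logSize x v * (1 / (v - q) ^ 2)) (Set.Icc a b)ᶜ := by
  have h1 := ((integral_abs_logSize_le x h.mem h.mem_unit).1.const_mul (2 / δ ^ 2)).integrableOn
    (s := (Set.Icc a b)ᶜ)
  refine Integrable.mono' h1 ?_ ?_
  · refine Measurable.aestronglyMeasurable ?_
    exact (measurable_logSize x).mul (by fun_prop)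
  · refine (ae_restrict_iff' measurableSet_Icc.compl).mpr (Filter.Eventually.of_forall fun v hv => ?_)
    rw [norm_mul, norm_eq_abs, norm_eq_abs, abs_of_nonneg (a := 1 / (v - q) ^ 2) (by positivity)]
    have := mul_le_mul_of_nonneg_left (inv_sq_le_mul h.δ_pos h.δ_le_one (h.le_dist hv))
      (abs_nonneg (logSize x v))
    linarith

theorem freq_le (h : NodeConfig x a b q δ CL) :
    |freq x a b q| ≤ 2 / δ ^ 2 * potConst δ CL * n := by
  have h1 := integral_abs_logSize_le x h.mem h.mem_unit
  have hδ := h.δ_pos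
  have h2 : |π * freq x a b q| ≤ 2 / δ ^ 2 * (potConst δ CL * n) := by
    rw [freq_eq h.pos]
    refine (abs_integral_le_integral_abs).trans ?_
    calc ∫ v in (Set.Icc a b)ᶜ, |logSize x v * (1 / (v - q) ^ 2)|
        ≤ ∫ v in (Set.Icc a b)ᶜ, 2 / δ ^ 2 * (|logSize x v| * (1 / ((v - q) ^ 2 + 1 ^ 2))) := by
          refine setIntegral_mono_on h.integrableOn_outer.abs (h1.1.const_mul _).integrableOn
            measurableSet_Icc.compl fun v hv => ?_
          rw [abs_mul, abs_of_nonneg (a := 1 / (v - q) ^ 2) (by positivity)]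
          have := mul_le_mul_of_nonneg_left (inv_sq_le_mul h.δ_pos h.δ_le_one (h.le_dist hv))
            (abs_nonneg (logSize x v))
          linarith
      _ ≤ ∫ v : ℝ, 2 / δ ^ 2 * (|logSize x v| * (1 / ((v - q) ^ 2 + 1 ^ 2))) :=
          setIntegral_le_integral (h1.1.const_mul _) (Filter.Eventually.of_forall fun v => by
            simp only [Pi.zero_apply]; positivity)
      _ ≤ 2 / δ ^ 2 * (potConst δ CL * n) := by
          rw [integral_const_mul]
          exact mul_le_mul_of_nonneg_left h.integral_abs_logSize_le' (by positivity)
  rw [abs_mul, abs_of_pos pi_pos] at h2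
  have : |freq x a b q| ≤ π * |freq x a b q| :=
    le_mul_of_one_le_left (abs_nonneg _) (by linarith [pi_gt_three])
  linarith

/-- The contribution of the complement of `I₀` to the Poisson integral supplies the linear term
`ωy`. -/
theorem abs_outer_sub_le (h : NodeConfig x a b q δ CL) {p y : ℝ} (hp : |p - q| ≤ δ / 2)
    (hy : 0 < y) :
    |(∫ v in (Set.Icc a b)ᶜ, logSize x v * (y / ((v - p) ^ 2 + y ^ 2))) -
        π * (freq x a b q * y)| ≤
      y * (24 / δ ^ 4 * (|p - q| + y ^ 2) * (potConst δ CL * n)) := by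
  have h1 := integral_abs_logSize_le x h.mem h.mem_unit
  have hδ := h.δ_pos
  have hi := (poisson_logSize x p hy).1.integrableOn (s := (Set.Icc a b)ᶜ)
  have hj := h.integrableOn_outer.const_mul y
  have e : π * (freq x a b q * y) =
      ∫ v in (Set.Icc a b)ᶜ, y * (logSize x v * (1 / (v - q) ^ 2)) := by
    rw [integral_const_mul, ← freq_eq h.pos]; ring
  rw [e, ← integral_sub hi hj]
  refine (abs_integral_le_integral_abs).trans ?_
  have hmaj : Integrable (fun v : ℝ => y * (24 / δ ^ 4 * (|p - q| + y ^ 2) *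
      (|logSize x v| * (1 / ((v - q) ^ 2 + 1 ^ 2))))) := (h1.1.const_mul _).const_mul _
  calc _ ≤ ∫ v in (Set.Icc a b)ᶜ, y * (24 / δ ^ 4 * (|p - q| + y ^ 2) *
      (|logSize x v| * (1 / ((v - q) ^ 2 + 1 ^ 2)))) := by
        refine setIntegral_mono_on (hi.sub hj).abs hmaj.integrableOn
          measurableSet_Icc.compl fun v hv => ?_
        have h2 := abs_poisson_sub_le (y := y) h.δ_pos h.δ_le_one hp (h.le_dist hv)
        have e2 : logSize x v * (y / ((v - p) ^ 2 + y ^ 2)) - y * (logSize x v * (1 / (v - q) ^ 2)) =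
            y * logSize x v * (1 / ((v - p) ^ 2 + y ^ 2) - 1 / (v - q) ^ 2) := by ring
        rw [e2, abs_mul, abs_mul, abs_of_pos hy]
        have := mul_le_mul_of_nonneg_left h2 (mul_nonneg hy.le (abs_nonneg (logSize x v)))
        linarith
    _ ≤ ∫ v : ℝ, y * (24 / δ ^ 4 * (|p - q| + y ^ 2) *
      (|logSize x v| * (1 / ((v - q) ^ 2 + 1 ^ 2)))) :=
        setIntegral_le_integral hmaj (Filter.Eventually.of_forall fun v => by
          simp only [Pi.zero_apply]; positivity)
    _ ≤ _ := by
        rw [integral_const_mul, integral_const_mul]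
        have := h.integral_abs_logSize_le'
        gcongr

/-- From `u ≤ 3 log n + e^{u - 3 log n}`: the first term integrates against a kernel of mass at most
`π`. In the second the factor `n⁻³` absorbs the kernel's maximum `1/y ≤ n`, and `∫ e^u = O(log n)`.
-/
theorem inner_le (h : NodeConfig x a b q δ CL) {p y : ℝ} (hy : 1 / n ≤ y) :
    ∫ v in Set.Icc a b, logSize x v * (y / ((v - p) ^ 2 + y ^ 2)) ≤
      (3 * π + 2 * CL) * log n := by
  have hn : (0 : ℝ) < n := by exact_mod_cast h.pos
  have hy0 : 0 < y := lt_of_lt_of_le (by positivity) hy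
  have h1 := poisson_one p hy0
  have hPi : IntegrableOn (fun t : ℝ => ‖P x t‖ * nodeMass x) (Set.Icc a b) :=
    ((continuous_norm_P x).mul continuous_const).integrableOn_Icc
  have hyn : 1 / y ≤ n := by
    rw [div_le_iff₀ hy0]; rw [div_le_iff₀ hn] at hy; linarith
  have hmono : ∫ v in Set.Icc a b, logSize x v * (y / ((v - p) ^ 2 + y ^ 2)) ≤
      ∫ v in Set.Icc a b, (3 * log n * (y / ((v - p) ^ 2 + y ^ 2)) +
        (n : ℝ)⁻¹ ^ 2 * (‖P x v‖ * nodeMass x)) := by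
    refine integral_mono_ae (poisson_logSize x p hy0).1.integrableOn
      ((h1.1.const_mul _).integrableOn.add (hPi.const_mul _)) (ae_restrict_of_ae ?_)
    filter_upwards [ae_ne_nodes x] with v hv
    have hv' : ∀ i, (v : ℂ) ≠ x i := fun i hi => hv i (by exact_mod_cast hi)
    have h2 := add_one_le_exp (logSize x v - 3 * log n)
    have h3 : exp (logSize x v - 3 * log n) = ‖P x v‖ * nodeMass x * (n : ℝ)⁻¹ ^ 3 := by
      rw [exp_sub, exp_logSize h.pos h.inj hv', show 3 * log n = log ((n : ℝ) ^ 3) by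
        rw [log_pow]; norm_num, exp_log (by positivity)]
      rw [inv_pow, div_eq_mul_inv]
    have hE : 0 ≤ ‖P x v‖ * nodeMass x := by
      have := nodeMass_pos h.pos h.inj; positivity
    have hPk0 := poisson_nonneg p v hy0
    have hPk := (poisson_le p v hy0).trans hyn
    set k := y / ((v - p) ^ 2 + y ^ 2)
    calc logSize x v * k ≤ (3 * log n + ‖P x v‖ * nodeMass x * (n : ℝ)⁻¹ ^ 3) * k := by
          gcongr; linarith
      _ = 3 * log n * k + ‖P x v‖ * nodeMass x * (n : ℝ)⁻¹ ^ 3 * k := by ring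
      _ ≤ 3 * log n * k + ‖P x v‖ * nodeMass x * (n : ℝ)⁻¹ ^ 3 * n := by gcongr
      _ = 3 * log n * k + (n : ℝ)⁻¹ ^ 2 * (‖P x v‖ * nodeMass x) := by field_simp
  refine hmono.trans ?_
  rw [integral_add (h1.1.const_mul _).integrableOn (hPi.const_mul _), integral_const_mul,
    integral_const_mul]
  have h4 : ∫ v in Set.Icc a b, y / ((v - p) ^ 2 + y ^ 2) ≤ π := by
    rw [← h1.2]
    exact setIntegral_le_integral h1.1 (Filter.Eventually.of_forall fun v => poisson_nonneg p v hy0)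
  have h5 := h.integral_norm_P_le
  have hl := h.one_le_log
  have hCL := h.CL_nonneg
  have h6 : (n : ℝ)⁻¹ ^ 2 ≤ 1 := pow_le_one₀ (by positivity) (inv_le_one_of_one_le₀ (by
    exact_mod_cast h.pos))
  have h7 : (n : ℝ)⁻¹ ^ 2 * ∫ v in Set.Icc a b, ‖P x v‖ * nodeMass x ≤ 1 * (2 * CL * log n) := by
    refine mul_le_mul h6 h5 (integral_nonneg fun v => ?_) zero_le_one
    have := nodeMass_pos h.pos h.inj
    simp only [Pi.zero_apply]; positivity
  have h8 : 3 * log n * ∫ v in Set.Icc a b, y / ((v - p) ^ 2 + y ^ 2) ≤ 3 * log n * π := by gcongr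
  linarith

/-- The same scheme from below: `-3 log n` is integrated against the mass of the kernel, and the
logarithmic singularities at the nodes cost at most `n · 2/n²`. -/
theorem le_inner (h : NodeConfig x a b q δ CL) {p y : ℝ} (hy : 1 / n ≤ y) :
    -((3 * π + 2) * log n) ≤
      ∫ v in Set.Icc a b, logSize x v * (y / ((v - p) ^ 2 + y ^ 2)) := by
  have hn : (0 : ℝ) < n := by exact_mod_cast h.pos
  have hn1 : (1 : ℝ) ≤ n := by exact_mod_cast h.pos
  have hy0 : 0 < y := lt_of_lt_of_le (by positivity) hy
  have h1 := poisson_one p hy0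
  have hs := integrable_sum_posLog h.pos x
  have hyn : 1 / y ≤ n := by
    rw [div_le_iff₀ hy0]; rw [div_le_iff₀ hn] at hy; linarith
  have hmono : ∫ v in Set.Icc a b, -(3 * log n * (y / ((v - p) ^ 2 + y ^ 2)) +
        n * ∑ i, posLog (((n : ℝ) ^ 3 * |v - x i|)⁻¹)) ≤
      ∫ v in Set.Icc a b, logSize x v * (y / ((v - p) ^ 2 + y ^ 2)) := by
    refine integral_mono_ae ((h1.1.const_mul _).integrableOn.add (hs.1.const_mul _).integrableOn).neg
      (poisson_logSize x p hy0).1.integrableOn (ae_restrict_of_ae ?_)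
    filter_upwards [ae_ne_nodes x] with v hv
    have h2 := logSize_ofReal_lower h.pos h.inj hv
    have hE : 0 ≤ ∑ i, posLog (((n : ℝ) ^ 3 * |v - x i|)⁻¹) :=
      Finset.sum_nonneg fun i _ => posLog_nonneg
    have hPk0 := poisson_nonneg p v hy0
    have hPk := (poisson_le p v hy0).trans hyn
    set k := y / ((v - p) ^ 2 + y ^ 2)
    set E := ∑ i, posLog (((n : ℝ) ^ 3 * |v - x i|)⁻¹)
    have h3 : E * k ≤ E * n := by gcongr
    have h4 := mul_le_mul_of_nonneg_right h2 hPk0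
    linarith
  refine le_trans ?_ hmono
  rw [integral_neg, integral_add (h1.1.const_mul _).integrableOn (hs.1.const_mul _).integrableOn,
    integral_const_mul, integral_const_mul]
  have h4 : ∫ v in Set.Icc a b, y / ((v - p) ^ 2 + y ^ 2) ≤ π := by
    rw [← h1.2]
    exact setIntegral_le_integral h1.1 (Filter.Eventually.of_forall fun v => poisson_nonneg p v hy0)
  have h5 : ∫ v in Set.Icc a b, ∑ i, posLog (((n : ℝ) ^ 3 * |v - x i|)⁻¹) ≤ 2 / n ^ 2 := by
    refine le_trans ?_ hs.2
    exact setIntegral_le_integral hs.1 (Filter.Eventually.of_forall fun v =>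
      Finset.sum_nonneg fun i _ => posLog_nonneg)
  have hl := h.one_le_log
  have h7 : n * ∫ v in Set.Icc a b, ∑ i, posLog (((n : ℝ) ^ 3 * |v - x i|)⁻¹) ≤ 2 := by
    calc _ ≤ n * (2 / (n : ℝ) ^ 2) := by gcongr
      _ = 2 / n := by field_simp
      _ ≤ 2 := div_le_self (by norm_num) hn1
  have h8 : 3 * log n * ∫ v in Set.Icc a b, y / ((v - p) ^ 2 + y ^ 2) ≤ 3 * log n * π := by gcongr
  linarith

/-- The error constant in `abs_logSize_sub_le`. -/
noncomputable def waveConst (δ CL : ℝ) : ℝ := 24 / δ ^ 4 * potConst δ CL + (5 + 2 * CL)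

/-- The plane wave estimate: the Poisson integral of `logSize` is split at `I₀`, the outside giving
the main term and the inside `O(log n)`. All later size bounds for `P` at positive heights near
`x_J` come from here. -/
theorem abs_logSize_sub_le (h : NodeConfig x a b q δ CL) {p y : ℝ} (hp : |p - q| ≤ δ / 2)
    (hy : 1 / n ≤ y) :
    |logSize x (p + y * Complex.I) - freq x a b q * y| ≤
      waveConst δ CL * (n * y * |p - q| + n * y ^ 3 + log n) := by
  have hn : (0 : ℝ) < n := by exact_mod_cast h.pos
  have hy0 : 0 < y := lt_of_lt_of_le (by positivity) hy
  have hδ := h.δ_pos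
  have hCL := h.CL_nonneg
  have hpc := h.potConst_pos
  have hl := h.one_le_log
  have h1 := poisson_logSize x p hy0
  have h2 := integral_add_compl (measurableSet_Icc (a := a) (b := b)) h1.1
  rw [h1.2] at h2
  have h3 := h.abs_outer_sub_le hp hy0
  have h4 := h.inner_le (p := p) hy
  have h5 := h.le_inner (p := p) hy
  set W := ∫ v in (Set.Icc a b)ᶜ, logSize x v * (y / ((v - p) ^ 2 + y ^ 2))
  set V := ∫ v in Set.Icc a b, logSize x v * (y / ((v - p) ^ 2 + y ^ 2))
  have hV : |V| ≤ (3 * π + 2 + 2 * CL) * log n := by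
    rw [abs_le]
    constructor
    · have : 0 ≤ 2 * CL * log n := by positivity
      linarith
    · linarith
  have key : π * |logSize x (p + y * Complex.I) - freq x a b q * y| ≤
      (3 * π + 2 + 2 * CL) * log n +
        y * (24 / δ ^ 4 * (|p - q| + y ^ 2) * (potConst δ CL * n)) := by
    rw [← abs_of_pos pi_pos, ← abs_mul, abs_of_pos pi_pos]
    have : π * (logSize x (p + y * Complex.I) - freq x a b q * y) =
        V + (W - π * (freq x a b q * y)) := by rw [mul_sub, ← h2]; ring
    rw [this]
    exact (abs_add_le _ _).trans (add_le_add hV h3)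
  have hpi := pi_gt_three
  have hE0 : 0 ≤ y * (24 / δ ^ 4 * (|p - q| + y ^ 2) * (potConst δ CL * n)) := by positivity
  have h6 : (3 * π + 2 + 2 * CL) * log n ≤ π * ((5 + 2 * CL) * log n) := by
    have : 3 * π + 2 + 2 * CL ≤ π * (5 + 2 * CL) := by nlinarith
    calc _ ≤ π * (5 + 2 * CL) * log n := by gcongr
      _ = _ := by ring
  have h7 : π * |logSize x (p + y * Complex.I) - freq x a b q * y| ≤
      π * ((5 + 2 * CL) * log n + y * (24 / δ ^ 4 * (|p - q| + y ^ 2) * (potConst δ CL * n))) := by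
    nlinarith
  have h8 := le_of_mul_le_mul_left h7 pi_pos
  refine h8.trans ?_
  rw [waveConst]
  have h9 : 0 ≤ 24 / δ ^ 4 * potConst δ CL * log n := by positivity
  have h10 : 0 ≤ (5 + 2 * CL) * (n * y * |p - q| + n * y ^ 3) := by positivity
  nlinarith

/-- The integral defining the frequency is nearly nonnegative: outside `[-4, 4]` the polynomial
dominates its normalisation, and inside `logSize` is at least `-3 log n` up to the small singular
part. A gain of order `n` comes from `[4, 5]` alone. -/
theorem le_freq (h : NodeConfig x a b q δ CL) :
    n / 300 - 9 / δ ^ 2 * log n ≤ freq x a b q := by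
  have hn : (0 : ℝ) < n := by exact_mod_cast h.pos
  have hn1 : (1 : ℝ) ≤ n := by exact_mod_cast h.pos
  have hδ := h.δ_pos
  have hl := h.one_le_log
  have hq := h.mem_unit
  have hs := integrable_sum_posLog h.pos x
  set E : ℝ → ℝ := fun v => ∑ i, posLog (((n : ℝ) ^ 3 * |v - x i|)⁻¹) with hE
  have hE0 : ∀ v, 0 ≤ E v := fun v => Finset.sum_nonneg fun i _ => posLog_nonneg
  -- A minorant. On `[4, 5]` all nodes are at distance at least 3, so `logSize ≥ n (log 3 - log 2) ≥
  -- 2n/5`, and `(v - q)² ≤ 36`. After division by `π` this leaves `n/(90π) ≥ n/300`.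
  set f : ℝ → ℝ := fun v => (Set.Icc (4 : ℝ) 5).indicator (fun _ => (n : ℝ) * (2 / 5) / 36) v -
    ((Set.Icc (-4 : ℝ) 4).indicator (fun _ => 3 * log n / δ ^ 2) v + 1 / δ ^ 2 * E v) with hf
  have hi1 : Integrable ((Set.Icc (4 : ℝ) 5).indicator (fun _ : ℝ => (n : ℝ) * (2 / 5) / 36)) :=
    (integrable_indicator_iff measurableSet_Icc).mpr (integrableOn_const (by simp))
  have hi2 : Integrable ((Set.Icc (-4 : ℝ) 4).indicator (fun _ : ℝ => 3 * log n / δ ^ 2)) :=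
    (integrable_indicator_iff measurableSet_Icc).mpr (integrableOn_const (by simp))
  have hi3 : Integrable (fun v => 1 / δ ^ 2 * E v) := hs.1.const_mul _
  have hi23 : Integrable (fun v => (Set.Icc (-4 : ℝ) 4).indicator (fun _ => 3 * log n / δ ^ 2) v +
      1 / δ ^ 2 * E v) := hi2.add hi3
  have hfi : Integrable f := hi1.sub hi23
  have hlow : ∀ v : ℝ, 4 ≤ |v| → n * (2 / 5) ≤ logSize x v := fun v hv => by
    rw [logSize]
    have h1 : ∑ _i : Fin n, log 3 ≤ ∑ i, log ‖(v : ℂ) - x i‖ := by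
      refine Finset.sum_le_sum fun i _ => log_le_log (by norm_num) ?_
      rw [← Complex.ofReal_sub, Complex.norm_real, norm_eq_abs]
      have h2 := abs_sub_abs_le_abs_sub v (x i)
      have h3 : |x i| ≤ 1 := abs_le.mpr (h.mem i)
      linarith
    simp only [Finset.sum_const, Finset.card_univ, Fintype.card_fin, nsmul_eq_mul] at h1
    have h2 := h.neg_le_nat_mul_alpha
    have h3 : (2 / 5 : ℝ) ≤ log 3 - log 2 := by
      rw [← log_div (by norm_num) (by norm_num), le_log_iff_exp_le (by norm_num)]
      have h4 : exp (2 / 5) ^ 5 ≤ (3 / 2 : ℝ) ^ 5 := by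
        rw [← exp_nat_mul]
        have h5 : exp ((5 : ℕ) * (2 / 5)) = exp 1 ^ 2 := by
          rw [← exp_nat_mul]; norm_num
        rw [h5]
        have := exp_one_lt_d9
        have h6 := exp_pos 1
        nlinarith
      exact le_of_pow_le_pow_left₀ (by norm_num) (by norm_num) h4
    nlinarith
  have hmono : ∫ v in (Set.Icc a b)ᶜ, f v ≤
      ∫ v in (Set.Icc a b)ᶜ, logSize x v * (1 / (v - q) ^ 2) := by
    refine integral_mono_ae hfi.integrableOn h.integrableOn_outer
      ((ae_restrict_iff' measurableSet_Icc.compl).mpr ?_)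
    filter_upwards [ae_ne_nodes x] with v hv hvm
    have hd := h.le_dist hvm
    have hsq : δ ^ 2 ≤ (v - q) ^ 2 := by rw [← sq_abs (v - q)]; nlinarith
    have h0 : 0 < (v - q) ^ 2 := lt_of_lt_of_le (by positivity) hsq
    have hinv : 1 / (v - q) ^ 2 ≤ 1 / δ ^ 2 := one_div_le_one_div_of_le (by positivity) hsq
    have hinv0 : 0 ≤ 1 / (v - q) ^ 2 := by positivity
    have hEv : 0 ≤ 1 / δ ^ 2 * E v := mul_nonneg (by positivity) (hE0 v)
    have hE4 : 0 ≤ (Set.Icc (-4 : ℝ) 4).indicator (fun _ => 3 * log n / δ ^ 2) v :=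
      Set.indicator_nonneg (fun _ _ => by positivity) v
    simp only [hf]
    by_cases hv4 : 4 ≤ |v|
    · have hu := hlow v hv4
      by_cases hv5 : v ∈ Set.Icc (4 : ℝ) 5
      · rw [Set.indicator_of_mem hv5]
        have h36 : 1 / 36 ≤ 1 / (v - q) ^ 2 := by
          refine one_div_le_one_div_of_le h0 ?_
          nlinarith [hv5.1, hv5.2, hq.1, hq.2]
        have : n * (2 / 5) * (1 / 36) ≤ logSize x v * (1 / (v - q) ^ 2) :=
          mul_le_mul hu h36 (by norm_num) (le_trans (by positivity) hu)
        linarith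
      · rw [Set.indicator_of_notMem hv5]
        have : 0 ≤ logSize x v * (1 / (v - q) ^ 2) :=
          mul_nonneg (le_trans (by positivity) hu) hinv0
        linarith
    · push Not at hv4
      have hv5 : v ∉ Set.Icc (4 : ℝ) 5 := fun hm => by
        have := le_abs_self v; linarith [hm.1]
      have hv6 : v ∈ Set.Icc (-4 : ℝ) 4 := abs_le.mp hv4.le
      rw [Set.indicator_of_notMem hv5, Set.indicator_of_mem hv6]
      have h2 := logSize_ofReal_lower h.pos h.inj hv
      have h3 := mul_le_mul_of_nonneg_right h2 hinv0
      have h4 : (3 * log n + E v) * (1 / (v - q) ^ 2) ≤ (3 * log n + E v) * (1 / δ ^ 2) := by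
        have := hE0 v; gcongr
      have e1 : 3 * log n / δ ^ 2 = 3 * log n * (1 / δ ^ 2) := by ring
      rw [e1]
      simp only [hE] at *
      linarith
  rw [← freq_eq h.pos] at hmono
  have hdisj : Set.Icc (4 : ℝ) 5 ⊆ (Set.Icc a b)ᶜ := fun v hv hm => by
    linarith [hv.1, hm.2, h.hb]
  have e1 : ∫ v in (Set.Icc a b)ᶜ, f v =
      (∫ v in (Set.Icc a b)ᶜ, (Set.Icc (4 : ℝ) 5).indicator (fun _ => (n : ℝ) * (2 / 5) / 36) v) -
      ∫ v in (Set.Icc a b)ᶜ, ((Set.Icc (-4 : ℝ) 4).indicator (fun _ => 3 * log n / δ ^ 2) v +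
        1 / δ ^ 2 * E v) := integral_sub hi1.integrableOn hi23.integrableOn
  have e2 : ∫ v in (Set.Icc a b)ᶜ, (Set.Icc (4 : ℝ) 5).indicator
      (fun _ => (n : ℝ) * (2 / 5) / 36) v = (n : ℝ) * (2 / 5) / 36 := by
    rw [setIntegral_indicator measurableSet_Icc, Set.inter_eq_self_of_subset_right hdisj,
      setIntegral_const, measureReal_def, Real.volume_Icc]
    norm_num
  have e3 : ∫ v in (Set.Icc a b)ᶜ, ((Set.Icc (-4 : ℝ) 4).indicator (fun _ => 3 * log n / δ ^ 2) v +
        1 / δ ^ 2 * E v) ≤ 26 / δ ^ 2 * log n := by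
    refine (setIntegral_le_integral hi23 (Filter.Eventually.of_forall fun v => ?_)).trans ?_
    · have := hE0 v
      exact add_nonneg (Set.indicator_nonneg (fun _ _ => by positivity) v) (by positivity)
    rw [integral_add hi2 hi3, integral_const_mul, integral_indicator measurableSet_Icc,
      setIntegral_const, measureReal_def, Real.volume_Icc]
    have h6 : 1 / δ ^ 2 * ∫ v, E v ≤ 1 / δ ^ 2 * 2 := by
      have : 2 / (n : ℝ) ^ 2 ≤ 2 := div_le_self (by norm_num) (one_le_pow₀ hn1)
      have := hs.2.trans this
      gcongr
    have h7 : 1 / δ ^ 2 * 2 ≤ 1 / δ ^ 2 * (2 * log n) := by gcongr; linarith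
    norm_num at h6 ⊢
    have e4 : 8 * (3 * log n / δ ^ 2) + 1 / δ ^ 2 * (2 * log n) = 26 / δ ^ 2 * log n := by ring
    rw [← e4]
    norm_num at h7 ⊢
    linarith
  rw [e1, e2] at hmono
  have h9 : (n : ℝ) * (2 / 5) / 36 - 26 / δ ^ 2 * log n ≤ π * freq x a b q := by linarith
  have hpi := pi_gt_three
  have hpi4 := pi_lt_d2
  have h10 : π * (n / 300 - 9 / δ ^ 2 * log n) ≤ π * freq x a b q := by
    refine le_trans ?_ h9
    have h11 : 27 * (1 / δ ^ 2 * log n) ≤ 9 * π * (1 / δ ^ 2 * log n) := by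
      have : 0 ≤ 1 / δ ^ 2 * log n := by positivity
      nlinarith
    have h12 : 0 ≤ 1 / δ ^ 2 * log n := by positivity
    have e5 : 26 / δ ^ 2 * log n = 26 * (1 / δ ^ 2 * log n) := by ring
    have e6 : 9 / δ ^ 2 * log n = 9 * (1 / δ ^ 2 * log n) := by ring
    rw [e5, e6]
    nlinarith
  exact le_of_mul_le_mul_left h10 pi_pos

end NodeConfig

variable {n : ℕ} {x : Fin n → ℝ}

/-! ### Zero-free intervals are short -/

/-- Over a point at distance `d ≥ H` from `t`, `log |p + iy - t|` grows essentially quadratically in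
`y`: little up to `H/4`, a definite amount between `H/4` and `H`. The two increments have ratio at
most `2/15`. -/
theorem log_norm_sub_le {d H y₀ : ℝ} (p t : ℝ) (hH : 0 < H) (hd : d = |p - t|) (hHd : H ≤ d) :
    log ‖(p : ℂ) + (H / 4 : ℝ) * Complex.I - t‖ - log ‖(p : ℂ) + y₀ * Complex.I - t‖ ≤
      H ^ 2 / d ^ 2 / 32 ∧
    15 / 64 * (H ^ 2 / d ^ 2) ≤
      log ‖(p : ℂ) + H * Complex.I - t‖ - log ‖(p : ℂ) + (H / 4 : ℝ) * Complex.I - t‖ := by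
  have hd0 : 0 < d := hH.trans_le hHd
  have e : ∀ y : ℝ, log ‖(p : ℂ) + y * Complex.I - t‖ = 1 / 2 * log (d ^ 2 + y ^ 2) := by
    intro y
    have h1 : ‖(p : ℂ) + y * Complex.I - t‖ ^ 2 = d ^ 2 + y ^ 2 := by
      rw [← Complex.normSq_eq_norm_sq, Complex.normSq_apply, hd, sq_abs]
      simp; ring
    rw [← h1, log_pow]; push_cast; ring
  rw [e, e, e]
  have hsub : ∀ {A B : ℝ}, 0 < A → 0 < B → log A - log B ≤ A / B - 1 := fun {A B} hA hB => by
    rw [← log_div hA.ne' hB.ne']; exact log_le_sub_one_of_pos (by positivity)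
  constructor
  · have h1 := hsub (A := d ^ 2 + (H / 4) ^ 2) (B := d ^ 2 + y₀ ^ 2) (by positivity) (by positivity)
    have h2 : (d ^ 2 + (H / 4) ^ 2) / (d ^ 2 + y₀ ^ 2) - 1 ≤ H ^ 2 / d ^ 2 / 16 := by
      rw [tsub_le_iff_right, div_le_iff₀ (by positivity)]
      have : (H ^ 2 / d ^ 2 / 16 + 1) * (d ^ 2 + y₀ ^ 2) =
          (d ^ 2 + (H / 4) ^ 2) + (y₀ ^ 2 + H ^ 2 / d ^ 2 / 16 * y₀ ^ 2) := by
        field_simp; ring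
      rw [this]
      exact le_add_of_nonneg_right (by positivity)
    linarith
  · have h1 := hsub (A := d ^ 2 + (H / 4) ^ 2) (B := d ^ 2 + H ^ 2) (by positivity) (by positivity)
    have h2 : (d ^ 2 + (H / 4) ^ 2) / (d ^ 2 + H ^ 2) - 1 ≤ -(15 / 32 * (H ^ 2 / d ^ 2)) := by
      rw [tsub_le_iff_right, div_le_iff₀ (by positivity)]
      have hv : H ^ 2 / d ^ 2 ≤ 1 := by
        rw [div_le_one (by positivity)]; gcongr
      have : (-(15 / 32 * (H ^ 2 / d ^ 2)) + 1) * (d ^ 2 + H ^ 2) =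
          (d ^ 2 + (H / 4) ^ 2) + 15 / 32 * H ^ 2 * (1 - H ^ 2 / d ^ 2) := by
        field_simp; ring
      rw [this]
      exact le_add_of_nonneg_right (mul_nonneg (by positivity) (by linarith))
    linarith

/-- Above a gap of radius `H` the growth in `y` is quadratic by the preceding lemma, but the plane
wave estimate makes it linear with slope `ω`. Linear growth has increments in ratio about `1/3`,
exceeding `2/15`, so `ωH` must be of the order of the error. -/
theorem NodeConfig.freq_mul_le_of_gap {a b q δ CL : ℝ} (h : NodeConfig x a b q δ CL) {p H : ℝ}
    (hp : |p - q| ≤ δ / 2) (hω : 0 ≤ freq x a b q) (hH : 60 / n ≤ H)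
    (hgap : ∀ i, H ≤ |p - x i|) :
    freq x a b q * H ≤
      17 * (waveConst δ CL * (n * H * |p - q| + n * H ^ 3 + log n)) := by
  have hn : (0 : ℝ) < n := by exact_mod_cast h.pos
  have hH0 : 0 < H := lt_of_lt_of_le (by positivity) hH
  have hδ := h.δ_pos
  have hw : 0 ≤ waveConst δ CL := by
    have := h.potConst_pos; have := h.CL_nonneg
    rw [waveConst]; positivity
  have hy0 : (1 : ℝ) / n ≤ H / 4 := by
    have : 1 / (n : ℝ) = 60 / n / 60 := by ring
    linarith
  have hle : ∀ y : ℝ, 0 < y → y ≤ H → waveConst δ CL * (n * y * |p - q| + n * y ^ 3 + log n) ≤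
      waveConst δ CL * (n * H * |p - q| + n * H ^ 3 + log n) := fun y hy1 hy2 => by gcongr
  have h1 := (h.abs_logSize_sub_le hp (y := H) (by linarith))
  have h2 := (h.abs_logSize_sub_le hp (y := H / 4) hy0).trans
    (hle _ (by linarith) (by linarith))
  have h3 := (h.abs_logSize_sub_le hp (y := 1 / n) le_rfl).trans
    (hle _ (by positivity) (by linarith))
  set E := waveConst δ CL * (n * H * |p - q| + n * H ^ 3 + log n)
  set om := freq x a b q
  rw [abs_le] at h1 h2 h3
  have hA : logSize x (p + (H / 4 : ℝ) * Complex.I) - logSize x (p + (1 / n : ℝ) * Complex.I) ≤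
      (∑ i, H ^ 2 / |p - x i| ^ 2) / 32 := by
    rw [logSize, logSize, add_sub_add_right_eq_sub, ← Finset.sum_sub_distrib, Finset.sum_div]
    exact Finset.sum_le_sum fun i _ => (log_norm_sub_le p (x i) hH0 rfl (hgap i)).1
  have hB : 15 / 64 * (∑ i, H ^ 2 / |p - x i| ^ 2) ≤
      logSize x (p + H * Complex.I) - logSize x (p + (H / 4 : ℝ) * Complex.I) := by
    rw [logSize, logSize, add_sub_add_right_eq_sub, ← Finset.sum_sub_distrib, Finset.mul_sum]
    exact Finset.sum_le_sum fun i _ => (log_norm_sub_le (y₀ := 0) p (x i) hH0 rfl (hgap i)).2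
  have h4 : om * (1 / n) ≤ om * (H / 60) := by
    refine mul_le_mul_of_nonneg_left ?_ hω
    have : 1 / (n : ℝ) = 60 / n / 60 := by ring
    linarith
  -- With error `E` at each height: `ωH(1/4 - 1/60) - 2E ≤ (2/15)((3/4)ωH + 2E)`, that is, `ωH ≤
  -- 17E`.
  linarith [h1.1, h1.2, h2.1, h2.2, h3.1, h3.2]

/-! ### The size of `P` between consecutive nodes -/

/-- Log-concavity between zeros: each `|t - v_i|` is a convex combination of its values at `A` and
`B`, hence at least their weighted geometric mean. The product of these means is the same weighted
mean of the two endpoint products. -/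
theorem min_le_prod_abs_sub {ι : Type*} (s : Finset ι) (v : ι → ℝ) {A B t : ℝ} (hAB : A < B)
    (ht : t ∈ Set.Icc A B) (hv : ∀ i ∈ s, v i ≤ A ∨ B ≤ v i) :
    min (∏ i ∈ s, |A - v i|) (∏ i ∈ s, |B - v i|) ≤ ∏ i ∈ s, |t - v i| := by
  set lam := (B - t) / (B - A)
  set mu := (t - A) / (B - A)
  have hBA : 0 < B - A := by linarith
  have hl : 0 ≤ lam := div_nonneg (by linarith [ht.2]) hBA.le
  have hm : 0 ≤ mu := div_nonneg (by linarith [ht.1]) hBA.le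
  have hs : lam + mu = 1 := by simp only [lam, mu]; field_simp; ring
  have ht' : t = lam * A + mu * B := by simp only [lam, mu]; field_simp; ring
  have habs : ∀ i ∈ s, |A - v i| ^ lam * |B - v i| ^ mu ≤ |t - v i| := by
    intro i hi
    refine (geom_mean_le_arith_mean2_weighted hl hm (abs_nonneg _) (abs_nonneg _) hs).trans
      (le_of_eq ?_)
    have e : t - v i = lam * (A - v i) + mu * (B - v i) := by
      rw [ht']; linear_combination (v i) * hs
    rcases hv i hi with h | h
    · rw [abs_of_nonneg (by linarith : 0 ≤ A - v i), abs_of_nonneg (by linarith : 0 ≤ B - v i),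
        abs_of_nonneg (by linarith [ht.1]), e]
    · rw [abs_of_nonpos (by linarith : A - v i ≤ 0), abs_of_nonpos (by linarith : B - v i ≤ 0),
        abs_of_nonpos (by linarith [ht.2]), e]
      ring
  refine le_trans ?_ (Finset.prod_le_prod (fun i _ => by positivity) habs)
  rw [Finset.prod_mul_distrib, finsetProd_rpow _ _ (fun _ _ => abs_nonneg _),
    finsetProd_rpow _ _ (fun _ _ => abs_nonneg _)]
  set X := ∏ i ∈ s, |A - v i|
  set Y := ∏ i ∈ s, |B - v i|
  have hX : 0 ≤ X := Finset.prod_nonneg fun _ _ => abs_nonneg _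
  have hY : 0 ≤ Y := Finset.prod_nonneg fun _ _ => abs_nonneg _
  have hmin : 0 ≤ min X Y := le_min hX hY
  calc min X Y = min X Y ^ lam * min X Y ^ mu := by
        rw [← rpow_add_of_nonneg hmin hl hm, hs, rpow_one]
    _ ≤ X ^ lam * Y ^ mu := by
        gcongr
        · exact min_le_left _ _
        · exact min_le_right _ _

theorem norm_P_gap_lower {k l : Fin n} (hkl : x k < x l) (hgap : ∀ i, x i ≤ x k ∨ x l ≤ x i)
    {t : ℝ} (ht : t ∈ Set.Icc (x k) (x l)) :
    min ‖P' x (x k)‖ ‖P' x (x l)‖ / (x l - x k) * ((t - x k) * (x l - t)) ≤ ‖P x t‖ := by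
  have hne : l ≠ k := fun h => by rw [h] at hkl; exact lt_irrefl _ hkl
  have hl : l ∈ Finset.univ.erase k := Finset.mem_erase.mpr ⟨hne, Finset.mem_univ _⟩
  have hk : k ∈ Finset.univ.erase l := Finset.mem_erase.mpr ⟨hne.symm, Finset.mem_univ _⟩
  have h1 := min_le_prod_abs_sub ((Finset.univ.erase k).erase l) x hkl ht (fun i _ => hgap i)
  have hd : 0 < x l - x k := by linarith
  have ek : ‖P' x (x k)‖ = (x l - x k) * ∏ i ∈ (Finset.univ.erase k).erase l, |x k - x i| := by
    rw [norm_P'_node, ← Finset.mul_prod_erase _ _ hl, abs_sub_comm, abs_of_pos hd]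
  have el : ‖P' x (x l)‖ = (x l - x k) * ∏ i ∈ (Finset.univ.erase k).erase l, |x l - x i| := by
    rw [norm_P'_node, ← Finset.mul_prod_erase _ _ hk, abs_of_pos hd, Finset.erase_right_comm]
  have eP : ‖P x t‖ = (t - x k) * (x l - t) * ∏ i ∈ (Finset.univ.erase k).erase l, |t - x i| := by
    rw [P_ofReal, Complex.norm_real, norm_prod, ← Finset.mul_prod_erase _ _ (Finset.mem_univ k),
      ← Finset.mul_prod_erase _ _ hl]
    simp only [norm_eq_abs]
    rw [abs_of_nonneg (by linarith [ht.1] : 0 ≤ t - x k), abs_sub_comm t (x l),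
      abs_of_nonneg (by linarith [ht.2] : 0 ≤ x l - t), mul_assoc]
  rw [ek, el, ← mul_min_of_nonneg _ _ hd.le, mul_div_cancel_left₀ _ hd.ne', eP, mul_comm]
  exact mul_le_mul_of_nonneg_left h1 (mul_nonneg (by linarith [ht.1]) (by linarith [ht.2]))

/-- The quadratic minorant between neighbouring zeros integrates to a sixth of the cube of the gap,
over the gap. -/
theorem integral_gap_lower {k l : Fin n} (hkl : x k < x l) (hgap : ∀ i, x i ≤ x k ∨ x l ≤ x i) :
    min ‖P' x (x k)‖ ‖P' x (x l)‖ * (x l - x k) ^ 2 / 6 ≤ ∫ t in Set.Ioc (x k) (x l), ‖P x t‖ := by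
  have hd : 0 < x l - x k := by linarith
  rw [← intervalIntegral.integral_of_le hkl.le]
  have h1 : ∫ t in (x k)..(x l), min ‖P' x (x k)‖ ‖P' x (x l)‖ / (x l - x k) *
      ((t - x k) * (x l - t)) ≤ ∫ t in (x k)..(x l), ‖P x t‖ := by
    refine intervalIntegral.integral_mono_on hkl.le ?_ ?_ fun t ht => norm_P_gap_lower hkl hgap ht
    · exact Continuous.intervalIntegrable (by fun_prop) _ _
    · exact (continuous_norm_P x).intervalIntegrable _ _
  refine le_trans (le_of_eq ?_) h1
  have e : ∀ t : ℝ, (t - x k) * (x l - t) = (x k + x l) * t - t ^ 2 - x k * x l := fun t => by ring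
  simp_rw [e]
  rw [intervalIntegral.integral_const_mul, intervalIntegral.integral_sub,
    intervalIntegral.integral_sub, intervalIntegral.integral_const_mul, integral_id, integral_pow,
    intervalIntegral.integral_const]
  · field_simp
    simp only [smul_eq_mul]
    push_cast
    ring
  all_goals exact Continuous.intervalIntegrable (by fun_prop) _ _

/-! ### Sums over consecutive nodes -/

/-- The successor of an index, or the index itself if it is the last one. -/
def nextIndex {n : ℕ} (k : Fin n) : Fin n := if h : k.val + 1 < n then ⟨k.val + 1, h⟩ else k

open Classical in
/-- The indices `k` such that `x k` and `x (k + 1)` both exist and lie in `J`. -/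
noncomputable def pairIndices {n : ℕ} (x : Fin n → ℝ) (J : Set ℝ) : Finset (Fin n) :=
  {k | k.val + 1 < n ∧ x k ∈ J ∧ x (nextIndex k) ∈ J}

open Classical in
/-- `∑ 1 / |P'(x k)|` over the nodes in `J`. -/
noncomputable def localMass {n : ℕ} (x : Fin n → ℝ) (J : Set ℝ) : ℝ :=
  ∑ k : Fin n with x k ∈ J, 1 / ‖P' x (x k)‖

theorem nextIndex_val {k : Fin n} (h : k.val + 1 < n) : (nextIndex k).val = k.val + 1 := by
  rw [nextIndex, dif_pos h]

theorem mem_pairIndices {J : Set ℝ} {k : Fin n} :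
    k ∈ pairIndices x J ↔ k.val + 1 < n ∧ x k ∈ J ∧ x (nextIndex k) ∈ J := by
  simp [pairIndices]

theorem invMinDerivSum_eq (x : Fin n → ℝ) (J : Set ℝ) :
    invMinDerivSum x J =
      ∑ k ∈ pairIndices x J, 1 / min ‖P' x (x k)‖ ‖P' x (x (nextIndex k))‖ := by
  classical
  rw [invMinDerivSum, pairIndices, Finset.sum_filter]
  refine Finset.sum_congr rfl fun k _ => ?_
  by_cases h : k.val + 1 < n
  · have e : nextIndex k = ⟨k.val + 1, h⟩ := dif_pos h
    simp [h, e]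
  · simp [h]

theorem localMass_nonneg (x : Fin n → ℝ) (J : Set ℝ) : 0 ≤ localMass x J :=
  Finset.sum_nonneg fun _ _ => by positivity

theorem localMass_le (x : Fin n → ℝ) (J : Set ℝ) : localMass x J ≤ nodeMass x :=
  Finset.sum_le_sum_of_subset_of_nonneg (Finset.subset_univ _) fun _ _ _ => by positivity

/-- Each node belongs to at most two consecutive pairs. -/
theorem invMinDerivSum_le (hx : Function.Injective x) (J : Set ℝ) :
    invMinDerivSum x J ≤ 2 * localMass x J := by
  classical
  rw [invMinDerivSum_eq]
  have h1 : ∀ k ∈ pairIndices x J, 1 / min ‖P' x (x k)‖ ‖P' x (x (nextIndex k))‖ ≤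
      1 / ‖P' x (x k)‖ + 1 / ‖P' x (x (nextIndex k))‖ := fun k _ => by
    have hp := norm_P'_node_pos hx k
    have hp' := norm_P'_node_pos hx (nextIndex k)
    rcases min_choice ‖P' x (x k)‖ ‖P' x (x (nextIndex k))‖ with e | e <;> rw [e]
    · exact le_add_of_nonneg_right (by positivity)
    · exact le_add_of_nonneg_left (by positivity)
  refine (Finset.sum_le_sum h1).trans ?_
  rw [Finset.sum_add_distrib, two_mul]
  refine add_le_add ?_ ?_
  · refine Finset.sum_le_sum_of_subset_of_nonneg (fun k hk => ?_) fun _ _ _ => by positivity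
    simpa using (mem_pairIndices.mp hk).2.1
  · have hinj : Set.InjOn nextIndex (pairIndices x J : Set (Fin n)) := fun i hi j hj hij => by
      have h2 := congrArg Fin.val hij
      rw [nextIndex_val (mem_pairIndices.mp hi).1, nextIndex_val (mem_pairIndices.mp hj).1] at h2
      exact Fin.ext (by omega)
    rw [← Finset.sum_image (f := fun k => 1 / ‖P' x (x k)‖) hinj]
    refine Finset.sum_le_sum_of_subset_of_nonneg (fun k hk => ?_) fun _ _ _ => by positivity
    obtain ⟨i, hi, rfl⟩ := Finset.mem_image.mp hk
    simpa using (mem_pairIndices.mp hi).2.2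

theorem pair_gap (hx : StrictMono x) {k : Fin n} (hk : k.val + 1 < n) :
    x k < x (nextIndex k) ∧ ∀ i, x i ≤ x k ∨ x (nextIndex k) ≤ x i := by
  have hv := nextIndex_val hk
  refine ⟨hx (Fin.lt_def.mpr (by omega)), fun i => ?_⟩
  rcases le_or_gt i k with h | h
  · exact Or.inl (hx.monotone h)
  · refine Or.inr (hx.monotone (Fin.le_def.mpr ?_))
    rw [hv]; exact h

theorem sum_pair_le_integral (hx : StrictMono x) {A B : ℝ} :
    (∑ k ∈ pairIndices x (Set.Icc A B), min ‖P' x (x k)‖ ‖P' x (x (nextIndex k))‖ *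
      (x (nextIndex k) - x k) ^ 2) ≤ 6 * ∫ t in Set.Icc A B, ‖P x t‖ := by
  set K := pairIndices x (Set.Icc A B)
  have hI : ∀ k ∈ K, Set.Ioc (x k) (x (nextIndex k)) ⊆ Set.Icc A B := fun k hk t ht =>
    ⟨(mem_pairIndices.mp hk).2.1.1.trans ht.1.le, ht.2.trans (mem_pairIndices.mp hk).2.2.2⟩
  have hdisj : (K : Set (Fin n)).Pairwise
      (Function.onFun Disjoint fun k => Set.Ioc (x k) (x (nextIndex k))) := by
    intro i hi j hj hij
    rw [Function.onFun, Set.disjoint_left]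
    intro t hti htj
    have gi := (pair_gap hx (mem_pairIndices.mp hi).1).2
    have gj := (pair_gap hx (mem_pairIndices.mp hj).1).2
    rcases lt_or_gt_of_ne hij with h | h
    · have := hx h
      rcases gi j with g | g
      · linarith
      · linarith [hti.2, htj.1]
    · have := hx h
      rcases gj i with g | g
      · linarith
      · linarith [htj.2, hti.1]
  have hint : IntegrableOn (fun t : ℝ => ‖P x t‖) (Set.Icc A B) :=
    (continuous_norm_P x).integrableOn_Icc
  have h1 : ∑ k ∈ K, ∫ t in Set.Ioc (x k) (x (nextIndex k)), ‖P x t‖ ≤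
      ∫ t in Set.Icc A B, ‖P x t‖ := by
    rw [← integral_biUnion_finset K (fun k _ => measurableSet_Ioc) hdisj
      (fun k hk => hint.mono_set (hI k hk))]
    exact setIntegral_mono_set hint (Filter.Eventually.of_forall fun t => norm_nonneg _)
      (Filter.Eventually.of_forall (Set.iUnion₂_subset hI))
  have h2 := Finset.sum_le_sum fun k (hk : k ∈ K) =>
    integral_gap_lower (pair_gap hx (mem_pairIndices.mp hk).1).1
      (pair_gap hx (mem_pairIndices.mp hk).1).2
  rw [← Finset.sum_div] at h2
  linarith

theorem sub_le_sum_pair (hx : StrictMono x) {A B : ℝ} {i j : Fin n} (hij : i < j)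
    (hi : x i ∈ Set.Icc A B) (hj : x j ∈ Set.Icc A B) :
    x j - x i ≤ ∑ k ∈ pairIndices x (Set.Icc A B), (x (nextIndex k) - x k) := by
  classical
  set X : ℕ → ℝ := fun m => if h : m < n then x ⟨m, h⟩ else 0 with hX
  have hXx : ∀ k : Fin n, X k = x k := fun k => by simp [hX]
  have h1 : ∑ m ∈ Finset.Ico i.val j.val, (X (m + 1) - X m) = x j - x i := by
    rw [Finset.sum_Ico_eq_sub _ (Fin.lt_def.mp hij).le, Finset.sum_range_sub, Finset.sum_range_sub,
      hXx, hXx]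
    ring
  rw [← h1]
  have h2 : ∑ m ∈ Finset.Ico i.val j.val, (X (m + 1) - X m) =
      ∑ k ∈ Finset.Ico i j, (x (nextIndex k) - x k) := by
    symm
    refine Finset.sum_bij (fun k _ => k.val) ?_ ?_ ?_ ?_
    · intro k hk
      rw [Finset.mem_Ico] at hk ⊢
      exact ⟨hk.1, hk.2⟩
    · intro k _ l _ hkl; exact Fin.ext hkl
    · intro m hm
      rw [Finset.mem_Ico] at hm
      exact ⟨⟨m, hm.2.trans j.2⟩, Finset.mem_Ico.mpr ⟨hm.1, hm.2⟩, rfl⟩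
    · intro k hk
      rw [Finset.mem_Ico] at hk
      have hk1 : k.val + 1 < n := lt_of_le_of_lt (Nat.succ_le_of_lt (Fin.lt_def.mp hk.2)) j.2
      rw [← hXx k, ← hXx (nextIndex k), nextIndex_val hk1]
  rw [h2]
  refine Finset.sum_le_sum_of_subset_of_nonneg (fun k hk => ?_) fun k hk _ => ?_
  · rw [Finset.mem_Ico] at hk
    have hk1 : k.val + 1 < n := lt_of_le_of_lt (Nat.succ_le_of_lt (Fin.lt_def.mp hk.2)) j.2
    have hk2 : nextIndex k ≤ j := Fin.le_def.mpr (by rw [nextIndex_val hk1]; exact hk.2)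
    have hk3 : i ≤ nextIndex k := Fin.le_def.mpr (by
      rw [nextIndex_val hk1]; have := Fin.le_def.mp hk.1; omega)
    refine mem_pairIndices.mpr ⟨hk1, ⟨?_, ?_⟩, ⟨?_, ?_⟩⟩
    · exact hi.1.trans (hx.monotone hk.1)
    · exact (hx.monotone hk.2.le).trans hj.2
    · exact hi.1.trans (hx.monotone hk3)
    · exact (hx.monotone hk2).trans hj.2
  · linarith [(pair_gap hx (mem_pairIndices.mp hk).1).1]

/-- Cauchy–Schwarz over the gaps `d_k`, written as `√p_k d_k · 1/√p_k`: the sum of `p_k d_k²` is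
controlled by `∫|P|`, and the sum of `1/p_k` is the one defining `P₀`. -/
theorem sq_sub_le_integral_mul (hx : StrictMono x) {A B : ℝ} {i j : Fin n} (hij : i < j)
    (hi : x i ∈ Set.Icc A B) (hj : x j ∈ Set.Icc A B) :
    (x j - x i) ^ 2 ≤ 6 * (∫ t in Set.Icc A B, ‖P x t‖) * invMinDerivSum x (Set.Icc A B) := by
  set K := pairIndices x (Set.Icc A B)
  have h1 := sub_le_sum_pair hx hij hi hj
  have h2 := sum_pair_le_integral hx (A := A) (B := B)
  have hp : ∀ k, 0 < min ‖P' x (x k)‖ ‖P' x (x (nextIndex k))‖ := fun k =>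
    lt_min (norm_P'_node_pos hx.injective _) (norm_P'_node_pos hx.injective _)
  have h3 := Finset.sum_sq_le_sum_mul_sum_of_sq_le_mul K
    (r := fun k => x (nextIndex k) - x k)
    (f := fun k => min ‖P' x (x k)‖ ‖P' x (x (nextIndex k))‖ * (x (nextIndex k) - x k) ^ 2)
    (g := fun k => 1 / min ‖P' x (x k)‖ ‖P' x (x (nextIndex k))‖)
    (fun k _ => mul_nonneg (hp k).le (sq_nonneg _)) (fun k _ => by have := hp k; positivity)
    (fun k _ => by have := hp k; apply le_of_eq; field_simp)
  have h4 : 0 ≤ x j - x i := sub_nonneg.mpr (hx hij).le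
  rw [← invMinDerivSum_eq] at h3
  have hS : 0 ≤ invMinDerivSum x (Set.Icc A B) := by
    rw [invMinDerivSum_eq]
    exact Finset.sum_nonneg fun k _ => by have := hp k; positivity
  calc (x j - x i) ^ 2 ≤ (∑ k ∈ K, (x (nextIndex k) - x k)) ^ 2 := by gcongr
    _ ≤ _ := h3
    _ ≤ _ := by gcongr

theorem localIntegral_eq (x : Fin n → ℝ) (y r : ℝ) :
    localIntegral x y r = (∫ t in ball y r, ‖P x t‖) * localMass x (ball y r) := by
  classical
  rw [localIntegral, localMass, ← integral_mul_const]
  congr 1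
  funext t
  rw [Finset.mul_sum]
  exact Finset.sum_congr (by congr) fun k _ => by rw [mul_one_div]

/-- The consequences for `P₀` of a bound for the local integral, if both outer quarters of the
interval contain a node. -/
theorem normalisation_bounds {y r CJ : ℝ} (hx : StrictMono x) (hr : 0 < r)
    (hloc : localIntegral x y r ≤ CJ * (2 * r) ^ 2) {i j : Fin n}
    (hi : x i ∈ Set.Icc (y - r) (y - r / 2)) (hj : x j ∈ Set.Icc (y + r / 2) (y + r)) :
    0 < P₀ x y r ∧
    (∫ t in ball y r, ‖P x t‖) ≤ 4 * CJ * r * P₀ x y r ∧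
    P₀ x y r * localMass x (ball y r) ≤ 48 * CJ * r ∧
    r ≤ P₀ x y r * nodeMass x ∧
    P₀ x y r * r ≤ 12 * ∫ t in ball y r, ‖P x t‖ := by
  have hij : i < j := hx.lt_iff_lt.mp (by linarith [hi.2, hj.1])
  have h1 := sq_sub_le_integral_mul hx hij (A := y - r) (B := y + r)
    ⟨hi.1, by linarith [hi.2]⟩ ⟨by linarith [hj.1], hj.2⟩
  have h2 : r ^ 2 ≤ (x j - x i) ^ 2 := by
    have : r ≤ x j - x i := by linarith [hi.2, hj.1]
    gcongr
  have h3 := h2.trans h1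
  rw [← show ball y r = Set.Icc (y - r) (y + r) from rfl] at h3
  rw [localIntegral_eq] at hloc
  have h4 := invMinDerivSum_le hx.injective (ball y r)
  have h5 := localMass_le x (ball y r)
  have h6 := localMass_nonneg x (ball y r)
  have hI : 0 ≤ ∫ t in ball y r, ‖P x t‖ := integral_nonneg fun _ => norm_nonneg _
  rw [P₀]
  set I := ∫ t in ball y r, ‖P x t‖
  set S₁ := localMass x (ball y r)
  set S₂ := invMinDerivSum x (ball y r)
  have hr2 : 0 < r ^ 2 := by positivity
  have hS2 : 0 < S₂ := by
    by_contra! hneg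
    have : 6 * I * S₂ ≤ 0 := mul_nonpos_of_nonneg_of_nonpos (by positivity) hneg
    linarith
  have h7 : I * S₂ ≤ 8 * CJ * r ^ 2 := by nlinarith
  -- The lower bound `r² ≤ 6 I S₂` is played against the hypothesis `I S₁ ≤ 4 CJ r²`. The product `I
  -- S₁ S₂` then bounds `S₁` by a multiple of `S₂`, converse to `S₂ ≤ 2 S₁`.
  have h8 : r ^ 2 * S₁ ≤ 24 * CJ * r ^ 2 * S₂ := by
    calc r ^ 2 * S₁ ≤ 6 * I * S₂ * S₁ := by gcongr
      _ = 6 * S₂ * (I * S₁) := by ring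
      _ ≤ 6 * S₂ * (CJ * (2 * r) ^ 2) := by gcongr
      _ = _ := by ring
  refine ⟨by positivity, ?_, ?_, ?_, ?_⟩
  · rw [← mul_div_assoc, le_div_iff₀ hS2]; nlinarith
  · have h9 : S₁ ≤ 24 * CJ * S₂ := by
      refine le_of_mul_le_mul_left ?_ hr2
      linarith
    rw [div_mul_eq_mul_div, div_le_iff₀ hS2]
    nlinarith
  · rw [div_mul_eq_mul_div, le_div_iff₀ hS2]
    nlinarith
  · rw [div_mul_eq_mul_div, div_le_iff₀ hS2]
    nlinarith

/-! ### Cauchy's formula on rectangles -/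

/-- The integral of `f` along the boundary of `[A, B] × [C, D]`. -/
noncomputable def rectIntegral (f : ℂ → ℂ) (A B C D : ℝ) : ℂ :=
  (∫ x in A..B, f (x + C * Complex.I)) - (∫ x in A..B, f (x + D * Complex.I)) +
    Complex.I * (∫ y in C..D, f (B + y * Complex.I)) -
    Complex.I * ∫ y in C..D, f (A + y * Complex.I)

/-- The boundary of `[A, B] × [C, D]`. -/
def rectBoundary (A B C D : ℝ) : Set ℂ :=
  {z | z.re ∈ Set.Icc A B ∧ z.im ∈ Set.Icc C D ∧ (z.re = A ∨ z.re = B ∨ z.im = C ∨ z.im = D)}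

section

variable {A B C D : ℝ}

theorem continuousOn_sides (hAB : A ≤ B) (hCD : C ≤ D) {f : ℂ → ℂ}
    (hf : ContinuousOn f (rectBoundary A B C D)) :
    IntervalIntegrable (fun x : ℝ => f (x + C * Complex.I)) volume A B ∧
    IntervalIntegrable (fun x : ℝ => f (x + D * Complex.I)) volume A B ∧
    IntervalIntegrable (fun y : ℝ => f (B + y * Complex.I)) volume C D ∧
    IntervalIntegrable (fun y : ℝ => f (A + y * Complex.I)) volume C D := by
  refine ⟨?_, ?_, ?_, ?_⟩ <;> refine ContinuousOn.intervalIntegrable ?_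
  · rw [Set.uIcc_of_le hAB]
    exact hf.comp (by fun_prop) fun t ht => by simp [rectBoundary, hCD, ht.1, ht.2]
  · rw [Set.uIcc_of_le hAB]
    exact hf.comp (by fun_prop) fun t ht => by simp [rectBoundary, hCD, ht.1, ht.2]
  · rw [Set.uIcc_of_le hCD]
    exact hf.comp (by fun_prop) fun t ht => by simp [rectBoundary, hAB, ht.1, ht.2]
  · rw [Set.uIcc_of_le hCD]
    exact hf.comp (by fun_prop) fun t ht => by simp [rectBoundary, hAB, ht.1, ht.2]

theorem rectIntegral_congr (hAB : A ≤ B) (hCD : C ≤ D) {f g : ℂ → ℂ}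
    (hfg : ∀ z ∈ rectBoundary A B C D, f z = g z) :
    rectIntegral f A B C D = rectIntegral g A B C D := by
  have h1 : ∫ x in A..B, f (x + C * Complex.I) = ∫ x in A..B, g (x + C * Complex.I) := by
    refine intervalIntegral.integral_congr fun t ht => hfg _ ?_
    rw [Set.uIcc_of_le hAB] at ht
    simp [rectBoundary, hCD, ht.1, ht.2]
  have h2 : ∫ x in A..B, f (x + D * Complex.I) = ∫ x in A..B, g (x + D * Complex.I) := by
    refine intervalIntegral.integral_congr fun t ht => hfg _ ?_
    rw [Set.uIcc_of_le hAB] at ht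
    simp [rectBoundary, hCD, ht.1, ht.2]
  have h3 : ∫ y in C..D, f (B + y * Complex.I) = ∫ y in C..D, g (B + y * Complex.I) := by
    refine intervalIntegral.integral_congr fun t ht => hfg _ ?_
    rw [Set.uIcc_of_le hCD] at ht
    simp [rectBoundary, hAB, ht.1, ht.2]
  have h4 : ∫ y in C..D, f (A + y * Complex.I) = ∫ y in C..D, g (A + y * Complex.I) := by
    refine intervalIntegral.integral_congr fun t ht => hfg _ ?_
    rw [Set.uIcc_of_le hCD] at ht
    simp [rectBoundary, hAB, ht.1, ht.2]
  rw [rectIntegral, rectIntegral, h1, h2, h3, h4]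

theorem rectIntegral_sum (hAB : A ≤ B) (hCD : C ≤ D) {ι : Type*} (s : Finset ι) {f : ι → ℂ → ℂ}
    (hf : ∀ i ∈ s, ContinuousOn (f i) (rectBoundary A B C D)) :
    rectIntegral (fun z => ∑ i ∈ s, f i z) A B C D = ∑ i ∈ s, rectIntegral (f i) A B C D := by
  have h := fun i hi => continuousOn_sides hAB hCD (hf i hi)
  simp only [rectIntegral]
  rw [intervalIntegral.integral_finsetSum fun i hi => (h i hi).1,
    intervalIntegral.integral_finsetSum fun i hi => (h i hi).2.1,
    intervalIntegral.integral_finsetSum fun i hi => (h i hi).2.2.1,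
    intervalIntegral.integral_finsetSum fun i hi => (h i hi).2.2.2]
  simp only [Finset.sum_add_distrib, Finset.sum_sub_distrib, Finset.mul_sum]

theorem rectIntegral_add (hAB : A ≤ B) (hCD : C ≤ D) {f g : ℂ → ℂ}
    (hf : ContinuousOn f (rectBoundary A B C D)) (hg : ContinuousOn g (rectBoundary A B C D)) :
    rectIntegral (fun z => f z + g z) A B C D =
      rectIntegral f A B C D + rectIntegral g A B C D := by
  have h := continuousOn_sides hAB hCD hf
  have h' := continuousOn_sides hAB hCD hg
  simp only [rectIntegral]
  rw [intervalIntegral.integral_add h.1 h'.1, intervalIntegral.integral_add h.2.1 h'.2.1,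
    intervalIntegral.integral_add h.2.2.1 h'.2.2.1, intervalIntegral.integral_add h.2.2.2 h'.2.2.2]
  ring

theorem rectIntegral_const_mul (c : ℂ) (f : ℂ → ℂ) :
    rectIntegral (fun z => c * f z) A B C D = c * rectIntegral f A B C D := by
  simp only [rectIntegral, intervalIntegral.integral_const_mul]
  ring

theorem norm_rectIntegral_le (hAB : A ≤ B) (hCD : C ≤ D) {f : ℂ → ℂ} {τ : ℝ}
    (hf : ∀ z ∈ rectBoundary A B C D, ‖f z‖ ≤ τ) :
    ‖rectIntegral f A B C D‖ ≤ 2 * (τ * (B - A)) + 2 * (τ * (D - C)) := by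
  have h1 : ∀ E : ℝ, E = C ∨ E = D →
      ‖∫ x in A..B, f (x + E * Complex.I)‖ ≤ τ * (B - A) := fun E hE => by
    rw [← abs_of_nonneg (sub_nonneg.mpr hAB)]
    refine intervalIntegral.norm_integral_le_of_norm_le_const fun t ht => hf _ ?_
    rw [Set.uIoc_of_le hAB] at ht
    rcases hE with rfl | rfl <;> simp [rectBoundary, hCD, ht.1.le, ht.2]
  have h2 : ∀ E : ℝ, E = A ∨ E = B →
      ‖∫ y in C..D, f (E + y * Complex.I)‖ ≤ τ * (D - C) := fun E hE => by
    rw [← abs_of_nonneg (sub_nonneg.mpr hCD)]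
    refine intervalIntegral.norm_integral_le_of_norm_le_const fun t ht => hf _ ?_
    rw [Set.uIoc_of_le hCD] at ht
    rcases hE with rfl | rfl <;> simp [rectBoundary, hAB, ht.1.le, ht.2]
  rw [rectIntegral]
  refine (norm_sub_le _ _).trans ((add_le_add (norm_add_le _ _) le_rfl).trans
    ((add_le_add (add_le_add (norm_sub_le _ _) le_rfl) le_rfl).trans ?_))
  rw [norm_mul, norm_mul, Complex.norm_I, one_mul, one_mul]
  linarith [h1 C (Or.inl rfl), h1 D (Or.inr rfl), h2 A (Or.inl rfl), h2 B (Or.inr rfl)]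

theorem rectIntegral_eq_zero {f : ℂ → ℂ} {U : Set ℂ}
    (hsub : ∀ z : ℂ, z.re ∈ Set.Icc A B → z.im ∈ Set.Icc C D → z ∈ U) (hAB : A ≤ B) (hCD : C ≤ D)
    (hf : DifferentiableOn ℂ f U) : rectIntegral f A B C D = 0 := by
  have h := Complex.integral_boundary_rect_eq_zero_of_differentiableOn f
    ((A : ℂ) + C * Complex.I) ((B : ℂ) + D * Complex.I) (hf.mono fun z hz => ?_)
  · simpa [rectIntegral] using h
  · rw [Complex.mem_reProdIm] at hz
    simp only [Complex.add_re, Complex.ofReal_re, Complex.mul_re, Complex.I_re, mul_zero,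
      Complex.ofReal_im, Complex.I_im, mul_one, sub_self, add_zero, Complex.add_im, Complex.mul_im,
      zero_add, Set.uIcc_of_le hAB, Set.uIcc_of_le hCD] at hz
    exact hsub z hz.1 hz.2

/-- The principal logarithm is a primitive on three sides. The left side crosses its cut, so `log
(-(z - p))` is used there, and the mismatches `∓πi` at the two left corners add up to `2πi`. -/
theorem rectIntegral_inv_sub {p : ℂ} (hA : A < p.re) (hB : p.re < B) (hC : C < p.im)
    (hD : p.im < D) : rectIntegral (fun z => (z - p)⁻¹) A B C D = 2 * π * Complex.I := by
  have horiz : ∀ E : ℝ, E ≠ p.im → ∫ x in A..B, ((x : ℂ) + E * Complex.I - p)⁻¹ =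
      Complex.log (B + E * Complex.I - p) - Complex.log (A + E * Complex.I - p) := by
    intro E hE
    refine intervalIntegral.integral_eq_sub_of_hasDerivAt (f := fun x : ℝ =>
      Complex.log (x + E * Complex.I - p)) (fun t _ => ?_) ?_
    · have h1 : HasDerivAt (fun x : ℝ => (x : ℂ) + E * Complex.I - p) 1 t :=
        ((Complex.ofRealCLM.hasDerivAt (x := t)).add_const _).sub_const _
      have h2 : (t : ℂ) + E * Complex.I - p ∈ Complex.slitPlane := by
        refine Complex.mem_slitPlane_iff.mpr (Or.inr ?_)
        simpa using sub_ne_zero.mpr hE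
      simpa using h1.clog_real h2
    · refine ContinuousOn.intervalIntegrable (ContinuousOn.inv₀ (by fun_prop) fun t _ h0 => ?_)
      have := congrArg Complex.im h0
      simp at this
      exact hE (by linarith)
  have hright : ∫ y in C..D, ((B : ℂ) + y * Complex.I - p)⁻¹ * Complex.I =
      Complex.log (B + D * Complex.I - p) - Complex.log (B + C * Complex.I - p) := by
    refine intervalIntegral.integral_eq_sub_of_hasDerivAt (f := fun y : ℝ =>
      Complex.log (B + y * Complex.I - p)) (fun t _ => ?_) ?_
    · have h1 : HasDerivAt (fun y : ℝ => (B : ℂ) + y * Complex.I - p) Complex.I t := by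
        have := (((Complex.ofRealCLM.hasDerivAt (x := t)).mul_const Complex.I).const_add
          (B : ℂ)).sub_const p
        simpa using this
      have h2 : (B : ℂ) + t * Complex.I - p ∈ Complex.slitPlane := by
        refine Complex.mem_slitPlane_iff.mpr (Or.inl ?_)
        simpa using hB
      have := h1.clog_real h2
      rw [div_eq_inv_mul] at this
      exact this
    · refine ContinuousOn.intervalIntegrable (ContinuousOn.mul (ContinuousOn.inv₀ (by fun_prop)
        fun t _ h0 => ?_) continuousOn_const)
      have := congrArg Complex.re h0
      simp at this
      linarith
  have hleft : ∫ y in C..D, ((A : ℂ) + y * Complex.I - p)⁻¹ * Complex.I =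
      Complex.log (-(A + D * Complex.I - p)) - Complex.log (-(A + C * Complex.I - p)) := by
    refine intervalIntegral.integral_eq_sub_of_hasDerivAt (f := fun y : ℝ =>
      Complex.log (-(A + y * Complex.I - p))) (fun t _ => ?_) ?_
    · have h1 : HasDerivAt (fun y : ℝ => -((A : ℂ) + y * Complex.I - p)) (-Complex.I) t := by
        have := ((((Complex.ofRealCLM.hasDerivAt (x := t)).mul_const Complex.I).const_add
          (A : ℂ)).sub_const p).neg
        rw [Complex.ofRealCLM_apply, Complex.ofReal_one, one_mul] at this
        exact this
      have h2 : -((A : ℂ) + t * Complex.I - p) ∈ Complex.slitPlane := by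
        refine Complex.mem_slitPlane_iff.mpr (Or.inl ?_)
        simpa using hA
      have := h1.clog_real h2
      rw [neg_div_neg_eq, div_eq_inv_mul] at this
      exact this
    · refine ContinuousOn.intervalIntegrable (ContinuousOn.mul (ContinuousOn.inv₀ (by fun_prop)
        fun t _ h0 => ?_) continuousOn_const)
      have := congrArg Complex.re h0
      simp at this
      linarith
  rw [intervalIntegral.integral_mul_const] at hright hleft
  have e1 : Complex.log (-(A + D * Complex.I - p)) =
      Complex.log (A + D * Complex.I - p) - π * Complex.I := by
    have him : 0 < ((A : ℂ) + D * Complex.I - p).im := by simpa using hD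
    rw [Complex.log, Complex.log, norm_neg, Complex.arg_neg_eq_arg_sub_pi_of_im_pos him]
    push_cast; ring
  have e2 : Complex.log (-(A + C * Complex.I - p)) =
      Complex.log (A + C * Complex.I - p) + π * Complex.I := by
    have him : ((A : ℂ) + C * Complex.I - p).im < 0 := by simpa using hC
    rw [Complex.log, Complex.log, norm_neg, Complex.arg_neg_eq_arg_add_pi_of_im_neg him]
    push_cast; ring
  rw [rectIntegral, horiz C hC.ne, horiz D hD.ne', mul_comm Complex.I, mul_comm Complex.I, hright,
    hleft, e1, e2]
  ring

/-- Subtracting `f(p)/(z - p)` leaves the analytic function `dslope f p`, whose boundary integral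
vanishes. -/
theorem rectIntegral_div_sub {f : ℂ → ℂ} {U : Set ℂ} (hU : IsOpen U)
    (hsub : ∀ z : ℂ, z.re ∈ Set.Icc A B → z.im ∈ Set.Icc C D → z ∈ U)
    (hf : DifferentiableOn ℂ f U) {p : ℂ} (hA : A < p.re) (hB : p.re < B) (hC : C < p.im)
    (hD : p.im < D) :
    rectIntegral (fun z => f z * (z - p)⁻¹) A B C D = 2 * π * Complex.I * f p := by
  have hAB : A ≤ B := (hA.trans hB).le
  have hCD : C ≤ D := (hC.trans hD).le
  have hpU : p ∈ U := hsub p ⟨hA.le, hB.le⟩ ⟨hC.le, hD.le⟩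
  have hds : DifferentiableOn ℂ (dslope f p) U :=
    (Complex.differentiableOn_dslope (hU.mem_nhds hpU)).mpr hf
  have hne : ∀ z ∈ rectBoundary A B C D, z - p ≠ 0 := by
    rintro z ⟨-, -, h⟩ h0
    rw [sub_eq_zero] at h0
    subst h0
    rcases h with h | h | h | h <;> linarith
  have hbU : rectBoundary A B C D ⊆ U := fun z hz => hsub z hz.1 hz.2.1
  have h1 : rectIntegral (fun z => f z * (z - p)⁻¹) A B C D =
      rectIntegral (fun z => dslope f p z + f p * (z - p)⁻¹) A B C D := by
    refine rectIntegral_congr hAB hCD fun z hz => ?_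
    have hz0 := hne z hz
    rw [dslope_of_ne _ (sub_ne_zero.mp hz0), slope_def_field]
    field_simp
    ring
  rw [h1, rectIntegral_add hAB hCD (hds.continuousOn.mono hbU), rectIntegral_const_mul,
    rectIntegral_inv_sub hA hB hC hD, rectIntegral_eq_zero hsub hAB hCD hds]
  · ring
  · exact continuousOn_const.mul (ContinuousOn.inv₀ (by fun_prop) hne)

theorem rectIntegral_div_prod {E : ℂ → ℂ} {U : Set ℂ} (hU : IsOpen U)
    (hsub : ∀ z : ℂ, z.re ∈ Set.Icc A B → z.im ∈ Set.Icc C D → z ∈ U)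
    (hE : DifferentiableOn ℂ E U) {ι : Type*} [DecidableEq ι] (s : Finset ι) (hs : s.Nonempty)
    (v : ι → ℂ) (hv : Set.InjOn v s)
    (hin : ∀ i ∈ s, A < (v i).re ∧ (v i).re < B ∧ C < (v i).im ∧ (v i).im < D) :
    rectIntegral (fun z => E z * (∏ i ∈ s, (z - v i))⁻¹) A B C D =
      2 * π * Complex.I * ∑ i ∈ s, E (v i) * (∏ j ∈ s.erase i, (v i - v j))⁻¹ := by
  obtain ⟨i₀, hi₀⟩ := hs
  have hAB : A ≤ B := ((hin i₀ hi₀).1.trans (hin i₀ hi₀).2.1).le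
  have hCD : C ≤ D := ((hin i₀ hi₀).2.2.1.trans (hin i₀ hi₀).2.2.2).le
  have hne : ∀ i ∈ s, ∀ z ∈ rectBoundary A B C D, z ≠ v i := by
    rintro i hi z ⟨-, -, h⟩ h0
    subst h0
    rcases h with h | h | h | h <;> linarith [(hin i hi).1, (hin i hi).2.1, (hin i hi).2.2.1,
      (hin i hi).2.2.2]
  have hbU : rectBoundary A B C D ⊆ U := fun z hz => hsub z hz.1 hz.2.1
  have h1 : rectIntegral (fun z => E z * (∏ i ∈ s, (z - v i))⁻¹) A B C D =
      rectIntegral (fun z => ∑ i ∈ s, (∏ j ∈ s.erase i, (v i - v j))⁻¹ * (E z * (z - v i)⁻¹))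
        A B C D := by
    refine rectIntegral_congr hAB hCD fun z hz => ?_
    rw [inv_prod_sub_eq_sum s ⟨i₀, hi₀⟩ v hv fun i hi => hne i hi z hz, Finset.mul_sum]
    exact Finset.sum_congr rfl fun i _ => by ring
  rw [h1, rectIntegral_sum hAB hCD, Finset.mul_sum]
  · refine Finset.sum_congr rfl fun i hi => ?_
    obtain ⟨a1, a2, a3, a4⟩ := hin i hi
    rw [rectIntegral_const_mul, rectIntegral_div_sub hU hsub hE a1 a2 a3 a4]
    ring
  · intro i hi
    refine continuousOn_const.mul ((hE.continuousOn.mono hbU).mul (ContinuousOn.inv₀ (by fun_prop) ?_))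
    exact fun z hz => sub_ne_zero.mpr (hne i hi z hz)

end

/-! ### A localised Cauchy kernel -/

/-- The entire weight `-6 η² exp (i ζ / η) exp (-ζ² / H²)`. -/
noncomputable def weight (η H : ℝ) (ζ : ℂ) : ℂ :=
  -6 * (η : ℂ) ^ 2 * (Complex.exp (Complex.I * ζ / η) * Complex.exp (-(ζ ^ 2) / (H : ℂ) ^ 2))

/-- The cubic `ζ (ζ + 2 i η) (ζ + 3 i η)`. -/
noncomputable def cubic (η : ℝ) (ζ : ℂ) : ℂ :=
  ζ * (ζ + 2 * η * Complex.I) * (ζ + 3 * η * Complex.I)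

/-- The localised Cauchy kernel at height `η`. -/
noncomputable def cauchyKernel (η H s : ℝ) : ℂ :=
  (2 * π * Complex.I)⁻¹ *
    (weight η H (-(s + η * Complex.I)) * (cubic η (-(s + η * Complex.I)))⁻¹)

theorem norm_weight (η H : ℝ) (ζ : ℂ) :
    ‖weight η H ζ‖ = 6 * η ^ 2 * exp (-ζ.im / η + (ζ.im ^ 2 - ζ.re ^ 2) / H ^ 2) := by
  have e1 : (Complex.I * ζ / (η : ℂ)).re = -ζ.im / η := by
    rw [Complex.div_ofReal_re]; simp
  have e2 : (-(ζ ^ 2) / (H : ℂ) ^ 2).re = (ζ.im ^ 2 - ζ.re ^ 2) / H ^ 2 := by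
    rw [← Complex.ofReal_pow, Complex.div_ofReal_re, Complex.neg_re, sq ζ, Complex.mul_re]
    ring
  rw [weight, norm_mul, norm_mul, norm_mul, Complex.norm_exp, Complex.norm_exp, e1, e2, exp_add]
  simp

theorem differentiable_weight (η H : ℝ) : Differentiable ℂ (weight η H) := by
  unfold weight
  fun_prop

theorem norm_add_mul_I_sq (s t : ℝ) : ‖(s : ℂ) + t * Complex.I‖ ^ 2 = s ^ 2 + t ^ 2 := by
  rw [← Complex.normSq_eq_norm_sq, Complex.normSq_apply]; simp; ring

theorem norm_cubic_kernel (η s : ℝ) :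
    ‖cubic η (-(s + η * Complex.I))‖ =
      (s ^ 2 + η ^ 2) * ‖((-s : ℝ) : ℂ) + (2 * η : ℝ) * Complex.I‖ := by
  have e1 : ‖-((s : ℂ) + η * Complex.I) + 2 * η * Complex.I‖ = ‖(s : ℂ) + η * Complex.I‖ := by
    rw [show -((s : ℂ) + η * Complex.I) + 2 * η * Complex.I =
      -((starRingEnd ℂ) ((s : ℂ) + η * Complex.I)) by simp; ring, norm_neg, Complex.norm_conj]
  have e2 : -((s : ℂ) + η * Complex.I) + 3 * η * Complex.I =
      ((-s : ℝ) : ℂ) + (2 * η : ℝ) * Complex.I := by push_cast; ring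
  rw [cubic, norm_mul, norm_mul, norm_neg, e1, e2, ← sq, norm_add_mul_I_sq]

/-- The weight is normalised so that `weight/cubic` has residue 1 at `ζ = 0`: `(2iη)(3iη) = -6η²`.
Its factor `e^{iζ/η}` decays upwards, and the Gaussian confines everything to horizontal scale `H`.
The two extra poles, at heights `-η` and `-2η` once `ζ = z - (p + iη)`, give cubic decay on the real
line, so the first moment is `O(η)` uniformly in `H`. -/
theorem norm_cauchyKernel_le {η H : ℝ} (hη : 0 < η) (hH : η ≤ H) (s : ℝ) :
    ‖cauchyKernel η H s‖ ≤ 8 * (η / (s ^ 2 + η ^ 2)) * exp (-(s ^ 2 / H ^ 2)) ∧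
      |s| * ‖cauchyKernel η H s‖ ≤ 8 * η * (η / (s ^ 2 + η ^ 2)) := by
  have hH0 : 0 < H := hη.trans_le hH
  set M := ‖((-s : ℝ) : ℂ) + (2 * η : ℝ) * Complex.I‖ with hM
  have hM2 : M ^ 2 = s ^ 2 + 4 * η ^ 2 := by rw [hM, norm_add_mul_I_sq]; ring
  have hM0 : 0 ≤ M := norm_nonneg _
  have hMη : η ≤ M := by nlinarith
  have hMs : |s| ≤ M := by
    refine abs_le_of_sq_le_sq ?_ hM0
    nlinarith [sq_nonneg η]
  have hMpos : 0 < M := hη.trans_le hMη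
  have hq : 0 < s ^ 2 + η ^ 2 := by positivity
  have hw : ‖weight η H (-((s : ℂ) + η * Complex.I))‖ ≤ 8 * (2 * π) * η ^ 2 * exp (-(s ^ 2 / H ^ 2)) := by
    rw [norm_weight]
    have e : -(-((s : ℂ) + η * Complex.I)).im / η +
        ((-((s : ℂ) + η * Complex.I)).im ^ 2 - (-((s : ℂ) + η * Complex.I)).re ^ 2) / H ^ 2 =
        1 + η ^ 2 / H ^ 2 + -(s ^ 2 / H ^ 2) := by
      simp only [Complex.neg_im, Complex.add_im, Complex.ofReal_im, Complex.mul_im,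
        Complex.ofReal_re, Complex.I_im, Complex.I_re, Complex.neg_re, Complex.add_re,
        Complex.mul_re]
      field_simp; ring
    have h1 : exp (1 + η ^ 2 / H ^ 2) ≤ 8 := by
      have h2 : η ^ 2 / H ^ 2 ≤ 1 := by rw [div_le_one (by positivity)]; gcongr
      calc exp (1 + η ^ 2 / H ^ 2) ≤ exp (1 + 1) := exp_le_exp.mpr (by linarith)
        _ = exp 1 * exp 1 := exp_add _ _
        _ ≤ 8 := by nlinarith [exp_one_lt_d9, exp_pos 1]
    rw [e, exp_add]
    have h3 := exp_pos (-(s ^ 2 / H ^ 2))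
    calc 6 * η ^ 2 * (exp (1 + η ^ 2 / H ^ 2) * exp (-(s ^ 2 / H ^ 2)))
        ≤ 6 * η ^ 2 * (8 * exp (-(s ^ 2 / H ^ 2))) := by gcongr
      _ = 8 * 6 * η ^ 2 * exp (-(s ^ 2 / H ^ 2)) := by ring
      _ ≤ 8 * (2 * π) * η ^ 2 * exp (-(s ^ 2 / H ^ 2)) := by
          gcongr; linarith [pi_gt_three]
  have hk : ‖cauchyKernel η H s‖ ≤ 8 * (η ^ 2 / ((s ^ 2 + η ^ 2) * M)) * exp (-(s ^ 2 / H ^ 2)) := by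
    rw [cauchyKernel, norm_mul, norm_mul, norm_inv, norm_inv, norm_cubic_kernel, ← hM]
    have e : ‖(2 : ℂ) * π * Complex.I‖ = 2 * π := by simp [abs_of_pos pi_pos]
    rw [e]
    have h2π : 0 < 2 * π := by positivity
    calc (2 * π)⁻¹ * (‖weight η H (-((s : ℂ) + η * Complex.I))‖ * ((s ^ 2 + η ^ 2) * M)⁻¹)
        ≤ (2 * π)⁻¹ * (8 * (2 * π) * η ^ 2 * exp (-(s ^ 2 / H ^ 2)) * ((s ^ 2 + η ^ 2) * M)⁻¹) := by
          gcongr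
      _ = _ := by field_simp
  constructor
  · refine hk.trans ?_
    gcongr 8 * ?_ * _
    rw [div_le_div_iff₀ (by positivity) hq]
    calc η ^ 2 * (s ^ 2 + η ^ 2) = η * (s ^ 2 + η ^ 2) * η := by ring
      _ ≤ η * (s ^ 2 + η ^ 2) * M := by gcongr
      _ = η * ((s ^ 2 + η ^ 2) * M) := by ring
  · have h1 : exp (-(s ^ 2 / H ^ 2)) ≤ 1 := exp_le_one_iff.mpr (by
      have : 0 ≤ s ^ 2 / H ^ 2 := by positivity
      linarith)
    calc |s| * ‖cauchyKernel η H s‖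
        ≤ M * (8 * (η ^ 2 / ((s ^ 2 + η ^ 2) * M)) * 1) := by
          refine mul_le_mul hMs (hk.trans ?_) (norm_nonneg _) hM0
          gcongr
      _ = 8 * η * (η / (s ^ 2 + η ^ 2)) := by field_simp

theorem cubic_kernel_ne_zero {η : ℝ} (hη : 0 < η) (s : ℝ) : cubic η (-(s + η * Complex.I)) ≠ 0 := by
  rw [← norm_ne_zero_iff, norm_cubic_kernel]
  have h : ‖((-s : ℝ) : ℂ) + (2 * η : ℝ) * Complex.I‖ ^ 2 ≠ 0 := by
    rw [norm_add_mul_I_sq]; positivity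
  refine mul_ne_zero (by positivity) fun h0 => h (by rw [h0]; norm_num)

theorem continuous_cubic (η : ℝ) : Continuous (cubic η) := by unfold cubic; fun_prop

theorem continuous_cauchyKernel {η : ℝ} (hη : 0 < η) (H : ℝ) : Continuous (cauchyKernel η H) := by
  unfold cauchyKernel
  refine continuous_const.mul (((differentiable_weight η H).continuous.comp (by fun_prop)).mul
    (Continuous.inv₀ ((continuous_cubic η).comp (by fun_prop)) fun s => cubic_kernel_ne_zero hη s))

theorem integral_norm_cauchyKernel_le {η H : ℝ} (hη : 0 < η) (hH : η ≤ H) :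
    Integrable (cauchyKernel η H) ∧ ∫ s, ‖cauchyKernel η H s‖ ≤ 8 * π ∧
    Integrable (fun s => |s| * ‖cauchyKernel η H s‖) ∧
    ∫ s, |s| * ‖cauchyKernel η H s‖ ≤ 8 * π * η := by
  have h1 := poisson_one 0 hη
  simp only [sub_zero] at h1
  have hb : ∀ s, ‖cauchyKernel η H s‖ ≤ 8 * (η / (s ^ 2 + η ^ 2)) := fun s => by
    refine (norm_cauchyKernel_le hη hH s).1.trans ?_
    have : exp (-(s ^ 2 / H ^ 2)) ≤ 1 := exp_le_one_iff.mpr (by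
      have : 0 ≤ s ^ 2 / H ^ 2 := by positivity
      linarith)
    have h0 : 0 ≤ 8 * (η / (s ^ 2 + η ^ 2)) := by positivity
    nlinarith
  have hc := continuous_cauchyKernel hη H
  have hi : Integrable (cauchyKernel η H) := (h1.1.const_mul 8).mono' hc.aestronglyMeasurable
    (Filter.Eventually.of_forall hb)
  have hi2 : Integrable (fun s => |s| * ‖cauchyKernel η H s‖) :=
    (h1.1.const_mul (8 * η)).mono' (continuous_abs.mul hc.norm).aestronglyMeasurable
      (Filter.Eventually.of_forall fun s => by
        rw [norm_mul, norm_norm, norm_eq_abs, abs_abs]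
        exact (norm_cauchyKernel_le hη hH s).2)
  refine ⟨hi, ?_, hi2, ?_⟩
  · refine (integral_mono hi.norm (h1.1.const_mul 8) hb).trans (le_of_eq ?_)
    rw [integral_const_mul, h1.2]
  · refine (integral_mono hi2 (h1.1.const_mul (8 * η))
      fun s => (norm_cauchyKernel_le hη hH s).2).trans (le_of_eq ?_)
    rw [integral_const_mul, h1.2]; ring

/-! ### Representation of functions on the line of height `η` -/

theorem add_mul_I_ne_zero_of_im {ζ : ℂ} {c : ℝ} (h : ζ.im ≠ -c) : ζ + c * Complex.I ≠ 0 := by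
  intro h0
  have := congrArg Complex.im h0
  simp at this
  exact h (by linarith)

theorem norm_two_pi_I : ‖(2 : ℂ) * π * Complex.I‖ = 2 * π := by simp [abs_of_pos pi_pos]

theorem two_pi_I_ne_zero : (2 : ℂ) * π * Complex.I ≠ 0 := by
  rw [← norm_ne_zero_iff, norm_two_pi_I]; positivity

/-- Cauchy's formula on `[-3, 3] × [0, H]`. The condition `y₀ ≤ η` keeps the kernel's two lower
poles out of the domain, so the only residue is at `x + iη`, and the bottom side is the kernel
integral. -/
theorem upper_representation {G : ℂ → ℂ} {η H y₀ τ x : ℝ} (hη : 0 < η) (hH : η < H) (hH1 : H ≤ 1)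
    (hy₀ : 0 < y₀) (hy₀η : y₀ ≤ η) (hx : |x| ≤ 1)
    (hG : DifferentiableOn ℂ G {z | -y₀ < z.im})
    (htop : ∀ t : ℝ, |t| ≤ 3 → ‖G (t + H * Complex.I) *
      (weight η H (t + H * Complex.I - (x + η * Complex.I)) *
        (cubic η (t + H * Complex.I - (x + η * Complex.I)))⁻¹)‖ ≤ τ)
    (hside : ∀ t y : ℝ, |t| = 3 → 0 ≤ y → y ≤ H → ‖G (t + y * Complex.I) *
      (weight η H (t + y * Complex.I - (x + η * Complex.I)) *
        (cubic η (t + y * Complex.I - (x + η * Complex.I)))⁻¹)‖ ≤ τ) :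
    ‖G (x + η * Complex.I) - ∫ t in (-3 : ℝ)..3, G t * cauchyKernel η H (x - t)‖ ≤ 2 * τ := by
  set z₀ : ℂ := x + η * Complex.I with hz₀
  have hz₀re : z₀.re = x := by simp [hz₀]
  have hz₀im : z₀.im = η := by simp [hz₀]
  set g : ℂ → ℂ := fun z => G z * (weight η H (z - z₀) * (cubic η (z - z₀))⁻¹) with hg
  set f : ℂ → ℂ := fun z => G z * weight η H (z - z₀) *
    ((z - z₀ + 2 * η * Complex.I) * (z - z₀ + 3 * η * Complex.I))⁻¹ with hf
  have hU : IsOpen {z : ℂ | -y₀ < z.im} := isOpen_lt continuous_const Complex.continuous_im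
  have hfd : DifferentiableOn ℂ f {z | -y₀ < z.im} := by
    have hne : ∀ z ∈ {z : ℂ | -y₀ < z.im},
        (z - z₀ + 2 * η * Complex.I) * (z - z₀ + 3 * η * Complex.I) ≠ 0 := fun z hz => by
      have hz' : -y₀ < z.im := hz
      have h2 := add_mul_I_ne_zero_of_im (ζ := z - z₀) (c := 2 * η) (by
        rw [Complex.sub_im, hz₀im]; intro h; linarith)
      have h3 := add_mul_I_ne_zero_of_im (ζ := z - z₀) (c := 3 * η) (by
        rw [Complex.sub_im, hz₀im]; intro h; linarith)
      push_cast at h2 h3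
      exact mul_ne_zero h2 h3
    refine (hG.mul ?_).mul (DifferentiableOn.inv (by fun_prop) hne)
    exact ((differentiable_weight η H).comp (by fun_prop)).differentiableOn
  have hres := rectIntegral_div_sub (A := -3) (B := 3) (C := 0) (D := H) hU
    (fun z _ hz => by
      have := hz.1
      simp only [Set.mem_ofPred_eq]; linarith) hfd (p := z₀)
    (by rw [hz₀re]; linarith [neg_le_of_abs_le hx]) (by rw [hz₀re]; linarith [le_of_abs_le hx])
    (by rw [hz₀im]; exact hη) (by rw [hz₀im]; exact hH)
  have hηC : (η : ℂ) ≠ 0 := by exact_mod_cast hη.ne'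
  -- The normalisation `-6η²` of the weight cancels the product of the two remaining linear factors
  -- at `ζ = 0`.
  have hf0 : f z₀ = G z₀ := by
    simp only [hf, weight, sub_self]
    simp
    field_simp
    linear_combination (-(6 * G z₀)) * Complex.I_sq
  have hfg : (fun z => f z * (z - z₀)⁻¹) = g := by
    funext z
    simp only [hf, hg, cubic, mul_inv]
    ring
  rw [hf0, hfg, rectIntegral] at hres
  have hbot : ∫ t in (-3 : ℝ)..3, g (t + (0 : ℝ) * Complex.I) =
      2 * π * Complex.I * ∫ t in (-3 : ℝ)..3, G t * cauchyKernel η H (x - t) := by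
    rw [← intervalIntegral.integral_const_mul]
    congr 1
    funext t
    have e : (t : ℂ) - z₀ = -(((x - t : ℝ) : ℂ) + η * Complex.I) := by rw [hz₀]; push_cast; ring
    simp only [hg, Complex.ofReal_zero, zero_mul, add_zero, cauchyKernel, e]
    have := two_pi_I_ne_zero
    field_simp
  rw [hbot] at hres
  have hHpos : 0 < H := hη.trans hH
  have b1 : ‖∫ t in (-3 : ℝ)..3, g (t + H * Complex.I)‖ ≤ τ * 6 := by
    rw [show (6 : ℝ) = |3 - (-3)| by norm_num]
    refine intervalIntegral.norm_integral_le_of_norm_le_const fun t ht => htop t ?_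
    rw [Set.uIoc_of_le (by norm_num)] at ht
    exact abs_le.mpr ⟨ht.1.le, ht.2⟩
  have b2 : ‖∫ y in (0 : ℝ)..H, g ((3 : ℝ) + y * Complex.I)‖ ≤ τ * H := by
    nth_rewrite 2 [show H = |H - 0| by rw [sub_zero, abs_of_pos hHpos]]
    refine intervalIntegral.norm_integral_le_of_norm_le_const fun t ht => hside 3 t (by norm_num) ?_ ?_
    all_goals rw [Set.uIoc_of_le (hη.trans hH).le] at ht
    exacts [ht.1.le, ht.2]
  have b3 : ‖∫ y in (0 : ℝ)..H, g ((-3 : ℝ) + y * Complex.I)‖ ≤ τ * H := by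
    nth_rewrite 2 [show H = |H - 0| by rw [sub_zero, abs_of_pos hHpos]]
    refine intervalIntegral.norm_integral_le_of_norm_le_const fun t ht => hside (-3) t (by norm_num) ?_ ?_
    all_goals rw [Set.uIoc_of_le (hη.trans hH).le] at ht
    exacts [ht.1.le, ht.2]
  have hτ : 0 ≤ τ := (norm_nonneg _).trans (htop 0 (by norm_num))
  have hmul : ‖2 * π * Complex.I * (G z₀ - ∫ t in (-3 : ℝ)..3, G t * cauchyKernel η H (x - t))‖ ≤
      τ * 6 + τ * H + τ * H := by
    have e : 2 * π * Complex.I * (G z₀ - ∫ t in (-3 : ℝ)..3, G t * cauchyKernel η H (x - t)) =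
        -(∫ t in (-3 : ℝ)..3, g (t + H * Complex.I)) +
          Complex.I * (∫ y in (0 : ℝ)..H, g ((3 : ℝ) + y * Complex.I)) -
          Complex.I * ∫ y in (0 : ℝ)..H, g ((-3 : ℝ) + y * Complex.I) := by
      rw [mul_sub, ← hres]; ring
    rw [e]
    refine (norm_sub_le _ _).trans (add_le_add ((norm_add_le _ _).trans (add_le_add ?_ ?_)) ?_)
    · rw [norm_neg]; exact b1
    · rw [norm_mul, Complex.norm_I, one_mul]; exact b2
    · rw [norm_mul, Complex.norm_I, one_mul]; exact b3
  rw [norm_mul, norm_two_pi_I] at hmul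
  have hpi := pi_gt_three
  have h9 := norm_nonneg (G z₀ - ∫ t in (-3 : ℝ)..3, G t * cauchyKernel η H (x - t))
  nlinarith

variable {n : ℕ} {x : Fin n → ℝ}

/-- Residues of `e^{-iωz}/P` times the kernel on `[-3, 3] × [-H, H]`: one at `p + iη`, one at each
node, and two spurious ones at `p - iη` and `p - 2iη`. The spurious ones are kept as explicit errors
because `e^{-iωz}/P` is exponentially small there. -/
theorem lower_representation (hx : Function.Injective x) (hx1 : ∀ i, x i ∈ Set.Icc (-1 : ℝ) 1)
    {η H τ om p : ℝ} (hη : 0 < η) (hH : 3 * η ≤ H) (hH1 : H ≤ 1) (hp : |p| ≤ 1)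
    (hbd : ∀ z ∈ rectBoundary (-3) 3 (-H) H, ‖Complex.exp (-(Complex.I * om * z)) * (P x z)⁻¹ *
      (weight η H (z - (p + η * Complex.I)) * (cubic η (z - (p + η * Complex.I)))⁻¹)‖ ≤ τ) :
    ‖Complex.exp (-(Complex.I * om * (p + η * Complex.I))) * (P x (p + η * Complex.I))⁻¹ +
      2 * π * Complex.I * ∑ k, Complex.exp (-(Complex.I * om * x k)) * (P' x (x k))⁻¹ *
        cauchyKernel η H (p - x k)‖ ≤
      3 * τ + 180 * (‖Complex.exp (-(Complex.I * om * (p - η * Complex.I))) *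
          (P x (p - η * Complex.I))⁻¹‖ +
        ‖Complex.exp (-(Complex.I * om * (p - 2 * η * Complex.I))) *
          (P x (p - 2 * η * Complex.I))⁻¹‖) := by
  have hHpos : 0 < H := by linarith
  set z₀ : ℂ := p + η * Complex.I with hz₀
  set z₁ : ℂ := p - η * Complex.I with hz₁
  set z₂ : ℂ := p - 2 * η * Complex.I with hz₂
  -- The kernel's three poles are treated as additional nodes, so that one partial fraction
  -- expansion yields all residues.
  set v : Fin n ⊕ Fin 3 → ℂ := Sum.elim (fun k => (x k : ℂ)) ![z₀, z₁, z₂] with hv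
  set E : ℂ → ℂ := fun z => Complex.exp (-(Complex.I * om * z)) * weight η H (z - z₀) with hE
  have him0 : z₀.im = η := by simp [hz₀]
  have him1 : z₁.im = -η := by simp [hz₁]
  have him2 : z₂.im = -(2 * η) := by simp [hz₂]
  have hre0 : z₀.re = p := by simp [hz₀]
  have hre1 : z₁.re = p := by simp [hz₁]
  have hre2 : z₂.re = p := by simp [hz₂]
  have hinj : Set.InjOn v (Finset.univ : Finset (Fin n ⊕ Fin 3)) := by
    have h3 : Function.Injective (![z₀, z₁, z₂] : Fin 3 → ℂ) := by
      intro i j hij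
      have h := congrArg Complex.im hij
      fin_cases i <;> fin_cases j <;> simp [him0, him1, him2] at h ⊢ <;> linarith
    refine (Function.Injective.sumElim (fun i j h => hx (by exact_mod_cast h)) h3 ?_).injOn
    intro k j h
    have h := congrArg Complex.im h
    fin_cases j <;> simp [him0, him1, him2] at h <;> linarith
  have hin : ∀ i ∈ (Finset.univ : Finset (Fin n ⊕ Fin 3)), -3 < (v i).re ∧ (v i).re < 3 ∧
      -H < (v i).im ∧ (v i).im < H := by
    have hp' := abs_le.mp hp
    rintro (k | j) -
    · have := hx1 k
      simp only [hv, Sum.elim_inl, Complex.ofReal_re, Complex.ofReal_im]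
      refine ⟨by linarith [this.1], by linarith [this.2], by linarith, hHpos⟩
    · fin_cases j <;> simp [hv, him0, him1, him2, hre0, hre1, hre2] <;>
        refine ⟨by linarith, by linarith, by linarith, by linarith⟩
  have hEd : DifferentiableOn ℂ E Set.univ := by
    have h1 : Differentiable ℂ fun z : ℂ => weight η H (z - z₀) :=
      (differentiable_weight η H).comp (by fun_prop)
    have h2 : Differentiable ℂ fun z : ℂ => Complex.exp (-(Complex.I * om * z)) := by fun_prop
    exact (h2.mul h1).differentiableOn
  have hres := rectIntegral_div_prod (A := -3) (B := 3) (C := -H) (D := H) isOpen_univ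
    (fun _ _ _ => Set.mem_univ _) hEd Finset.univ ⟨Sum.inr 0, Finset.mem_univ _⟩ v hinj hin
  have hprod : ∀ z, (∏ i, (z - v i)) = P x z * cubic η (z - z₀) := by
    intro z
    rw [Fintype.prod_sum_type, Fin.prod_univ_three, P_eq_prod, cubic]
    simp only [hv, Sum.elim_inl, Sum.elim_inr, Matrix.cons_val_zero, Matrix.cons_val_one,
      Matrix.cons_val]
    rw [hz₁, hz₂, show z - z₀ + 2 * η * Complex.I = z - (p - η * Complex.I) by rw [hz₀]; ring,
      show z - z₀ + 3 * η * Complex.I = z - (p - 2 * η * Complex.I) by rw [hz₀]; ring]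
  have her1 : ∀ k : Fin n, (Finset.univ : Finset (Fin n ⊕ Fin 3)).erase (Sum.inl k) =
      (Finset.univ.erase k).disjSum Finset.univ := fun k => by
    ext i; rcases i with i | i <;> simp
  have her2 : ∀ j : Fin 3, (Finset.univ : Finset (Fin n ⊕ Fin 3)).erase (Sum.inr j) =
      Finset.univ.disjSum (Finset.univ.erase j) := fun j => by
    ext i; rcases i with i | i <;> simp
  have h0e : (Finset.univ : Finset (Fin 3)).erase 0 = {1, 2} := by decide
  have h1e : (Finset.univ : Finset (Fin 3)).erase 1 = {0, 2} := by decide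
  have h2e : (Finset.univ : Finset (Fin 3)).erase 2 = {0, 1} := by decide
  have hk : ∀ k : Fin n, E (v (Sum.inl k)) *
      (∏ j ∈ Finset.univ.erase (Sum.inl k), (v (Sum.inl k) - v j))⁻¹ =
      2 * π * Complex.I * (Complex.exp (-(Complex.I * om * x k)) * (P' x (x k))⁻¹ *
        cauchyKernel η H (p - x k)) := by
    intro k
    rw [her1, Finset.prod_disjSum, Fin.prod_univ_three]
    simp only [hv, Sum.elim_inl, Sum.elim_inr, Matrix.cons_val_zero, Matrix.cons_val_one,
      Matrix.cons_val, ← P'_node, hE]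
    have e : (x k : ℂ) - z₀ = -(((p - x k : ℝ) : ℂ) + η * Complex.I) := by
      rw [hz₀]; push_cast; ring
    have e2 : ((x k : ℂ) - z₀) * (x k - z₁) * (x k - z₂) = cubic η (x k - z₀) := by
      rw [cubic, hz₀, hz₁, hz₂]; ring
    rw [e2, e, cauchyKernel]
    have := two_pi_I_ne_zero
    rw [mul_inv]
    field_simp
  have hηC : (η : ℂ) ≠ 0 := by exact_mod_cast hη.ne'
  have hj0 : E (v (Sum.inr 0)) * (∏ j ∈ Finset.univ.erase (Sum.inr 0), (v (Sum.inr 0) - v j))⁻¹ =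
      Complex.exp (-(Complex.I * om * z₀)) * (P x z₀)⁻¹ := by
    rw [her2, Finset.prod_disjSum, h0e, Finset.prod_pair (by decide)]
    simp only [hv, Sum.elim_inl, Sum.elim_inr, Matrix.cons_val_zero, Matrix.cons_val_one,
      Matrix.cons_val, ← P_eq_prod, hE]
    have e : (z₀ - z₁) * (z₀ - z₂) = -6 * (η : ℂ) ^ 2 := by
      rw [hz₀, hz₁, hz₂]; linear_combination (6 * (η : ℂ) ^ 2) * Complex.I_sq
    rw [e, sub_self, weight]
    simp only [mul_zero, zero_div, Complex.exp_zero, mul_inv]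
    simp
    field_simp
  have hj1 : E (v (Sum.inr 1)) * (∏ j ∈ Finset.univ.erase (Sum.inr 1), (v (Sum.inr 1) - v j))⁻¹ =
      Complex.exp (-(Complex.I * om * z₁)) * (P x z₁)⁻¹ *
        (weight η H (-(2 * η : ℝ) * Complex.I) * (2 * (η : ℂ) ^ 2)⁻¹) := by
    rw [her2, Finset.prod_disjSum, h1e, Finset.prod_pair (by decide)]
    simp only [hv, Sum.elim_inl, Sum.elim_inr, Matrix.cons_val_zero, Matrix.cons_val_one,
      Matrix.cons_val, ← P_eq_prod, hE]
    have e : (z₁ - z₀) * (z₁ - z₂) = 2 * (η : ℂ) ^ 2 := by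
      rw [hz₀, hz₁, hz₂]; linear_combination (-(2 * (η : ℂ) ^ 2)) * Complex.I_sq
    have e2 : z₁ - z₀ = -(2 * η : ℝ) * Complex.I := by rw [hz₀, hz₁]; push_cast; ring
    rw [e, e2, mul_inv]
    ring
  have hj2 : E (v (Sum.inr 2)) * (∏ j ∈ Finset.univ.erase (Sum.inr 2), (v (Sum.inr 2) - v j))⁻¹ =
      Complex.exp (-(Complex.I * om * z₂)) * (P x z₂)⁻¹ *
        (weight η H (-(3 * η : ℝ) * Complex.I) * (-3 * (η : ℂ) ^ 2)⁻¹) := by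
    rw [her2, Finset.prod_disjSum, h2e, Finset.prod_pair (by decide)]
    simp only [hv, Sum.elim_inl, Sum.elim_inr, Matrix.cons_val_zero, Matrix.cons_val_one,
      Matrix.cons_val, ← P_eq_prod, hE]
    have e : (z₂ - z₀) * (z₂ - z₁) = -3 * (η : ℂ) ^ 2 := by
      rw [hz₀, hz₁, hz₂]; linear_combination (3 * (η : ℂ) ^ 2) * Complex.I_sq
    have e2 : z₂ - z₀ = -(3 * η : ℝ) * Complex.I := by rw [hz₀, hz₂]; push_cast; ring
    rw [e, e2, mul_inv]
    ring
  rw [Fintype.sum_sum_type, Fin.sum_univ_three, hj0, hj1, hj2] at hres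
  simp_rw [hk] at hres
  rw [← Finset.mul_sum] at hres
  have hηH : η ^ 2 / H ^ 2 ≤ 1 / 9 := by
    rw [div_le_div_iff₀ (by positivity) (by norm_num)]
    nlinarith
  have hw : ∀ c : ℝ, 0 ≤ c → c ≤ 3 → ‖weight η H (-(c * η : ℝ) * Complex.I)‖ ≤ 6 * η ^ 2 * exp 4 := by
    intro c hc0 hc
    rw [norm_weight]
    have e : -(-((c * η : ℝ) : ℂ) * Complex.I).im / η + ((-((c * η : ℝ) : ℂ) * Complex.I).im ^ 2 -
        (-((c * η : ℝ) : ℂ) * Complex.I).re ^ 2) / H ^ 2 = c + c ^ 2 * (η ^ 2 / H ^ 2) := by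
      simp
      field_simp
    rw [e]
    have h3 : c ^ 2 * (η ^ 2 / H ^ 2) ≤ 9 * (1 / 9) :=
      mul_le_mul (by nlinarith) hηH (by positivity) (by norm_num)
    gcongr
    linarith
  have hexp4 : exp 4 ≤ 60 := by
    have : exp 4 = exp 1 ^ 4 := by rw [← exp_nat_mul]; norm_num
    rw [this]
    calc exp 1 ^ 4 ≤ (2.7182818286 : ℝ) ^ 4 := by
          gcongr; exact exp_one_lt_d9.le
      _ ≤ 60 := by norm_num
  -- The weight at the spurious poles is at most `6η² e⁴ ≤ 360η²`; division by `2η²` and `3η²` gives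
  -- 180 and 120.
  have hc1 : ‖weight η H (-(2 * η : ℝ) * Complex.I) * (2 * (η : ℂ) ^ 2)⁻¹‖ ≤ 180 := by
    rw [norm_mul, norm_inv, norm_mul, norm_pow, Complex.norm_real, norm_eq_abs, abs_of_pos hη,
      Complex.norm_ofNat, ← div_eq_mul_inv, div_le_iff₀ (by positivity)]
    nlinarith [hw 2 (by norm_num) (by norm_num), sq_nonneg η]
  have hc2 : ‖weight η H (-(3 * η : ℝ) * Complex.I) * (-3 * (η : ℂ) ^ 2)⁻¹‖ ≤ 120 := by
    rw [norm_mul, norm_inv, norm_mul, norm_pow, Complex.norm_real, norm_eq_abs, abs_of_pos hη,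
      norm_neg, Complex.norm_ofNat, ← div_eq_mul_inv, div_le_iff₀ (by positivity)]
    nlinarith [hw 3 (by norm_num) (by norm_num), sq_nonneg η]
  have hrect := norm_rectIntegral_le (A := -3) (B := 3) (C := -H) (D := H) (by norm_num)
    (by linarith) (f := fun z => E z * (∏ i, (z - v i))⁻¹) (τ := τ) (fun z hz => by
      refine le_trans (le_of_eq ?_) (hbd z hz)
      rw [hprod, hE, mul_inv]
      congr 1
      ring)
  rw [hres, norm_mul, norm_two_pi_I] at hrect
  set S := 2 * π * Complex.I * ∑ k, Complex.exp (-(Complex.I * om * x k)) * (P' x (x k))⁻¹ *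
        cauchyKernel η H (p - x k)
  set F₀ := Complex.exp (-(Complex.I * om * z₀)) * (P x z₀)⁻¹
  set F₁ := Complex.exp (-(Complex.I * om * z₁)) * (P x z₁)⁻¹
  set F₂ := Complex.exp (-(Complex.I * om * z₂)) * (P x z₂)⁻¹
  set w₁ := weight η H (-(2 * η : ℝ) * Complex.I) * (2 * (η : ℂ) ^ 2)⁻¹
  set w₂ := weight η H (-(3 * η : ℝ) * Complex.I) * (-3 * (η : ℂ) ^ 2)⁻¹
  have hτ : 0 ≤ τ := (norm_nonneg _).trans (hbd ((-3 : ℝ) : ℂ) (by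
    simp [rectBoundary, hHpos.le]))
  have h1 : ‖S + (F₀ + F₁ * w₁ + F₂ * w₂)‖ ≤ 3 * τ := by
    have := pi_gt_three
    have h9 := norm_nonneg (S + (F₀ + F₁ * w₁ + F₂ * w₂))
    have h10 : τ * (H - -H) ≤ τ * 2 := by gcongr; linarith
    nlinarith
  have h2 : F₀ + S = (S + (F₀ + F₁ * w₁ + F₂ * w₂)) - F₁ * w₁ - F₂ * w₂ := by ring
  rw [h2]
  refine (norm_sub_le _ _).trans ((add_le_add (norm_sub_le _ _) le_rfl).trans ?_)
  rw [norm_mul F₁, norm_mul F₂]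
  have h3 : ‖F₁‖ * ‖w₁‖ ≤ ‖F₁‖ * 180 := by gcongr
  have h4 : ‖F₂‖ * ‖w₂‖ ≤ ‖F₂‖ * 180 := by gcongr; linarith
  linarith

/-! ### Partitions of unity -/

namespace IsBumpPartition

variable {φ : ℤ → ℝ → ℝ} {s : ℤ → ℝ} {L Cφ : ℝ} {N : ℕ}

theorem continuous (h : IsBumpPartition φ s L Cφ N) (j : ℤ) : Continuous (φ j) :=
  (h.smooth j).continuous

theorem nonneg (h : IsBumpPartition φ s L Cφ N) (j : ℤ) (t : ℝ) : 0 ≤ φ j t := (h.mem_Icc j t).1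

theorem eq_zero (h : IsBumpPartition φ s L Cφ N) {j : ℤ} {t : ℝ}
    (ht : t ∉ Set.Icc (s j) (s j + L)) : φ j t = 0 := by
  by_contra h0
  exact ht (h.support_subset j h0)

theorem integrable (h : IsBumpPartition φ s L Cφ N) (j : ℤ) : Integrable (φ j) :=
  (h.continuous j).integrable_of_hasCompactSupport
    (HasCompactSupport.of_support_subset_isCompact isCompact_Icc (h.support_subset j))

theorem sum_le_one (h : IsBumpPartition φ s L Cφ N) (G : Finset ℤ) (t : ℝ) :
    ∑ j ∈ G, φ j t ≤ 1 :=
  sum_le_hasSum G (fun j _ => h.nonneg j t) (h.sum_eq_one t)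

theorem const_nonneg (h : IsBumpPartition φ s L Cφ N) : 0 ≤ Cφ / L :=
  (abs_nonneg _).trans (h.deriv_le 0 0)

theorem abs_sub_le (h : IsBumpPartition φ s L Cφ N) (j : ℤ) (p t : ℝ) :
    |φ j p - φ j t| ≤ Cφ / L * |p - t| := by
  have := convex_univ.norm_image_sub_le_of_norm_deriv_le (𝕜 := ℝ) (f := φ j) (C := Cφ / L)
    (fun z _ => (h.smooth j).differentiable (by simp) z) (fun z _ => h.deriv_le j z)
    (Set.mem_univ t) (Set.mem_univ p)
  simpa using this

theorem card_filter_le (h : IsBumpPartition φ s L Cφ N) (G : Finset ℤ) (t : ℝ) :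
    (G.filter fun j => t ∈ Set.Icc (s j) (s j + L)).card ≤ N := by
  have h1 : ((G.filter fun j => t ∈ Set.Icc (s j) (s j + L) : Finset ℤ) : Set ℤ).encard ≤ N :=
    (Set.encard_le_encard fun j hj => by
      rw [Finset.coe_filter] at hj; exact hj.2).trans (h.overlap t)
  rw [Set.encard_coe_eq_coe_finsetCard] at h1
  exact_mod_cast h1

/-- At most `2N` of the terms are nonzero, namely those with `p` or `t` in the supporting interval.
The bound is thus independent of the size of `G`. -/
theorem sum_abs_sub_le (h : IsBumpPartition φ s L Cφ N) (G : Finset ℤ) (p t : ℝ) :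
    ∑ j ∈ G, |φ j p - φ j t| ≤ 2 * N * (Cφ / L) * |p - t| := by
  have h0 := h.const_nonneg
  have hle : ∀ j ∈ G, |φ j p - φ j t| ≤
      (if p ∈ Set.Icc (s j) (s j + L) then Cφ / L * |p - t| else 0) +
        (if t ∈ Set.Icc (s j) (s j + L) then Cφ / L * |p - t| else 0) := fun j _ => by
    have h1 := h.abs_sub_le j p t
    have h2 : 0 ≤ Cφ / L * |p - t| := by positivity
    by_cases hp : p ∈ Set.Icc (s j) (s j + L)
    · rw [if_pos hp]; split_ifs <;> linarith
    · by_cases ht : t ∈ Set.Icc (s j) (s j + L)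
      · rw [if_neg hp, if_pos ht]; linarith
      · rw [h.eq_zero hp, h.eq_zero ht, if_neg hp, if_neg ht]; simp
  refine (Finset.sum_le_sum hle).trans ?_
  rw [Finset.sum_add_distrib, ← Finset.sum_filter, ← Finset.sum_filter, Finset.sum_const,
    Finset.sum_const, nsmul_eq_mul, nsmul_eq_mul]
  have c1 : ((G.filter fun j => p ∈ Set.Icc (s j) (s j + L)).card : ℝ) ≤ N := by
    exact_mod_cast h.card_filter_le G p
  have c2 : ((G.filter fun j => t ∈ Set.Icc (s j) (s j + L)).card : ℝ) ≤ N := by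
    exact_mod_cast h.card_filter_le G t
  have h2 : 0 ≤ Cφ / L * |p - t| := by positivity
  calc _ ≤ N * (Cφ / L * |p - t|) + N * (Cφ / L * |p - t|) := by gcongr
    _ = _ := by ring

/-- Every interval of length `L` contains a multiple of `L`. Only finitely many multiples lie in
`[A, B]`, and each belongs to at most `N` of the intervals. -/
theorem finite_of_subset (h : IsBumpPartition φ s L Cφ N) (hL : 0 < L) {A B : ℝ} {G : Set ℤ}
    (hG : ∀ j ∈ G, Set.Icc (s j) (s j + L) ⊆ Set.Icc A B) : G.Finite := by
  have hcov : G ⊆ ⋃ m ∈ Set.Icc ⌈A / L⌉ ⌊B / L⌋, {j : ℤ | (m : ℝ) * L ∈ Set.Icc (s j) (s j + L)} := by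
    intro j hj
    have h1 : (⌈s j / L⌉ : ℝ) * L ∈ Set.Icc (s j) (s j + L) := by
      constructor
      · rw [← div_le_iff₀ hL]; exact Int.le_ceil _
      · have := (Int.ceil_lt_add_one (s j / L)).le
        calc (⌈s j / L⌉ : ℝ) * L ≤ (s j / L + 1) * L := by gcongr
          _ = s j + L := by field_simp
    have h2 := hG j hj h1
    simp only [Set.mem_iUnion]
    refine ⟨⌈s j / L⌉, ⟨?_, ?_⟩, h1⟩
    · rw [Int.ceil_le, div_le_iff₀ hL]; exact h2.1
    · rw [Int.le_floor, le_div_iff₀ hL]; exact h2.2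
  refine Set.Finite.subset ?_ hcov
  refine (Set.finite_Icc _ _).biUnion fun m _ => ?_
  exact Set.finite_of_encard_le_coe (h.overlap _)

end IsBumpPartition

/-! ### Smoothing against an approximate identity -/

/-- By Fubini the kernel is moved onto `φ_j`, and what matters is `φ_j * k - φ_j`. The measure `ν`
is general because the lemma is used both for Lebesgue measure on `J₀` and for the counting measure
of the nodes. -/
theorem sum_norm_transfer_le {k : ℝ → ℂ} (hk : Continuous k) {Kb : ℝ} (hKb : ∀ u, ‖k u‖ ≤ Kb)
    (hki : Integrable k) (hk1 : Integrable fun u => |u| * ‖k u‖) {M₁ ε₁ : ℝ}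
    (hM₁ : ∫ u, |u| * ‖k u‖ ≤ M₁) (hε₁ : ‖(∫ u, k u) - 1‖ ≤ ε₁)
    {ν : Measure ℝ} [SFinite ν] {w : ℝ → ℝ} (hw : Integrable w ν) (hw0 : ∀ t, 0 ≤ w t)
    {φ : ℤ → ℝ → ℝ} {s : ℤ → ℝ} {L Cφ : ℝ} {N : ℕ} (hφ : IsBumpPartition φ s L Cφ N)
    (G : Finset ℤ) {g : ℤ → ℝ → ℂ} (hg : ∀ j ∈ G, Measurable (g j))
    (hgw : ∀ j ∈ G, ∀ t, ‖g j t‖ ≤ w t) :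
    ∑ j ∈ G, ‖(∫ p, (φ j p : ℂ) * ∫ t, g j t * k (p - t) ∂ν) - ∫ t, (φ j t : ℂ) * g j t ∂ν‖ ≤
      (2 * N * (Cφ / L) * M₁ + ε₁) * ∫ t, w t ∂ν := by
  have hφc : ∀ j, Continuous fun p => (φ j p : ℂ) := fun j =>
    Complex.continuous_ofReal.comp (hφ.continuous j)
  have hφn : ∀ j p, ‖(φ j p : ℂ)‖ = φ j p := fun j p => by
    rw [Complex.norm_real, norm_eq_abs, abs_of_nonneg (hφ.nonneg j p)]
  have hε0 : 0 ≤ ε₁ := (norm_nonneg _).trans hε₁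
  have hM0 : 0 ≤ M₁ := (integral_nonneg fun u => by simp only [Pi.zero_apply]; positivity).trans hM₁
  set d : ℤ → ℝ → ℂ := fun j t => (∫ p, (φ j p : ℂ) * k (p - t)) - φ j t with hd
  have hki' : ∀ t, Integrable fun p => k (p - t) := fun t => hki.comp_sub_right t
  have hφk : ∀ j t, Integrable fun p => (φ j p : ℂ) * k (p - t) := fun j t =>
    ((hφ.integrable j).mul_const Kb).mono'
      ((hφc j).mul (hk.comp (by fun_prop))).aestronglyMeasurable
      (Filter.Eventually.of_forall fun p => by
        rw [norm_mul, hφn]; exact mul_le_mul_of_nonneg_left (hKb _) (hφ.nonneg j p))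
  -- The smoothing error splits into the variation of `φ_j`, paid for by the first moment, and
  -- `φ_j(t)` times the defect of the kernel's mass. Summing over `j` pointwise before integrating
  -- avoids any factor `|G|`.
  have hdsum : ∀ t, ∑ j ∈ G, ‖d j t‖ ≤ 2 * N * (Cφ / L) * M₁ + ε₁ := by
    intro t
    have h1 : ∀ j, ‖d j t‖ ≤ (∫ p, |φ j p - φ j t| * ‖k (p - t)‖) + φ j t * ε₁ := by
      intro j
      have e : d j t = (∫ p, ((φ j p - φ j t : ℝ) : ℂ) * k (p - t)) +
          φ j t * ((∫ u, k u) - 1) := by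
        have e1 : ∫ u, k u = ∫ p, k (p - t) := (integral_sub_right_eq_self k t).symm
        rw [e1, mul_sub, ← integral_const_mul, ← add_sub_assoc]
        have e2 : Integrable fun p => ((φ j p - φ j t : ℝ) : ℂ) * k (p - t) := by
          have := (hφk j t).sub ((hki' t).const_mul (φ j t : ℂ))
          refine this.congr (Filter.Eventually.of_forall fun p => ?_)
          simp only [Pi.sub_apply]; push_cast; ring
        rw [← integral_add e2 ((hki' t).const_mul _), hd]
        simp only [mul_one]
        congr 2
        funext p; push_cast; ring
      rw [e]
      refine (norm_add_le _ _).trans (add_le_add ?_ ?_)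
      · refine (norm_integral_le_integral_norm _).trans (le_of_eq ?_)
        congr 1; funext p
        rw [norm_mul, Complex.norm_real, norm_eq_abs]
      · rw [norm_mul, hφn]
        exact mul_le_mul_of_nonneg_left hε₁ (hφ.nonneg j t)
    have hint : ∀ j, Integrable fun p => |φ j p - φ j t| * ‖k (p - t)‖ := fun j => by
      refine ((hki' t).norm.const_mul 1).mono' ?_ (Filter.Eventually.of_forall fun p => ?_)
      · exact (((hφ.continuous j).sub continuous_const).abs.mul
          (hk.comp (by fun_prop)).norm).aestronglyMeasurable
      · rw [norm_mul, norm_norm, norm_eq_abs, abs_abs]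
        refine mul_le_mul_of_nonneg_right ?_ (norm_nonneg _)
        have h2 := hφ.mem_Icc j p
        have h3 := hφ.mem_Icc j t
        rw [abs_le]; constructor <;> linarith [h2.1, h2.2, h3.1, h3.2]
    have hk1' : Integrable fun p => |p - t| * ‖k (p - t)‖ := hk1.comp_sub_right t
    calc ∑ j ∈ G, ‖d j t‖
        ≤ ∑ j ∈ G, ((∫ p, |φ j p - φ j t| * ‖k (p - t)‖) + φ j t * ε₁) :=
          Finset.sum_le_sum fun j _ => h1 j
      _ = (∫ p, (∑ j ∈ G, |φ j p - φ j t|) * ‖k (p - t)‖) + (∑ j ∈ G, φ j t) * ε₁ := by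
          rw [Finset.sum_add_distrib, ← Finset.sum_mul, ← integral_finsetSum _ fun j _ => hint j]
          simp_rw [Finset.sum_mul]
      _ ≤ (∫ p, 2 * N * (Cφ / L) * (|p - t| * ‖k (p - t)‖)) + 1 * ε₁ := by
          refine add_le_add (integral_mono ?_ (hk1'.const_mul _) fun p => ?_)
            (mul_le_mul_of_nonneg_right (hφ.sum_le_one G t) hε0)
          · simp_rw [Finset.sum_mul]
            exact integrable_finsetSum _ fun j _ => hint j
          · have := mul_le_mul_of_nonneg_right (hφ.sum_abs_sub_le G p t) (norm_nonneg (k (p - t)))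
            simp only
            linarith
      _ ≤ _ := by
          rw [integral_const_mul, one_mul,
            integral_sub_right_eq_self (fun u => |u| * ‖k u‖) t]
          have := hφ.const_nonneg
          gcongr
  have hconv : ∀ j, Continuous fun t => ∫ p, (φ j p : ℂ) * k (p - t) := fun j => by
    refine continuous_of_dominated (bound := fun p => φ j p * Kb) (fun t => (hφk j t).aestronglyMeasurable)
      (fun t => Filter.Eventually.of_forall fun p => ?_) ((hφ.integrable j).mul_const Kb)
      (Filter.Eventually.of_forall fun p => ?_)
    · rw [norm_mul, hφn]; exact mul_le_mul_of_nonneg_left (hKb _) (hφ.nonneg j p)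
    · exact continuous_const.mul (hk.comp (by fun_prop))
  have hdc : ∀ j, Continuous (d j) := fun j => (hconv j).sub (hφc j)
  have hgi : ∀ j ∈ G, Integrable (g j) ν := fun j hj =>
    hw.mono' (hg j hj).aestronglyMeasurable (Filter.Eventually.of_forall (hgw j hj))
  have hdb : ∀ j ∈ G, ∀ t, ‖d j t‖ ≤ 2 * N * (Cφ / L) * M₁ + ε₁ := fun j hj t =>
    (Finset.single_le_sum (fun i _ => norm_nonneg (d i t)) hj).trans (hdsum t)
  have hgd : ∀ j ∈ G, Integrable (fun t => g j t * d j t) ν := fun j hj =>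
    (hw.mul_const (2 * N * (Cφ / L) * M₁ + ε₁)).mono'
      ((hg j hj).aestronglyMeasurable.mul (hdc j).aestronglyMeasurable)
      (Filter.Eventually.of_forall fun t => by
        rw [norm_mul]
        exact mul_le_mul (hgw j hj t) (hdb j hj t) (norm_nonneg _) (hw0 t))
  have hfub : ∀ j ∈ G, (∫ p, (φ j p : ℂ) * ∫ t, g j t * k (p - t) ∂ν) -
      (∫ t, (φ j t : ℂ) * g j t ∂ν) = ∫ t, g j t * d j t ∂ν := by
    intro j hj
    have hprod : Integrable (Function.uncurry fun p t => (φ j p : ℂ) * (g j t * k (p - t)))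
        (volume.prod ν) := by
      refine ((hφ.integrable j).mul_prod (hw.mul_const Kb)).mono' ?_
        (Filter.Eventually.of_forall fun z => ?_)
      · refine Measurable.aestronglyMeasurable ?_
        exact ((hφc j).measurable.comp measurable_fst).mul
          (((hg j hj).comp measurable_snd).mul (hk.measurable.comp (by fun_prop)))
      · simp only [Function.uncurry, norm_mul, hφn]
        have := hφ.nonneg j z.1
        have h2 := hw0 z.2
        gcongr
        · exact hgw j hj _
        · exact hKb _
    have h1 : (∫ p, (φ j p : ℂ) * ∫ t, g j t * k (p - t) ∂ν) =
        ∫ t, g j t * (∫ p, (φ j p : ℂ) * k (p - t)) ∂ν := by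
      calc _ = ∫ p, ∫ t, (φ j p : ℂ) * (g j t * k (p - t)) ∂ν := by
            simp_rw [integral_const_mul]
        _ = ∫ t, (∫ p, (φ j p : ℂ) * (g j t * k (p - t))) ∂ν := integral_integral_swap hprod
        _ = _ := by
            congr 1; funext t
            rw [← integral_const_mul]
            congr 1; funext p; ring
    have hφg : Integrable (fun t => (φ j t : ℂ) * g j t) ν :=
      hw.mono' ((hφc j).aestronglyMeasurable.mul (hg j hj).aestronglyMeasurable)
        (Filter.Eventually.of_forall fun t => by
          rw [norm_mul, hφn]
          calc φ j t * ‖g j t‖ ≤ 1 * ‖g j t‖ := by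
                gcongr; exact (hφ.mem_Icc j t).2
            _ ≤ w t := by rw [one_mul]; exact hgw j hj t)
    have hgc : Integrable (fun t => g j t * (∫ p, (φ j p : ℂ) * k (p - t))) ν := by
      refine ((hgd j hj).add hφg).congr (Filter.Eventually.of_forall fun t => ?_)
      simp only [hd, Pi.add_apply]; ring
    rw [h1, ← integral_sub hgc hφg]
    congr 1; funext t
    simp only [hd]; ring
  calc _ = ∑ j ∈ G, ‖∫ t, g j t * d j t ∂ν‖ :=
        Finset.sum_congr rfl fun j hj => by rw [hfub j hj]
    _ ≤ ∑ j ∈ G, ∫ t, ‖g j t * d j t‖ ∂ν :=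
        Finset.sum_le_sum fun j _ => norm_integral_le_integral_norm _
    _ = ∫ t, ∑ j ∈ G, ‖g j t * d j t‖ ∂ν :=
        (integral_finsetSum _ fun j hj => (hgd j hj).norm).symm
    _ ≤ ∫ t, (2 * N * (Cφ / L) * M₁ + ε₁) * w t ∂ν := by
        refine integral_mono (integrable_finsetSum _ fun j hj => (hgd j hj).norm)
          (hw.const_mul _) fun t => ?_
        simp only [norm_mul]
        calc ∑ j ∈ G, ‖g j t‖ * ‖d j t‖ ≤ ∑ j ∈ G, w t * ‖d j t‖ :=
              Finset.sum_le_sum fun j hj => mul_le_mul_of_nonneg_right (hgw j hj t) (norm_nonneg _)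
          _ = w t * ∑ j ∈ G, ‖d j t‖ := (Finset.mul_sum _ _ _).symm
          _ ≤ w t * (2 * N * (Cφ / L) * M₁ + ε₁) := mul_le_mul_of_nonneg_left (hdsum t) (hw0 t)
          _ = _ := mul_comm _ _
    _ = _ := integral_const_mul _ _

/-! ### Functions with small logarithmic derivative -/

/-- By Grönwall `f` stays within a relative distance `O(κL)` of its left endpoint value, so the
phase that makes `f a` positive serves on the whole interval. -/
theorem exists_unit_mul_re_ge {f f' : ℝ → ℂ} {a L κ : ℝ} (hL : 0 ≤ L) (hκ : 0 ≤ κ)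
    (hf : ∀ t ∈ Set.Icc a (a + L), HasDerivAt f (f' t) t)
    (hf' : ∀ t ∈ Set.Icc a (a + L), ‖f' t‖ ≤ κ * ‖f t‖) (hδ : κ * L ≤ 1 / 6) :
    ∃ τ : ℂ, ‖τ‖ = 1 ∧ ∀ t ∈ Set.Icc a (a + L), (1 - 6 * (κ * L)) * ‖f t‖ ≤ (τ * f t).re := by
  have hmem : a ∈ Set.Icc a (a + L) := ⟨le_rfl, by linarith⟩
  have hgr : ∀ t ∈ Set.Icc a (a + L), ‖f t‖ ≤ 2 * ‖f a‖ := by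
    intro t ht
    have h1 := norm_le_gronwallBound_of_norm_deriv_right_le (f := f) (f' := f') (δ := ‖f a‖)
      (K := κ) (ε := 0) (a := a) (b := a + L)
      (fun u hu => (hf u hu).continuousAt.continuousWithinAt)
      (fun u hu => (hf u ⟨hu.1, hu.2.le⟩).hasDerivWithinAt) le_rfl
      (fun u hu => by rw [add_zero]; exact hf' u ⟨hu.1, hu.2.le⟩) t ht
    rw [gronwallBound_ε0] at h1
    have h2 : exp (κ * (t - a)) ≤ 2 := by
      have h3 : κ * (t - a) ≤ 1 / 6 := le_trans (by gcongr; linarith [ht.2]) hδ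
      calc exp (κ * (t - a)) ≤ exp (1 / 6) := exp_le_exp.mpr h3
        _ ≤ 2 := by
          rw [← le_log_iff_exp_le (by norm_num)]
          linarith [log_two_gt_d9]
    calc ‖f t‖ ≤ ‖f a‖ * exp (κ * (t - a)) := h1
      _ ≤ ‖f a‖ * 2 := by gcongr
      _ = _ := mul_comm _ _
  have hdiff : ∀ t ∈ Set.Icc a (a + L), ‖f t - f a‖ ≤ 2 * (κ * L) * ‖f a‖ := by
    intro t ht
    have h1 := norm_image_sub_le_of_norm_deriv_le_segment' (f := f) (f' := f') (a := a)
      (b := a + L) (C := κ * (2 * ‖f a‖)) (fun u hu => (hf u hu).hasDerivWithinAt)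
      (fun u hu => (hf' u ⟨hu.1, hu.2.le⟩).trans (by
        gcongr; exact hgr u ⟨hu.1, hu.2.le⟩)) t ht
    refine h1.trans ?_
    calc κ * (2 * ‖f a‖) * (t - a) ≤ κ * (2 * ‖f a‖) * L := by
          gcongr; linarith [ht.2]
      _ = _ := by ring
  set δ := κ * L with hδd
  have hδ0 : 0 ≤ δ := mul_nonneg hκ hL
  by_cases h0 : f a = 0
  · refine ⟨1, norm_one, fun t ht => ?_⟩
    have h1 := hgr t ht
    rw [h0, norm_zero, mul_zero] at h1
    have h2 : f t = 0 := norm_le_zero_iff.mp h1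
    rw [h2]; simp
  · have hfa : 0 < ‖f a‖ := norm_pos_iff.mpr h0
    refine ⟨(starRingEnd ℂ) (f a) / ‖f a‖, ?_, fun t ht => ?_⟩
    · rw [norm_div, Complex.norm_conj, Complex.norm_real, norm_norm, div_self hfa.ne']
    · have h1 := hdiff t ht
      set τ := (starRingEnd ℂ) (f a) / (‖f a‖ : ℂ) with hτ
      have hτn : ‖τ‖ = 1 := by
        rw [hτ, norm_div, Complex.norm_conj, Complex.norm_real, norm_norm, div_self hfa.ne']
      have e : τ * f t = (‖f a‖ : ℂ) + τ * (f t - f a) := by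
        have : τ * f a = (‖f a‖ : ℂ) := by
          rw [hτ, div_mul_eq_mul_div, mul_comm, Complex.mul_conj, Complex.normSq_eq_norm_sq]
          have : (‖f a‖ : ℂ) ≠ 0 := by exact_mod_cast hfa.ne'
          push_cast; field_simp
        rw [mul_sub, this]; ring
      have h2 : -(2 * δ * ‖f a‖) ≤ (τ * (f t - f a)).re := by
        have := (abs_le.mp (Complex.abs_re_le_norm (τ * (f t - f a)))).1
        rw [norm_mul, hτn, one_mul] at this
        linarith
      have h3 : ‖f t‖ ≤ (1 + 2 * δ) * ‖f a‖ := by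
        have := norm_le_norm_add_norm_sub' (f t) (f a)
        linarith
      rw [e, Complex.add_re, Complex.ofReal_re]
      -- Then `(1 - 6δ)(1 + 2δ) ≤ 1 - 2δ`, which is what the real part retains.
      have h4 : (1 - 6 * δ) * ‖f t‖ ≤ (1 - 6 * δ) * ((1 + 2 * δ) * ‖f a‖) :=
        mul_le_mul_of_nonneg_left h3 (by linarith)
      nlinarith [mul_nonneg hδ0 hfa.le, mul_nonneg (mul_nonneg hδ0 hδ0) hfa.le]

/-! ### An analytic square wave -/

/-- The function `(4 / π) arctan q`; the real part of `squareWave (r e^{iθ})` is a smoothed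
square wave. -/
noncomputable def squareWave (q : ℂ) : ℂ :=
  (2 / π : ℝ) * (-Complex.I * Complex.log ((1 + q * Complex.I) / (1 - q * Complex.I)))

theorem one_sub_mul_I_ne_zero {q : ℂ} (hq : ‖q‖ < 1) : 1 - q * Complex.I ≠ 0 := by
  intro h
  have : ‖q * Complex.I‖ = 1 := by rw [← sub_eq_zero.mp h, norm_one]
  rw [norm_mul, Complex.norm_I, mul_one] at this
  linarith

theorem cayley_re_pos {q : ℂ} (hq : ‖q‖ < 1) : 0 < ((1 + q * Complex.I) / (1 - q * Complex.I)).re := by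
  have h0 := one_sub_mul_I_ne_zero hq
  have hN := Complex.normSq_pos.mpr h0
  have hq2 : q.re ^ 2 + q.im ^ 2 < 1 := by
    have : ‖q‖ ^ 2 < 1 := by nlinarith [norm_nonneg q]
    rw [← Complex.normSq_eq_norm_sq, Complex.normSq_apply] at this
    linarith
  rw [Complex.div_re, ← add_div]
  refine div_pos ?_ hN
  simp
  nlinarith

/-- The Cayley transform sends the disc to the right half plane, so the argument stays in `(-π/2,
π/2)`. -/
theorem abs_re_squareWave_le {q : ℂ} (hq : ‖q‖ < 1) : |(squareWave q).re| ≤ 1 := by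
  have h1 := Complex.abs_arg_lt_pi_div_two_iff.mpr (Or.inl (cayley_re_pos hq))
  set w := (1 + q * Complex.I) / (1 - q * Complex.I)
  have e : (squareWave q).re = 2 / π * Complex.arg w := by
    rw [squareWave, Complex.re_ofReal_mul]; simp [w, Complex.log_im]
  rw [e, abs_mul, abs_of_pos (by positivity)]
  calc 2 / π * |Complex.arg w| ≤ 2 / π * (π / 2) := by gcongr
    _ = 1 := by field_simp

theorem hasDerivAt_squareWave {q : ℂ} (hq : ‖q‖ < 1) :
    HasDerivAt squareWave ((4 / π : ℝ) * (1 + q ^ 2)⁻¹) q := by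
  have h0 := one_sub_mul_I_ne_zero hq
  have h0' : 1 + q * Complex.I ≠ 0 := by
    have := one_sub_mul_I_ne_zero (q := -q) (by rwa [norm_neg])
    simpa using this
  have h1 : HasDerivAt (fun q : ℂ => 1 + q * Complex.I) Complex.I q := by
    simpa using ((hasDerivAt_id q).mul_const Complex.I).const_add 1
  have h2 : HasDerivAt (fun q : ℂ => 1 - q * Complex.I) (-Complex.I) q := by
    simpa using ((hasDerivAt_id q).mul_const Complex.I).const_sub 1
  have h3 := ((h1.div h2 h0).clog (Complex.mem_slitPlane_iff.mpr (Or.inl (cayley_re_pos hq))))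
  have h4 := (h3.const_mul (-Complex.I)).const_mul ((2 / π : ℝ) : ℂ)
  refine h4.congr_deriv ?_
  have h5 : 1 + q ^ 2 = (1 + q * Complex.I) * (1 - q * Complex.I) := by
    linear_combination (q ^ 2) * Complex.I_sq
  rw [h5]
  push_cast
  have hpi : (π : ℂ) ≠ 0 := by exact_mod_cast pi_ne_zero
  simp only [Pi.div_apply]
  have e : Complex.I * (1 - q * Complex.I) - (1 + q * Complex.I) * -Complex.I = 2 * Complex.I := by
    ring
  have hden : (2 * Complex.I / (1 - q * Complex.I) ^ 2 /
      ((1 + q * Complex.I) / (1 - q * Complex.I))) =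
      2 * Complex.I * ((1 + q * Complex.I) * (1 - q * Complex.I))⁻¹ := by
    generalize 1 - q * Complex.I = u at h0
    generalize 1 + q * Complex.I = v at h0'
    field_simp
  rw [e, hden]
  linear_combination (-(4 / π : ℂ) * ((1 + q * Complex.I) * (1 - q * Complex.I))⁻¹) * Complex.I_sq

theorem squareWave_zero : squareWave 0 = 0 := by simp [squareWave]

/-- The derivative of the difference is `-(4/π) u²/(1 + u²)`, and `|1 + u²| ≥ 1 - ρ` on the disc of
radius `ρ`. Staying at distance `1 - ρ` from the unit circle avoids the singularities `±i` of the
arctangent. -/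
theorem norm_squareWave_sub_le {q : ℂ} {ρ : ℝ} (hρ : ρ < 1) (hq : ‖q‖ ≤ ρ) :
    ‖squareWave q - (4 / π : ℝ) * q‖ ≤ 2 / (1 - ρ) * ‖q‖ ^ 2 := by
  have hρ0 : 0 ≤ ρ := (norm_nonneg q).trans hq
  have hd : ∀ u ∈ Metric.closedBall (0 : ℂ) ‖q‖, HasDerivWithinAt
      (fun q => squareWave q - (4 / π : ℝ) * q)
      ((4 / π : ℝ) * (1 + u ^ 2)⁻¹ - (4 / π : ℝ)) (Metric.closedBall (0 : ℂ) ‖q‖) u := by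
    intro u hu
    rw [mem_closedBall_zero_iff] at hu
    have h2 := (hasDerivAt_id u).const_mul ((4 / π : ℝ) : ℂ)
    simp only [mul_one] at h2
    exact ((hasDerivAt_squareWave (by linarith)).sub h2).hasDerivWithinAt
  have hb : ∀ u ∈ Metric.closedBall (0 : ℂ) ‖q‖,
      ‖((4 / π : ℝ) : ℂ) * (1 + u ^ 2)⁻¹ - (4 / π : ℝ)‖ ≤ 2 / (1 - ρ) * ‖q‖ := by
    intro u hu
    rw [mem_closedBall_zero_iff] at hu
    have h1 : 1 - ρ ≤ ‖1 + u ^ 2‖ := by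
      have h2 := norm_sub_norm_le (1 : ℂ) (-(u ^ 2))
      rw [norm_one, norm_neg, norm_pow, sub_neg_eq_add] at h2
      nlinarith [norm_nonneg u]
    have hpos : 0 < ‖1 + u ^ 2‖ := lt_of_lt_of_le (by linarith) h1
    have h0 : 1 + u ^ 2 ≠ 0 := norm_pos_iff.mp hpos
    have e : ((4 / π : ℝ) : ℂ) * (1 + u ^ 2)⁻¹ - (4 / π : ℝ) =
        -((4 / π : ℝ) : ℂ) * u ^ 2 * (1 + u ^ 2)⁻¹ := by field_simp; ring
    have h4π : 4 / π ≤ 2 := by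
      rw [div_le_iff₀ pi_pos]; linarith [pi_gt_three]
    rw [e, norm_mul, norm_mul, norm_neg, norm_inv, norm_pow, Complex.norm_real, norm_eq_abs,
      abs_of_pos (by positivity)]
    calc 4 / π * ‖u‖ ^ 2 * ‖1 + u ^ 2‖⁻¹ ≤ 2 * ‖q‖ * (1 - ρ)⁻¹ := by
          gcongr
          · nlinarith [norm_nonneg u]
      _ = _ := by rw [div_eq_mul_inv]; ring
  have h := (convex_closedBall (0 : ℂ) ‖q‖).norm_image_sub_le_of_norm_hasDerivWithin_le hd hb
    (Metric.mem_closedBall_self (norm_nonneg q)) (y := q) (by simp)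
  simp only [squareWave_zero, mul_zero, sub_zero] at h
  refine h.trans (le_of_eq ?_)
  ring

theorem norm_squareWave_le {q : ℂ} {ρ : ℝ} (hρ : ρ < 1) (hq : ‖q‖ ≤ ρ) :
    ‖squareWave q‖ ≤ 4 / (1 - ρ) * ‖q‖ := by
  have hρ0 : 0 ≤ ρ := (norm_nonneg q).trans hq
  have h1 := norm_squareWave_sub_le hρ hq
  have h4π : 4 / π ≤ 2 := by
    rw [div_le_iff₀ pi_pos]; linarith [pi_gt_three]
  have h2 := norm_le_norm_add_norm_sub' (squareWave q) ((4 / π : ℝ) * q)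
  rw [norm_mul, Complex.norm_real, norm_eq_abs, abs_of_pos (by positivity)] at h2
  have h3 : 2 / (1 - ρ) * ‖q‖ ^ 2 ≤ 2 / (1 - ρ) * ‖q‖ := by
    have : 0 ≤ 2 / (1 - ρ) := div_nonneg (by norm_num) (by linarith)
    refine mul_le_mul_of_nonneg_left ?_ this
    nlinarith [norm_nonneg q]
  have h4 : 2 ≤ 2 / (1 - ρ) := by
    rw [le_div_iff₀ (by linarith)]; linarith
  have h5 : 4 / π * ‖q‖ ≤ 2 / (1 - ρ) * ‖q‖ := by
    exact mul_le_mul_of_nonneg_right (h4π.trans h4) (norm_nonneg q)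
  have h6 : 4 / (1 - ρ) * ‖q‖ = 2 / (1 - ρ) * ‖q‖ + 2 / (1 - ρ) * ‖q‖ := by ring
  linarith

/-! ### Localised representations on `J₀` -/

/-- A node configuration together with scales `η < H < r` that are well separated: `E` bounds the
error in comparing `log |P|` with the plane wave at the scale `H`, and `X` measures the size
`exp (-X)` of negligible quantities. -/
structure ScaleConfig {n : ℕ} (x : Fin n → ℝ) (a b y δ CL r ε η H E X : ℝ) : Prop
    extends NodeConfig x a b y δ CL where
  ε_pos : 0 < ε
  ε_lt : ε < 1 / 4
  r_pos : 0 < r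
  r_le : r ≤ δ / 4
  H_le_r : H ≤ r / 4
  le_H : 60 / n ≤ H
  le_η : 1 / n ≤ η
  η_le : 3 * η ≤ H
  H_le : H ≤ 1
  X_nonneg : 0 ≤ X
  freq_nonneg : 0 ≤ freq x a b y
  -- The square is the price of absorbing a drift linear in `|t - p|` into the Gaussian exponent `(t
  -- - p)²/H²`.
  le_E : NodeConfig.waveConst δ CL * (n * H * r + n * H ^ 3 + log n) + (NodeConfig.waveConst δ CL * n * H ^ 2) ^ 2 / 4 ≤ E
  -- `top` and `bottom` make the horizontal sides of the contour negligible, through the decay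
  -- `e^{-H/η}` of the kernel and the decay of `e^{-iωz}/P` below the axis respectively; `bottom`
  -- also excludes gaps of radius `H` between nodes.
  top : E + 2 + X ≤ H / η
  bottom : 18 * E + 5 + X + H / η ≤ freq x a b y * H
  -- This makes the residues at heights `-η` and `-2η` negligible.
  interior : E + X ≤ 2 * (freq x a b y * η)
  -- Far from `J₀` the Gaussian beats even the trivial bounds `e^{O(n)}`.
  outer : freq x a b y * H + H / η + 5 + X + (3 + (8 * π + 2 * CL) / (2 * δ)) * n ≤
    δ ^ 2 / (16 * H ^ 2)
  -- Points of `J₄` are at distance at least `4εr` from the complement of `J₀`, where the Gaussian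
  -- is already below `e^{-X}`.
  gauss : X ≤ 16 * ε ^ 2 * r ^ 2 / H ^ 2

theorem norm_P_ofReal_add_mul_I_neg {n : ℕ} (x : Fin n → ℝ) (t v : ℝ) :
    ‖P x (t + (-v : ℝ) * Complex.I)‖ = ‖P x (t + v * Complex.I)‖ := by
  rw [norm_P, norm_P]
  refine Finset.prod_congr rfl fun i _ => ?_
  rw [← Complex.norm_conj]
  congr 1
  simp

theorem norm_weight_mul_inv_cubic_le {η H m : ℝ} (hm : 0 < m) {ζ : ℂ} (h0 : m ≤ ‖ζ‖)
    (h2 : m ≤ ‖ζ + 2 * η * Complex.I‖) (h3 : m ≤ ‖ζ + 3 * η * Complex.I‖) :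
    ‖weight η H ζ * (cubic η ζ)⁻¹‖ ≤
      6 * η ^ 2 / m ^ 3 * exp (-ζ.im / η + (ζ.im ^ 2 - ζ.re ^ 2) / H ^ 2) := by
  have hc : m ^ 3 ≤ ‖cubic η ζ‖ := by
    rw [cubic, norm_mul, norm_mul]
    calc m ^ 3 = m * m * m := by ring
      _ ≤ _ := by gcongr
  rw [norm_mul, norm_weight, norm_inv, div_mul_eq_mul_div, ← div_eq_mul_inv]
  gcongr

theorem norm_weight_mul_inv_cubic_le_of_im {η H p t v : ℝ} (hη : 0 < η) (h0 : η ≤ |v - η|)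
    (h2 : η ≤ |v + η|) (h3 : η ≤ |v + 2 * η|) :
    ‖weight η H (t + v * Complex.I - (p + η * Complex.I)) *
      (cubic η (t + v * Complex.I - (p + η * Complex.I)))⁻¹‖ ≤
      6 / η * exp (-(v - η) / η + ((v - η) ^ 2 - (t - p) ^ 2) / H ^ 2) := by
  have him : ((t : ℂ) + v * Complex.I - (p + η * Complex.I)).im = v - η := by simp
  have hre : ((t : ℂ) + v * Complex.I - (p + η * Complex.I)).re = t - p := by simp
  have h := norm_weight_mul_inv_cubic_le (η := η) (H := H)
    (ζ := t + v * Complex.I - (p + η * Complex.I)) hη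
    (h0.trans (by rw [← him]; exact Complex.abs_im_le_norm _))
    (h2.trans (by
      refine le_trans (le_of_eq ?_) (Complex.abs_im_le_norm _)
      simp; ring_nf))
    (h3.trans (by
      refine le_trans (le_of_eq ?_) (Complex.abs_im_le_norm _)
      simp; ring_nf))
  rw [him, hre] at h
  refine h.trans (le_of_eq ?_)
  congr 1
  field_simp

theorem norm_weight_mul_inv_cubic_le_of_re {η H p t v : ℝ} (hη : 0 < η) (hη1 : η ≤ 1)
    (hp : |p| ≤ 1) (ht : |t| = 3) :
    ‖weight η H (t + v * Complex.I - (p + η * Complex.I)) *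
      (cubic η (t + v * Complex.I - (p + η * Complex.I)))⁻¹‖ ≤
      6 / η * exp (-(v - η) / η + ((v - η) ^ 2 - (t - p) ^ 2) / H ^ 2) := by
  have him : ((t : ℂ) + v * Complex.I - (p + η * Complex.I)).im = v - η := by simp
  have hre : ((t : ℂ) + v * Complex.I - (p + η * Complex.I)).re = t - p := by simp
  have htp : 1 ≤ |t - p| := by
    have := abs_sub_abs_le_abs_sub t p
    linarith
  have h := norm_weight_mul_inv_cubic_le (η := η) (H := H) one_pos
    (ζ := t + v * Complex.I - (p + η * Complex.I))
    (htp.trans (by rw [← hre]; exact Complex.abs_re_le_norm _))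
    (htp.trans (by
      refine le_trans (le_of_eq ?_) (Complex.abs_re_le_norm _)
      simp))
    (htp.trans (by
      refine le_trans (le_of_eq ?_) (Complex.abs_re_le_norm _)
      simp))
  rw [him, hre] at h
  refine h.trans ?_
  gcongr
  · nlinarith
  · simpa using hη1

theorem norm_P_le_exp {n : ℕ} {x : Fin n → ℝ} (hx : ∀ i, x i ∈ Set.Icc (-1 : ℝ) 1) {t v : ℝ}
    (ht : |t| ≤ 3) (hv : |v| ≤ 1) : ‖P x (t + v * Complex.I)‖ ≤ exp (2 * n) := by
  rw [norm_P, mul_comm (2 : ℝ), exp_nat_mul]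
  have h1 : (5 : ℝ) ≤ exp 2 := by
    have := quadratic_le_exp_of_nonneg (x := 2) (by norm_num); linarith
  calc ∏ i, ‖(t : ℂ) + v * Complex.I - x i‖ ≤ ∏ _i : Fin n, exp 2 := by
        refine Finset.prod_le_prod (fun _ _ => norm_nonneg _) fun i _ => ?_
        have h2 := norm_sub_le ((t : ℂ) + v * Complex.I) (x i)
        have h3 := norm_add_le (t : ℂ) (v * Complex.I)
        rw [norm_mul, Complex.norm_I, mul_one, Complex.norm_real, Complex.norm_real,
          norm_eq_abs, norm_eq_abs] at h3
        rw [Complex.norm_real, norm_eq_abs] at h2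
        have h4 : |x i| ≤ 1 := abs_le.mpr (hx i)
        linarith
    _ = _ := by simp

namespace ScaleConfig

variable {n : ℕ} {x : Fin n → ℝ} {a b y δ CL r ε η H E X : ℝ}

theorem waveConst_nonneg (h : ScaleConfig x a b y δ CL r ε η H E X) : 0 ≤ NodeConfig.waveConst δ CL := by
  have := h.δ_pos; have := h.CL_nonneg; have := h.potConst_pos
  rw [NodeConfig.waveConst]; positivity

theorem n_pos (h : ScaleConfig x a b y δ CL r ε η H E X) : (0 : ℝ) < n := by
  exact_mod_cast h.pos

theorem η_pos (h : ScaleConfig x a b y δ CL r ε η H E X) : 0 < η :=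
  lt_of_lt_of_le (by have := h.n_pos; positivity) h.le_η

theorem H_pos (h : ScaleConfig x a b y δ CL r ε η H E X) : 0 < H := by
  linarith [h.η_pos, h.η_le]

theorem E_nonneg (h : ScaleConfig x a b y δ CL r ε η H E X) : 0 ≤ E := by
  refine le_trans ?_ h.le_E
  have := h.waveConst_nonneg; have := h.H_pos; have := h.r_pos; have := h.one_le_log
  positivity

theorem nodeMass_pos' (h : ScaleConfig x a b y δ CL r ε η H E X) : 0 < nodeMass x :=
  nodeMass_pos h.pos h.inj

theorem nodeMass_le_exp (h : ScaleConfig x a b y δ CL r ε η H E X) :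
    nodeMass x ≤ exp ((1 + (8 * π + 2 * CL) / (2 * δ)) * n) := by
  rw [← exp_log h.nodeMass_pos', ← nat_mul_alpha h.pos, mul_comm]
  refine exp_le_exp.mpr (mul_le_mul_of_nonneg_right ?_ h.n_pos.le)
  exact (le_abs_self _).trans h.abs_alpha_le

theorem abs_le_one (h : ScaleConfig x a b y δ CL r ε η H E X) {p : ℝ} (hp : |p - y| ≤ r) :
    |p| ≤ 1 := by
  have h1 := abs_le.mp hp
  have := h.left; have := h.right; have := h.ha; have := h.hb; have := h.r_le; have := h.δ_pos
  rw [abs_le]; constructor <;> linarith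

/-- The error of the plane wave estimate grows linearly with the distance from `y`. By the
arithmetic–geometric mean inequality the drift is at most a constant plus `(t - p)²/H²`, which the
Gaussian in the kernel compensates. -/
theorem abs_sub_le_of_near (h : ScaleConfig x a b y δ CL r ε η H E X) {p t : ℝ}
    (hp : |p - y| ≤ r) (ht : |t - y| ≤ δ / 2) :
    |logSize x (t + H * Complex.I) - freq x a b y * H| - (t - p) ^ 2 / H ^ 2 ≤ E := by
  have hH := h.H_pos
  have hW := h.waveConst_nonneg
  have hn := h.n_pos
  have h1 := h.abs_logSize_sub_le ht (y := H) (h.le_η.trans (by linarith [h.η_le, h.η_pos]))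
  have h2 : |t - y| ≤ |t - p| + r := by
    have := abs_sub_le t p y; linarith
  have h3 : NodeConfig.waveConst δ CL * (n * H * |t - y| + n * H ^ 3 + log n) ≤
      NodeConfig.waveConst δ CL * (n * H * (|t - p| + r) + n * H ^ 3 + log n) := by gcongr
  have h4 : NodeConfig.waveConst δ CL * n * H * |t - p| ≤
      (NodeConfig.waveConst δ CL * n * H ^ 2) ^ 2 / 4 + (t - p) ^ 2 / H ^ 2 := by
    have e : NodeConfig.waveConst δ CL * n * H * |t - p| =
        (NodeConfig.waveConst δ CL * n * H ^ 2) * (|t - p| / H) := by field_simp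
    have e2 : (t - p) ^ 2 / H ^ 2 = (|t - p| / H) ^ 2 := by rw [div_pow, sq_abs]
    rw [e, e2]
    nlinarith [sq_nonneg (NodeConfig.waveConst δ CL * n * H ^ 2 / 2 - |t - p| / H)]
  have := h.le_E
  nlinarith

theorem outer_le (h : ScaleConfig x a b y δ CL r ε η H E X) {p t : ℝ}
    (hp : |p - y| ≤ r) (ht : δ / 2 < |t - y|) : δ ^ 2 / (16 * H ^ 2) ≤ (t - p) ^ 2 / H ^ 2 := by
  have hH := h.H_pos
  have hδ := h.δ_pos
  have h1 : δ / 4 ≤ |t - p| := by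
    have := abs_sub_le t p y; linarith [h.r_le]
  have h2 : (δ / 4) ^ 2 ≤ (t - p) ^ 2 := by rw [← sq_abs (t - p)]; gcongr
  calc δ ^ 2 / (16 * H ^ 2) = (δ / 4) ^ 2 / H ^ 2 := by field_simp; norm_num
    _ ≤ _ := by gcongr

theorem outer_le_side (h : ScaleConfig x a b y δ CL r ε η H E X) {p t : ℝ}
    (hp : |p - y| ≤ r) (ht : |t| = 3) : δ ^ 2 / (16 * H ^ 2) ≤ (t - p) ^ 2 / H ^ 2 := by
  refine h.outer_le hp ?_
  have h1 := abs_sub_abs_le_abs_sub t y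
  have h2 : |y| ≤ 1 := h.abs_le_one (p := y) (by simp [h.r_pos.le])
  linarith [h.δ_le_one]

theorem η_le_one (h : ScaleConfig x a b y δ CL r ε η H E X) : η ≤ 1 := by
  linarith [h.η_le, h.H_le, h.η_pos]

theorem one_le_H_div (h : ScaleConfig x a b y δ CL r ε η H E X) : 3 ≤ H / η := by
  rw [le_div_iff₀ h.η_pos]; exact h.η_le

theorem gauss_le (h : ScaleConfig x a b y δ CL r ε η H E X) {p t : ℝ}
    (hp : |p - y| ≤ (1 - 4 * ε) * r) (ht : t ∉ ball y r) : X ≤ (p - t) ^ 2 / H ^ 2 := by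
  have hH := h.H_pos
  have hr := h.r_pos
  have hε := h.ε_pos
  have ht' : r < |t - y| := by
    by_contra hc
    push Not at hc
    rw [abs_le] at hc
    exact ht ⟨by linarith, by linarith⟩
  have h1 : 4 * ε * r ≤ |p - t| := by
    have := abs_sub_le t p y
    rw [abs_sub_comm t p] at this
    linarith
  refine h.gauss.trans ?_
  gcongr
  rw [← sq_abs (p - t)]
  calc 16 * ε ^ 2 * r ^ 2 = (4 * ε * r) ^ 2 := by ring
    _ ≤ _ := by gcongr

theorem norm_cauchyKernel_le' (h : ScaleConfig x a b y δ CL r ε η H E X) (s : ℝ) :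
    ‖cauchyKernel η H s‖ ≤ 8 / η * exp (-(s ^ 2 / H ^ 2)) := by
  have hη := h.η_pos
  refine (norm_cauchyKernel_le hη (by linarith [h.η_le]) s).1.trans ?_
  gcongr
  rw [mul_div_assoc', div_le_div_iff₀ (by positivity) hη]
  nlinarith [sq_nonneg s]

/-- The mass of the localised Cauchy kernel. -/
theorem norm_integral_cauchyKernel_sub_one_le (h : ScaleConfig x a b y δ CL r ε η H E X) :
    ‖(∫ s, cauchyKernel η H s) - 1‖ ≤ 38 / η * exp (-X) := by
  have hη := h.η_pos
  have hη1 := h.η_le_one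
  have hH := h.H_pos
  have hr := h.r_pos
  have hp : |y - y| ≤ r := by simp [hr.le]
  have hy := h.abs_le_one hp
  have hout := h.outer
  have hA : 0 ≤ (3 + (8 * π + 2 * CL) / (2 * δ)) * n := by
    have := h.CL_nonneg; have := h.δ_pos; positivity
  have hωH : 0 ≤ freq x a b y * H := mul_nonneg h.freq_nonneg hH.le
  have hE := h.E_nonneg
  have hHη := h.one_le_H_div
  -- Representing the constant function 1 computes the mass of the kernel on `[-3, 3]`; the tails
  -- beyond are bounded by the Gaussian.
  have hkey := upper_representation (G := fun _ => 1) (η := η) (H := H) (y₀ := η)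
    (τ := 6 / η * exp (-X)) (x := y) hη (by linarith [h.η_le]) h.H_le hη le_rfl hy
    (differentiableOn_const _) ?_ ?_
  · simp only [one_mul] at hkey
    have hki := (integral_norm_cauchyKernel_le hη (H := H) (by linarith [h.η_le]))
    have e1 : ∫ s, cauchyKernel η H s = ∫ t, cauchyKernel η H (y - t) :=
      (integral_sub_left_eq_self _ _ y).symm
    have hki' : Integrable fun t => cauchyKernel η H (y - t) := hki.1.comp_sub_left y
    rw [intervalIntegral.integral_of_le (by norm_num)] at hkey
    have e2 := integral_add_compl (measurableSet_Ioc (a := (-3 : ℝ)) (b := 3)) hki'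
    have h3 : ‖∫ t in (Set.Ioc (-3 : ℝ) 3)ᶜ, cauchyKernel η H (y - t)‖ ≤
        8 * π * exp (-X) := by
      have hpo := poisson_one y hη
      have hb : ∀ t ∈ (Set.Ioc (-3 : ℝ) 3)ᶜ, ‖cauchyKernel η H (y - t)‖ ≤
          8 * exp (-X) * (η / ((t - y) ^ 2 + η ^ 2)) := by
        intro t ht
        have h1 := (norm_cauchyKernel_le hη (H := H) (by linarith [h.η_le]) (y - t)).1
        have h2 : X ≤ (y - t) ^ 2 / H ^ 2 := by
          refine le_trans (by linarith) ((h.outer_le hp (t := t) ?_).trans (le_of_eq ?_))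
          · have h4 : 3 ≤ |t| := by
              by_contra hc
              push Not at hc
              rw [abs_lt] at hc
              exact ht ⟨hc.1, hc.2.le⟩
            have := abs_sub_abs_le_abs_sub t y
            linarith [h.δ_le_one]
          · ring
        refine h1.trans ?_
        have h5 : exp (-((y - t) ^ 2 / H ^ 2)) ≤ exp (-X) := exp_le_exp.mpr (by linarith)
        have h6 : (y - t) ^ 2 = (t - y) ^ 2 := by ring
        rw [h6] at h5 ⊢
        have h7 : 0 ≤ 8 * (η / ((t - y) ^ 2 + η ^ 2)) := by positivity
        calc _ ≤ 8 * (η / ((t - y) ^ 2 + η ^ 2)) * exp (-X) := by gcongr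
          _ = _ := by ring
      calc _ ≤ ∫ t in (Set.Ioc (-3 : ℝ) 3)ᶜ, 8 * exp (-X) * (η / ((t - y) ^ 2 + η ^ 2)) := by
            refine norm_integral_le_of_norm_le (hpo.1.const_mul _).integrableOn ?_
            exact (ae_restrict_iff' measurableSet_Ioc.compl).mpr (Filter.Eventually.of_forall hb)
        _ ≤ ∫ t, 8 * exp (-X) * (η / ((t - y) ^ 2 + η ^ 2)) :=
            setIntegral_le_integral (hpo.1.const_mul _)
              (Filter.Eventually.of_forall fun t => by simp only [Pi.zero_apply]; positivity)
        _ = _ := by rw [integral_const_mul, hpo.2]; ring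
    rw [e1, ← e2]
    set I₁ := ∫ t in Set.Ioc (-3 : ℝ) 3, cauchyKernel η H (y - t)
    set I₂ := ∫ t in (Set.Ioc (-3 : ℝ) 3)ᶜ, cauchyKernel η H (y - t)
    have e3 : I₁ + I₂ - 1 = I₂ - (1 - I₁) := by ring
    rw [e3]
    refine (norm_sub_le _ _).trans ?_
    have h8 : 8 * π ≤ 26 / η := by
      rw [le_div_iff₀ hη]
      have : π ≤ 3.15 := pi_lt_d2.le
      nlinarith [pi_pos]
    calc ‖I₂‖ + ‖1 - I₁‖ ≤ 8 * π * exp (-X) + 2 * (6 / η * exp (-X)) := add_le_add h3 hkey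
      _ ≤ 26 / η * exp (-X) + 2 * (6 / η * exp (-X)) := by gcongr
      _ = _ := by ring
  · intro t ht
    rw [one_mul]
    refine (norm_weight_mul_inv_cubic_le_of_im hη ?_ ?_ ?_).trans ?_
    · exact le_trans (by linarith [h.η_le]) (le_abs_self _)
    · exact le_trans (by linarith [h.η_le]) (le_abs_self _)
    · exact le_trans (by linarith [h.η_le]) (le_abs_self _)
    · gcongr
      have h1 : ((H - η) ^ 2 - (t - y) ^ 2) / H ^ 2 ≤ 1 := by
        rw [div_le_one (by positivity)]
        nlinarith [sq_nonneg (t - y), h.η_le]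
      have h2 : -(H - η) / η = 1 - H / η := by field_simp; ring
      linarith [h.top]
  · intro t v ht hv0 hvH
    rw [one_mul]
    refine (norm_weight_mul_inv_cubic_le_of_re hη hη1 hy ht).trans ?_
    gcongr
    have h1 : (v - η) ^ 2 / H ^ 2 ≤ 1 := by
      rw [div_le_one (by positivity)]
      nlinarith [h.η_le]
    have h2 : -(v - η) / η ≤ 1 := by
      rw [div_le_one hη]; linarith
    have h3 := h.outer_le_side hp ht
    rw [sub_div]
    linarith

end ScaleConfig

/-! ### Representation of functions analytic in the upper half plane. -/

namespace ScaleConfig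

variable {n : ℕ} {x : Fin n → ℝ} {a b y δ CL r ε η H E X : ℝ}

theorem ball_subset (h : ScaleConfig x a b y δ CL r ε η H E X) : ball y r ⊆ Set.Icc a b := by
  intro t ht
  have := h.left; have := h.right; have := h.r_le; have := h.δ_pos
  exact ⟨by linarith [ht.1], by linarith [ht.2]⟩

theorem ball_subset_three (h : ScaleConfig x a b y δ CL r ε η H E X) :
    ball y r ⊆ Set.Ioc (-3) 3 := by
  intro t ht
  have h1 := h.ball_subset ht
  have := h.ha; have := h.hb
  exact ⟨by linarith [h1.1], by linarith [h1.2]⟩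

/-- Near `y` the growth `e^{ωH}` of `P` cancels against the given decay and `e^{-H/η}` wins. Far
from `y` the Gaussian beats the trivial bound for `P`. -/
theorem norm_top_le (h : ScaleConfig x a b y δ CL r ε η H E X) {p t : ℝ}
    (hp : |p - y| ≤ r) (ht : |t| ≤ 3) :
    ‖P x (t + H * Complex.I)‖ * exp (-(freq x a b y * H)) *
      (6 / η * exp (-(H - η) / η + ((H - η) ^ 2 - (t - p) ^ 2) / H ^ 2)) ≤
      6 / (η * nodeMass x) * exp (-X) := by
  have hη := h.η_pos
  have hH := h.H_pos
  have hS := h.nodeMass_pos'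
  have h1 : (H - η) ^ 2 / H ^ 2 ≤ 1 := by
    rw [div_le_one (by positivity)]
    nlinarith [h.η_le]
  have h2 : -(H - η) / η = 1 - H / η := by field_simp; ring
  have h3 : ‖P x (t + H * Complex.I)‖ * nodeMass x ≤
      exp (freq x a b y * H + H / η - 2 - X + (t - p) ^ 2 / H ^ 2) := by
    by_cases hn : |t - y| ≤ δ / 2
    · refine (norm_P_mul_le_exp_logSize h.pos h.inj _).trans (exp_le_exp.mpr ?_)
      have h4 := h.abs_sub_le_of_near hp hn
      have h5 := le_abs_self (logSize x (t + H * Complex.I) - freq x a b y * H)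
      linarith [h.top]
    · push Not at hn
      have h4 := h.outer_le hp hn
      calc _ ≤ exp (2 * n) * exp ((1 + (8 * π + 2 * CL) / (2 * δ)) * n) := by
            gcongr
            · exact norm_P_le_exp h.mem ht (by rw [abs_of_pos hH]; exact h.H_le)
            · exact h.nodeMass_le_exp
        _ = exp (2 * n + (1 + (8 * π + 2 * CL) / (2 * δ)) * n) := (exp_add _ _).symm
        _ ≤ _ := by
          refine exp_le_exp.mpr ?_
          have := h.outer
          have := mul_nonneg h.freq_nonneg hH.le
          have := h.one_le_H_div
          linarith
  rw [sub_div _ ((t - p) ^ 2), h2, div_mul_eq_div_div]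
  calc _ = 6 / η / nodeMass x * ((‖P x (t + H * Complex.I)‖ * nodeMass x) *
        exp (-(freq x a b y * H) + (1 - H / η + ((H - η) ^ 2 / H ^ 2 - (t - p) ^ 2 / H ^ 2)))) := by
        rw [exp_add (-(freq x a b y * H))]; field_simp
    _ ≤ 6 / η / nodeMass x * (exp (freq x a b y * H + H / η - 2 - X + (t - p) ^ 2 / H ^ 2) *
        exp (-(freq x a b y * H) + (1 - H / η + ((H - η) ^ 2 / H ^ 2 - (t - p) ^ 2 / H ^ 2)))) := by
        gcongr
    _ ≤ _ := by
        rw [← exp_add]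
        gcongr
        linarith

theorem norm_side_le (h : ScaleConfig x a b y δ CL r ε η H E X) {p t v : ℝ}
    (hp : |p - y| ≤ r) (ht : |t| = 3) (hv0 : 0 ≤ v) (hvH : v ≤ H) :
    ‖P x (t + v * Complex.I)‖ * exp (-(freq x a b y * v)) *
      (6 / η * exp (-(v - η) / η + ((v - η) ^ 2 - (t - p) ^ 2) / H ^ 2)) ≤
      6 / (η * nodeMass x) * exp (-X) := by
  have hη := h.η_pos
  have hH := h.H_pos
  have hS := h.nodeMass_pos'
  have h1 : (v - η) ^ 2 / H ^ 2 ≤ 1 := by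
    rw [div_le_one (by positivity)]
    nlinarith [h.η_le]
  have h2 : -(v - η) / η ≤ 1 := by
    rw [div_le_one hη]; linarith
  have h4 := h.outer_le_side hp ht
  have h3 : ‖P x (t + v * Complex.I)‖ * nodeMass x ≤ exp (-2 - X + (t - p) ^ 2 / H ^ 2) := by
    calc _ ≤ exp (2 * n) * exp ((1 + (8 * π + 2 * CL) / (2 * δ)) * n) := by
          gcongr
          · exact norm_P_le_exp h.mem ht.le (by rw [abs_of_nonneg hv0]; exact hvH.trans h.H_le)
          · exact h.nodeMass_le_exp
      _ = exp (2 * n + (1 + (8 * π + 2 * CL) / (2 * δ)) * n) := (exp_add _ _).symm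
      _ ≤ _ := by
        refine exp_le_exp.mpr ?_
        have := h.outer
        have := mul_nonneg h.freq_nonneg hH.le
        have := h.one_le_H_div
        linarith
  rw [sub_div _ ((t - p) ^ 2), div_mul_eq_div_div]
  calc _ = 6 / η / nodeMass x * ((‖P x (t + v * Complex.I)‖ * nodeMass x) *
        exp (-(freq x a b y * v) + (-(v - η) / η + ((v - η) ^ 2 / H ^ 2 - (t - p) ^ 2 / H ^ 2)))) := by
        rw [exp_add (-(freq x a b y * v))]; field_simp
    _ ≤ 6 / η / nodeMass x * (exp (-2 - X + (t - p) ^ 2 / H ^ 2) *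
        exp (-(freq x a b y * v) + (-(v - η) / η + ((v - η) ^ 2 / H ^ 2 - (t - p) ^ 2 / H ^ 2)))) := by
        gcongr
    _ ≤ _ := by
        rw [← exp_add]
        gcongr
        have := mul_nonneg h.freq_nonneg hv0
        linarith

/-- Inside `I₀` the Gaussian saves `e^{-X}` and `|P|` is kept, since its integral is controlled by
the Lebesgue function. Outside `I₀` the Gaussian beats the trivial bound, which accounts for the
summand 1. -/
theorem norm_real_outer_le (h : ScaleConfig x a b y δ CL r ε η H E X) {p t : ℝ}
    (hp : |p - y| ≤ (1 - 4 * ε) * r) (ht3 : |t| ≤ 3) (ht : t ∉ ball y r) :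
    ‖P x t‖ * ‖cauchyKernel η H (p - t)‖ ≤
      8 / (η * nodeMass x) * exp (-X) *
        (Set.indicator (Set.Icc a b) (fun t => ‖P x (t : ℝ)‖ * nodeMass x) t + 1) := by
  have hη := h.η_pos
  have hH := h.H_pos
  have hS := h.nodeMass_pos'
  have hp' : |p - y| ≤ r := hp.trans (by nlinarith [h.ε_pos, h.r_pos])
  have hK := h.norm_cauchyKernel_le' (p - t)
  rw [div_mul_eq_div_div]
  by_cases hab : t ∈ Set.Icc a b
  · rw [Set.indicator_of_mem hab]
    have hg : exp (-((p - t) ^ 2 / H ^ 2)) ≤ exp (-X) :=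
      exp_le_exp.mpr (by linarith [h.gauss_le hp ht])
    calc ‖P x t‖ * ‖cauchyKernel η H (p - t)‖ ≤ ‖P x t‖ * (8 / η * exp (-X)) := by
          gcongr; exact hK.trans (by gcongr)
      _ = 8 / η / nodeMass x * exp (-X) * (‖P x t‖ * nodeMass x) := by field_simp
      _ ≤ _ := by gcongr; linarith
  · rw [Set.indicator_of_notMem hab, zero_add, mul_one]
    have hfar : δ / 2 < |t - y| := by
      have h1 := h.le_dist hab
      have := h.δ_pos
      linarith
    have h4 := h.outer_le hp' hfar
    have h3 : ‖P x t‖ * nodeMass x ≤ exp (-X + (p - t) ^ 2 / H ^ 2) := by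
      have hP := norm_P_le_exp h.mem (t := t) (v := 0) ht3 (by simp)
      simp only [Complex.ofReal_zero, zero_mul, add_zero] at hP
      calc _ ≤ exp (2 * n) * exp ((1 + (8 * π + 2 * CL) / (2 * δ)) * n) := by
            gcongr
            exact h.nodeMass_le_exp
        _ = exp (2 * n + (1 + (8 * π + 2 * CL) / (2 * δ)) * n) := (exp_add _ _).symm
        _ ≤ _ := by
          refine exp_le_exp.mpr ?_
          have := h.outer
          have := mul_nonneg h.freq_nonneg hH.le
          have := h.one_le_H_div
          rw [show (p - t) ^ 2 = (t - p) ^ 2 by ring]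
          linarith
    calc ‖P x t‖ * ‖cauchyKernel η H (p - t)‖
        ≤ ‖P x t‖ * (8 / η * exp (-((p - t) ^ 2 / H ^ 2))) := by gcongr
      _ = 8 / η / nodeMass x * ((‖P x t‖ * nodeMass x) * exp (-((p - t) ^ 2 / H ^ 2))) := by
          field_simp
      _ ≤ 8 / η / nodeMass x *
          (exp (-X + (p - t) ^ 2 / H ^ 2) * exp (-((p - t) ^ 2 / H ^ 2))) := by gcongr
      _ = _ := by rw [← exp_add]; ring_nf

/-- A function analytic in the upper half plane and dominated there by `|P| e^{-ω Im z}` is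
represented, at height `η` above `J₄`, by its values on `J₀`. -/
theorem norm_sub_integral_le (h : ScaleConfig x a b y δ CL r ε η H E X) {G : ℂ → ℂ} {M y₀ : ℝ}
    (hM : 0 ≤ M) (hy₀ : 0 < y₀) (hG : DifferentiableOn ℂ G {z | -y₀ < z.im})
    (hGb : ∀ z : ℂ, 0 ≤ z.im → ‖G z‖ ≤ M * (‖P x z‖ * exp (-(freq x a b y * z.im)))) {p : ℝ}
    (hp : |p - y| ≤ (1 - 4 * ε) * r) :
    ‖G (p + η * Complex.I) - ∫ t in ball y r, G t * cauchyKernel η H (p - t)‖ ≤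
      M * (60 + 16 * CL * log n) / (η * nodeMass x) * exp (-X) := by
  have hη := h.η_pos
  have hη1 := h.η_le_one
  have hH := h.H_pos
  have hS := h.nodeMass_pos'
  have hp' : |p - y| ≤ r := hp.trans (by nlinarith [h.ε_pos, h.r_pos])
  have hp1 := h.abs_le_one hp'
  -- Shrinking the strip below height `η` keeps the kernel's lower poles outside the domain of
  -- analyticity.
  have hkey := upper_representation (η := η) (H := H) (y₀ := min y₀ η)
    (τ := M * (6 / (η * nodeMass x) * exp (-X))) (x := p) hη (by linarith [h.η_le]) h.H_le
    (lt_min hy₀ hη) (min_le_right _ _) hp1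
    (hG.mono fun z hz => by
      simp only [Set.mem_ofPred_eq] at hz ⊢
      linarith [min_le_left y₀ η]) ?_ ?_
  · rw [intervalIntegral.integral_of_le (by norm_num)] at hkey
    have hGc : ContinuousOn (fun t : ℝ => G t) (Set.Icc (-3) 3) := by
      refine hG.continuousOn.comp Complex.continuous_ofReal.continuousOn fun t _ => ?_
      simp [hy₀]
    have hKc : Continuous fun t => cauchyKernel η H (p - t) :=
      (continuous_cauchyKernel hη H).comp (by fun_prop)
    have hint : IntegrableOn (fun t : ℝ => G t * cauchyKernel η H (p - t)) (Set.Ioc (-3) 3) :=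
      ((hGc.mul hKc.continuousOn).integrableOn_Icc).mono_set Set.Ioc_subset_Icc_self
    have e := setIntegral_sdiff (measurableSet_Icc (a := y - r) (b := y + r)) hint
      h.ball_subset_three
    set D := Set.Ioc (-3 : ℝ) 3 \ Set.Icc (y - r) (y + r) with hD
    have hDm : MeasurableSet D := measurableSet_Ioc.diff measurableSet_Icc
    set c := 8 / (η * nodeMass x) * exp (-X) with hc
    have hc0 : 0 ≤ c := by positivity
    have hind : Integrable (Set.indicator (Set.Icc a b) fun t : ℝ => ‖P x t‖ * nodeMass x) := by
      rw [integrable_indicator_iff measurableSet_Icc]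
      exact ((continuous_norm_P x).mul continuous_const).integrableOn_Icc
    have hone : IntegrableOn (fun _ : ℝ => (1 : ℝ)) (Set.Ioc (-3 : ℝ) 3) := by
      rw [integrableOn_const_iff]; right; simp
    have hbi : IntegrableOn (fun t : ℝ => M * (c * (Set.indicator (Set.Icc a b)
        (fun t : ℝ => ‖P x t‖ * nodeMass x) t + 1))) (Set.Ioc (-3) 3) :=
      ((hind.integrableOn.add hone).const_mul c).const_mul M
    have hi0 : ∀ t : ℝ, 0 ≤ Set.indicator (Set.Icc a b) (fun t : ℝ => ‖P x t‖ * nodeMass x) t :=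
      fun t => Set.indicator_nonneg (fun _ _ => by positivity) _
    have hout : ‖∫ t in D, G t * cauchyKernel η H (p - t)‖ ≤
        M * (c * (2 * CL * log n + 6)) := by
      calc _ ≤ ∫ t in D, M * (c * (Set.indicator (Set.Icc a b)
            (fun t : ℝ => ‖P x t‖ * nodeMass x) t + 1)) := by
            refine norm_integral_le_of_norm_le (hbi.mono_set Set.sdiff_subset) ?_
            refine (ae_restrict_iff' hDm).mpr (Filter.Eventually.of_forall fun t ht => ?_)
            have h1 := hGb t (by simp)
            simp only [Complex.ofReal_im, mul_zero, neg_zero, exp_zero, mul_one] at h1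
            have h2 := h.norm_real_outer_le hp (t := t)
              (abs_le.mpr ⟨ht.1.1.le, ht.1.2⟩) ht.2
            rw [norm_mul]
            calc _ ≤ M * ‖P x t‖ * ‖cauchyKernel η H (p - t)‖ := by gcongr
              _ = M * (‖P x t‖ * ‖cauchyKernel η H (p - t)‖) := by ring
              _ ≤ _ := by gcongr
        _ ≤ ∫ t in Set.Ioc (-3 : ℝ) 3, M * (c * (Set.indicator (Set.Icc a b)
            (fun t : ℝ => ‖P x t‖ * nodeMass x) t + 1)) := by
            refine setIntegral_mono_set hbi (Filter.Eventually.of_forall fun t => ?_)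
              Set.sdiff_subset.eventuallyLE
            have := hi0 t
            simp only [Pi.zero_apply]; positivity
        _ = M * (c * ((∫ t in Set.Ioc (-3 : ℝ) 3, Set.indicator (Set.Icc a b)
            (fun t : ℝ => ‖P x t‖ * nodeMass x) t) + 6)) := by
            rw [integral_const_mul, integral_const_mul, integral_add hind.integrableOn hone]
            congr 3
            simp; norm_num
        _ ≤ _ := by
            gcongr
            calc _ ≤ ∫ t : ℝ, Set.indicator (Set.Icc a b) (fun t : ℝ => ‖P x t‖ * nodeMass x) t :=
                  setIntegral_le_integral hind (Filter.Eventually.of_forall hi0)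
              _ = ∫ t in Set.Icc a b, ‖P x t‖ * nodeMass x := integral_indicator measurableSet_Icc
              _ ≤ _ := h.integral_norm_P_le
    have e2 : G (p + η * Complex.I) - ∫ t in ball y r, G t * cauchyKernel η H (p - t) =
        (G (p + η * Complex.I) - ∫ t in Set.Ioc (-3 : ℝ) 3, G t * cauchyKernel η H (p - t)) +
          ∫ t in D, G t * cauchyKernel η H (p - t) := by
      rw [e, ball]; ring
    rw [e2]
    refine (norm_add_le _ _).trans ((add_le_add hkey hout).trans (le_of_eq ?_))
    rw [hc]
    field_simp
    ring
  · intro t ht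
    have h1 := hGb (t + H * Complex.I) (by simp [hH.le])
    have him : ((t : ℂ) + H * Complex.I).im = H := by simp
    rw [him] at h1
    rw [norm_mul]
    have h2 := norm_weight_mul_inv_cubic_le_of_im (H := H) (p := p) (t := t) (v := H) hη
      (le_trans (by linarith [h.η_le]) (le_abs_self _))
      (le_trans (by linarith [h.η_le]) (le_abs_self _))
      (le_trans (by linarith [h.η_le]) (le_abs_self _))
    refine (mul_le_mul h1 h2 (norm_nonneg _) (by positivity)).trans ?_
    rw [mul_assoc]
    exact mul_le_mul_of_nonneg_left (h.norm_top_le hp' ht) hM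
  · intro t v ht hv0 hvH
    have h1 := hGb (t + v * Complex.I) (by simp [hv0])
    have him : ((t : ℂ) + v * Complex.I).im = v := by simp
    rw [him] at h1
    rw [norm_mul]
    have h2 := norm_weight_mul_inv_cubic_le_of_re (H := H) (p := p) (t := t) (v := v) hη hη1
      hp1 ht
    refine (mul_le_mul h1 h2 (norm_nonneg _) (by positivity)).trans ?_
    rw [mul_assoc]
    exact mul_le_mul_of_nonneg_left (h.norm_side_le hp' ht hv0 hvH) hM

end ScaleConfig

/-! ### Representation of `e^{-iωz}/P(z)` by residues at the nodes. -/

namespace ScaleConfig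

variable {n : ℕ} {x : Fin n → ℝ} {a b y δ CL r ε η H E X : ℝ}

theorem inv_norm_P_le_of_dist (h : ScaleConfig x a b y δ CL r ε η H E X) {z : ℂ} {d : ℝ}
    (hd : 0 < d) (hz : ∀ i, d ≤ ‖z - x i‖) : ‖P x z‖⁻¹ ≤ nodeMass x / d := by
  have h1 := le_norm_P_mul h.pos h.inj hd hz
  have hS := h.nodeMass_pos'
  have hP : 0 < ‖P x z‖ := by
    by_contra hc
    have : ‖P x z‖ * nodeMass x ≤ 0 := mul_nonpos_of_nonpos_of_nonneg (not_lt.mp hc) hS.le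
    linarith
  rw [inv_eq_one_div, div_le_div_iff₀ hP hd]
  linarith

theorem inv_norm_P_eq (h : ScaleConfig x a b y δ CL r ε η H E X) {t v : ℝ} (hv : v ≠ 0) :
    ‖P x (t + v * Complex.I)‖⁻¹ = nodeMass x * exp (-logSize x (t + v * Complex.I)) := by
  have him : ((t : ℂ) + v * Complex.I).im ≠ 0 := by simpa using hv
  have hS := h.nodeMass_pos'
  rw [exp_neg, exp_logSize h.pos h.inj (ne_node_of_im_ne_zero him)]
  field_simp

/-- One bound covers the whole line of height `H`. Near `y` it is the plane wave estimate, elsewhere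
the partial fraction bound with distance at least `η`. The exponent `c` is left free so that each
horizontal side can use the value suited to it. -/
theorem inv_norm_P_le_of_im_eq (h : ScaleConfig x a b y δ CL r ε η H E X) {p t c : ℝ}
    (hp : |p - y| ≤ r)
    (hnear : E - freq x a b y * H ≤ c) (hfar : 0 ≤ δ ^ 2 / (16 * H ^ 2) + c) :
    ‖P x (t + H * Complex.I)‖⁻¹ ≤ nodeMass x / η * exp ((t - p) ^ 2 / H ^ 2 + c) := by
  have hη := h.η_pos
  have hη1 := h.η_le_one
  have hH := h.H_pos
  have hS := h.nodeMass_pos'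
  by_cases hn : |t - y| ≤ δ / 2
  · have h4 := h.abs_sub_le_of_near hp hn
    have h5 := neg_abs_le (logSize x (t + H * Complex.I) - freq x a b y * H)
    rw [h.inv_norm_P_eq hH.ne']
    have h6 : nodeMass x ≤ nodeMass x / η := by
      rw [le_div_iff₀ hη]; nlinarith
    gcongr
    linarith
  · push Not at hn
    have h4 := h.outer_le hp hn
    have h1 := h.inv_norm_P_le_of_dist (z := t + H * Complex.I) hη fun i => by
      have := Complex.abs_im_le_norm ((t : ℂ) + H * Complex.I - x i)
      simp only [Complex.sub_im, Complex.add_im, Complex.ofReal_im, Complex.mul_im, Complex.I_im,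
        mul_one, Complex.ofReal_re, Complex.I_re, mul_zero, add_zero, zero_add, sub_zero] at this
      rw [abs_of_pos hH] at this
      linarith [h.η_le]
    refine h1.trans (le_mul_of_one_le_right (by positivity) (one_le_exp (by linarith)))

theorem mul_weight_le (h : ScaleConfig x a b y δ CL r ε η H E X) {p t v I B c : ℝ}
    (hIB : I ≤ nodeMass x / η * exp ((t - p) ^ 2 / H ^ 2 + c))
    (hexp : B + c + -(v - η) / η + (v - η) ^ 2 / H ^ 2 ≤ -X) :
    exp B * I * (6 / η * exp (-(v - η) / η + ((v - η) ^ 2 - (t - p) ^ 2) / H ^ 2)) ≤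
      6 * nodeMass x / η ^ 2 * exp (-X) := by
  have hη := h.η_pos
  have hS := h.nodeMass_pos'
  calc _ ≤ exp B * (nodeMass x / η * exp ((t - p) ^ 2 / H ^ 2 + c)) *
        (6 / η * exp (-(v - η) / η + ((v - η) ^ 2 - (t - p) ^ 2) / H ^ 2)) := by gcongr
    _ = 6 * nodeMass x / η ^ 2 * exp (B + ((t - p) ^ 2 / H ^ 2 + c) +
        (-(v - η) / η + ((v - η) ^ 2 - (t - p) ^ 2) / H ^ 2)) := by
        rw [exp_add (B + _), exp_add B]; field_simp
    _ ≤ _ := by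
        gcongr
        rw [sub_div _ ((t - p) ^ 2)]
        linarith

theorem norm_exp_neg_I_mul (om : ℝ) (z : ℂ) :
    ‖Complex.exp (-(Complex.I * om * z))‖ = exp (om * z.im) := by
  rw [Complex.norm_exp]; simp

theorem boundary_le (h : ScaleConfig x a b y δ CL r ε η H E X) {p : ℝ} (hp : |p - y| ≤ r) {z : ℂ}
    (hz : z ∈ rectBoundary (-3) 3 (-H) H) :
    ‖Complex.exp (-(Complex.I * freq x a b y * z)) * (P x z)⁻¹ *
      (weight η H (z - (p + η * Complex.I)) * (cubic η (z - (p + η * Complex.I)))⁻¹)‖ ≤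
      6 * nodeMass x / η ^ 2 * exp (-X) := by
  have hη := h.η_pos
  have hη1 := h.η_le_one
  have hH := h.H_pos
  have hS := h.nodeMass_pos'
  have hηH := h.η_le
  have hp1 := h.abs_le_one hp
  have hHη := h.one_le_H_div
  have hωH := mul_nonneg h.freq_nonneg hH.le
  have hA : 0 ≤ (3 + (8 * π + 2 * CL) / (2 * δ)) * n := by
    have := h.CL_nonneg; have := h.δ_pos; positivity
  have hout := h.outer
  have hbot := h.bottom
  have htop := h.top
  have hE := h.E_nonneg
  obtain ⟨⟨hre1, hre2⟩, ⟨him1, him2⟩, hor⟩ := hz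
  rw [norm_mul, norm_mul, norm_exp_neg_I_mul, norm_inv]
  rw [← Complex.re_add_im z]
  set t := z.re
  set v := z.im
  have himz : ((t : ℂ) + v * Complex.I).im = v := by simp
  rw [himz]
  have hside : |t| = 3 → exp (freq x a b y * v) * ‖P x (t + v * Complex.I)‖⁻¹ *
      ‖weight η H (t + v * Complex.I - (p + η * Complex.I)) *
        (cubic η (t + v * Complex.I - (p + η * Complex.I)))⁻¹‖ ≤
      6 * nodeMass x / η ^ 2 * exp (-X) := fun ht => by
    have hv : |v| ≤ H := abs_le.mpr ⟨him1, him2⟩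
    have h1 := h.inv_norm_P_le_of_dist (z := t + v * Complex.I) one_pos fun i => by
      have h2 := Complex.abs_re_le_norm ((t : ℂ) + v * Complex.I - x i)
      have h3 := abs_sub_abs_le_abs_sub t (x i)
      have h4 : |x i| ≤ 1 := abs_le.mpr (h.mem i)
      have h5 : ((t : ℂ) + v * Complex.I - x i).re = t - x i := by simp
      rw [h5] at h2
      linarith
    rw [div_one] at h1
    have h6 := norm_weight_mul_inv_cubic_le_of_re (H := H) (v := v) hη hη1 hp1 ht
    have h7 := h.outer_le_side hp ht
    refine (mul_le_mul_of_nonneg_left h6 (by positivity)).trans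
      (h.mul_weight_le (c := -((t - p) ^ 2 / H ^ 2)) ?_ ?_)
    · rw [add_neg_cancel, exp_zero, mul_one]
      refine h1.trans ?_
      rw [le_div_iff₀ hη]; nlinarith
    · have h8 : freq x a b y * v ≤ freq x a b y * H :=
        mul_le_mul_of_nonneg_left him2 h.freq_nonneg
      have h9 : -(v - η) / η ≤ H / η + 1 := by
        rw [div_add_one hη.ne']; gcongr; linarith
      have h10 : (v - η) ^ 2 / H ^ 2 ≤ 4 := by
        rw [div_le_iff₀ (by positivity)]
        nlinarith
      linarith
  rcases hor with ht | ht | hv | hv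
  · exact hside (by rw [ht]; norm_num)
  · exact hside (by rw [ht]; norm_num)
  -- Bottom side: `e^{-iωz}` and `1/P` each contribute `e^{-ωH}`, against growth `e^{H/η + 1}` of
  -- the weight. The value of `c` is the largest that leaves `e^{-X}`.
  · have h6 := norm_weight_mul_inv_cubic_le_of_im (H := H) (p := p) (t := t) (v := v) hη
      (by rw [hv]; exact le_trans (by linarith) (neg_le_abs _))
      (by rw [hv]; exact le_trans (by linarith) (neg_le_abs _))
      (by rw [hv]; exact le_trans (by linarith) (neg_le_abs _))
    refine (mul_le_mul_of_nonneg_left h6 (by positivity)).trans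
      (h.mul_weight_le (c := freq x a b y * H - 5 - X - H / η) ?_ ?_)
    · rw [hv, norm_P_ofReal_add_mul_I_neg]
      exact h.inv_norm_P_le_of_im_eq hp (by linarith) (by linarith)
    · have h9 : -(v - η) / η = H / η + 1 := by
        rw [hv]; field_simp; ring
      have h10 : (v - η) ^ 2 / H ^ 2 ≤ 4 := by
        rw [div_le_iff₀ (by positivity), hv]
        nlinarith
      rw [h9, hv]
      rw [hv] at h10
      linarith
  -- Top side: the two factors `e^{±ωH}` cancel, and the weight supplies `e^{1 - H/η}`.
  · have h6 := norm_weight_mul_inv_cubic_le_of_im (H := H) (p := p) (t := t) (v := v) hη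
      (by rw [hv]; exact le_trans (by linarith) (le_abs_self _))
      (by rw [hv]; exact le_trans (by linarith) (le_abs_self _))
      (by rw [hv]; exact le_trans (by linarith) (le_abs_self _))
    refine (mul_le_mul_of_nonneg_left h6 (by positivity)).trans
      (h.mul_weight_le (c := -(freq x a b y * H) - 2 - X + H / η) ?_ ?_)
    · rw [hv]
      exact h.inv_norm_P_le_of_im_eq hp (by linarith) (by linarith)
    · have h9 : -(v - η) / η = 1 - H / η := by
        rw [hv]; field_simp; ring
      have h10 : (v - η) ^ 2 / H ^ 2 ≤ 1 := by
        rw [div_le_one (by positivity), hv]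
        nlinarith
      rw [h9, hv]
      rw [hv] at h10
      linarith

/-- By reflection `|P|` at height `-m` is about `e^{ωm}` after normalisation, and `e^{-iωz}` has
modulus `e^{-ωm}` there, so the quotient is about `e^{-2ωm}`. -/
theorem below_le (h : ScaleConfig x a b y δ CL r ε η H E X) {p m : ℝ} (hp : |p - y| ≤ r)
    (hm : η ≤ m) (hmH : m ≤ H) :
    ‖Complex.exp (-(Complex.I * freq x a b y * (p + (-m : ℝ) * Complex.I))) *
      (P x (p + (-m : ℝ) * Complex.I))⁻¹‖ ≤ nodeMass x * exp (-X) := by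
  have hη := h.η_pos
  have hm0 : 0 < m := hη.trans_le hm
  have hH := h.H_pos
  have hS := h.nodeMass_pos'
  have hW := h.waveConst_nonneg
  have hn := h.n_pos
  have hr := h.r_pos
  have hδ := h.δ_pos
  rw [norm_mul, norm_inv, norm_P_ofReal_add_mul_I_neg, norm_exp_neg_I_mul,
    h.inv_norm_P_eq hm0.ne']
  have him : ((p : ℂ) + (-m : ℝ) * Complex.I).im = -m := by simp
  rw [him]
  have h1 := h.abs_logSize_sub_le (p := p) (y := m) (hp.trans (by linarith [h.r_le]))
    (h.le_η.trans hm)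
  have h2 : NodeConfig.waveConst δ CL * (n * m * |p - y| + n * m ^ 3 + log n) ≤ E := by
    refine le_trans ?_ h.le_E
    have : NodeConfig.waveConst δ CL * (n * m * |p - y| + n * m ^ 3 + log n) ≤
        NodeConfig.waveConst δ CL * (n * H * r + n * H ^ 3 + log n) := by gcongr
    nlinarith [sq_nonneg (NodeConfig.waveConst δ CL * n * H ^ 2)]
  have h3 := neg_abs_le (logSize x (p + m * Complex.I) - freq x a b y * m)
  have h4 : freq x a b y * η ≤ freq x a b y * m := mul_le_mul_of_nonneg_left hm h.freq_nonneg
  have h5 := h.interior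
  calc _ = nodeMass x * exp (freq x a b y * -m + -logSize x (p + m * Complex.I)) := by
        rw [exp_add]; ring
    _ ≤ _ := by gcongr; linarith

open Classical in
/-- Above `J₄`, the function `e^{-iωz} / P(z)` is represented by its residues at the nodes in
`J₀`. -/
theorem norm_inv_add_sum_le (h : ScaleConfig x a b y δ CL r ε η H E X) {p : ℝ}
    (hp : |p - y| ≤ (1 - 4 * ε) * r) :
    ‖Complex.exp (-(Complex.I * freq x a b y * (p + η * Complex.I))) *
        (P x (p + η * Complex.I))⁻¹ +
      2 * π * Complex.I * ∑ k with x k ∈ ball y r,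
        Complex.exp (-(Complex.I * freq x a b y * x k)) * (P' x (x k))⁻¹ *
        cauchyKernel η H (p - x k)‖ ≤
      430 * nodeMass x / η ^ 2 * exp (-X) := by
  have hη := h.η_pos
  have hη1 := h.η_le_one
  have hH := h.H_pos
  have hS := h.nodeMass_pos'
  have hp' : |p - y| ≤ r := hp.trans (by nlinarith [h.ε_pos, h.r_pos])
  have hkey := lower_representation (om := freq x a b y) h.inj h.mem hη h.η_le h.H_le
    (h.abs_le_one hp') fun z hz => h.boundary_le hp' hz
  have hb1 := h.below_le hp' le_rfl (by linarith [h.η_le] : η ≤ H)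
  have hb2 := h.below_le hp' (by linarith : η ≤ 2 * η) (by linarith [h.η_le] : 2 * η ≤ H)
  have e1 : (p : ℂ) + (-η : ℝ) * Complex.I = p - η * Complex.I := by push_cast; ring
  have e2 : (p : ℂ) + (-(2 * η) : ℝ) * Complex.I = p - 2 * η * Complex.I := by push_cast; ring
  rw [e1] at hb1
  rw [e2] at hb2
  set T : Fin n → ℂ := fun k => Complex.exp (-(Complex.I * freq x a b y * x k)) *
    (P' x (x k))⁻¹ * cauchyKernel η H (p - x k) with hT
  have hsplit : ∑ k, T k = ∑ k with x k ∈ ball y r, T k + ∑ k with x k ∉ ball y r, T k :=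
    (Finset.sum_filter_add_sum_filter_not _ _ _).symm
  have hrest : ‖∑ k with x k ∉ ball y r, T k‖ ≤ 8 / η * exp (-X) * nodeMass x := by
    rw [nodeMass, Finset.mul_sum]
    refine (norm_sum_le _ _).trans ?_
    refine le_trans (Finset.sum_le_sum (g := fun k => 8 / η * exp (-X) * (1 / ‖P' x (x k)‖))
      fun k hk => ?_) (Finset.sum_le_sum_of_subset_of_nonneg (Finset.filter_subset _ _)
        fun k _ _ => by positivity)
    have hk' := h.gauss_le hp (Finset.mem_filter.mp hk).2
    have hK := h.norm_cauchyKernel_le' (p - x k)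
    rw [hT]
    simp only
    rw [norm_mul, norm_mul, norm_exp_neg_I_mul, Complex.ofReal_im, mul_zero, exp_zero, one_mul,
      norm_inv, ← one_div, mul_comm]
    gcongr
    exact hK.trans (by gcongr)
  set A := Complex.exp (-(Complex.I * freq x a b y * (p + η * Complex.I))) *
        (P x (p + η * Complex.I))⁻¹ with hAd
  set B := ∑ k with x k ∈ ball y r, T k with hB
  set R := ∑ k with x k ∉ ball y r, T k with hR
  rw [hsplit] at hkey
  have e3 : A + 2 * π * Complex.I * B =
      (A + 2 * π * Complex.I * (B + R)) - 2 * π * Complex.I * R := by ring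
  rw [e3]
  have h9 : nodeMass x * exp (-X) ≤ nodeMass x / η ^ 2 * exp (-X) := by
    gcongr
    rw [le_div_iff₀ (by positivity)]
    have : η ^ 2 ≤ 1 := pow_le_one₀ hη.le hη1
    nlinarith
  have h10 : 2 * π * (8 / η * exp (-X) * nodeMass x) ≤ 52 * (nodeMass x / η ^ 2 * exp (-X)) := by
    have h11 : 2 * π * (8 / η) ≤ 52 / η ^ 2 := by
      rw [mul_div_assoc', div_le_div_iff₀ hη (by positivity)]
      have : π ≤ 3.15 := pi_lt_d2.le
      have h12 : π * η ≤ 3.15 := by nlinarith [pi_pos]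
      nlinarith
    calc _ = 2 * π * (8 / η) * (exp (-X) * nodeMass x) := by ring
      _ ≤ 52 / η ^ 2 * (exp (-X) * nodeMass x) := by gcongr
      _ = _ := by ring
  -- The constant is `430 = 3·6 + 2·180 + 52`: the contour, the two spurious residues, and the nodes
  -- outside `J₀`.
  calc _ ≤ _ := norm_sub_le _ _
    _ ≤ (3 * (6 * nodeMass x / η ^ 2 * exp (-X)) + 180 * (nodeMass x * exp (-X) +
        nodeMass x * exp (-X))) + 2 * π * (8 / η * exp (-X) * nodeMass x) := by
        refine add_le_add (hkey.trans (by gcongr)) ?_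
        rw [norm_mul, norm_two_pi_I]
        gcongr
    _ ≤ (3 * (6 * nodeMass x / η ^ 2 * exp (-X)) + 180 * (nodeMass x / η ^ 2 * exp (-X) +
        nodeMass x / η ^ 2 * exp (-X))) + 52 * (nodeMass x / η ^ 2 * exp (-X)) := by
        gcongr
    _ = _ := by ring

end ScaleConfig

/-! ### Nodes in `J₀`, normalisation, and testing against the bumps. -/

namespace ScaleConfig

variable {n : ℕ} {x : Fin n → ℝ} {a b y δ CL r ε η H E X : ℝ}

/-- A gap of radius `H` would force `ωH ≤ 17E`, contrary to `bottom`. -/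
theorem exists_node_near (h : ScaleConfig x a b y δ CL r ε η H E X) {p : ℝ}
    (hp : |p - y| ≤ r) : ∃ i, |p - x i| < H := by
  by_contra hc
  push Not at hc
  have hH := h.H_pos
  have hW := h.waveConst_nonneg
  have hn := h.n_pos
  have hδ := h.δ_pos
  have h1 := h.freq_mul_le_of_gap (p := p) (hp.trans (by linarith [h.r_le])) h.freq_nonneg
    h.le_H hc
  have h2 : NodeConfig.waveConst δ CL * (n * H * |p - y| + n * H ^ 3 + log n) ≤ E := by
    refine le_trans ?_ h.le_E
    have : NodeConfig.waveConst δ CL * (n * H * |p - y| + n * H ^ 3 + log n) ≤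
        NodeConfig.waveConst δ CL * (n * H * r + n * H ^ 3 + log n) := by gcongr
    nlinarith [sq_nonneg (NodeConfig.waveConst δ CL * n * H ^ 2)]
  have := h.E_nonneg
  have := h.one_le_H_div
  linarith [h.bottom, h.X_nonneg]

/-- Nodes close to `y ± 3r/4` lie in the outer quarters of `J₀`, as `H ≤ r/4`. The last bound
combines `P₀ r ≪ ∫_{J₀}|P|` with the global bound for `∫ |P| · nodeMass`. -/
theorem normalisation (h : ScaleConfig x a b y δ CL r ε η H E X) (hx : StrictMono x) {CJ : ℝ}
    (hloc : localIntegral x y r ≤ CJ * (2 * r) ^ 2) :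
    0 < P₀ x y r ∧
    (∫ t in ball y r, ‖P x t‖) ≤ 4 * CJ * r * P₀ x y r ∧
    P₀ x y r * localMass x (ball y r) ≤ 48 * CJ * r ∧
    r ≤ P₀ x y r * nodeMass x ∧
    P₀ x y r * nodeMass x * r ≤ 24 * CL * log n := by
  have hr := h.r_pos
  have hS := h.nodeMass_pos'
  have hHr := h.H_le_r
  obtain ⟨i, hi⟩ := h.exists_node_near (p := y - 3 * r / 4) (by
    rw [abs_le]; constructor <;> linarith)
  obtain ⟨j, hj⟩ := h.exists_node_near (p := y + 3 * r / 4) (by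
    rw [abs_le]; constructor <;> linarith)
  rw [abs_lt] at hi hj
  obtain ⟨h1, h2, h3, h4, h5⟩ := normalisation_bounds hx hr hloc (i := i) (j := j)
    ⟨by linarith, by linarith⟩ ⟨by linarith, by linarith⟩
  refine ⟨h1, h2, h3, h4, ?_⟩
  have h6 : (∫ t in ball y r, ‖P x t‖) * nodeMass x ≤ 2 * CL * log n := by
    rw [← integral_mul_const]
    refine le_trans (setIntegral_mono_set ?_ (Filter.Eventually.of_forall fun t => ?_)
      h.ball_subset.eventuallyLE) h.integral_norm_P_le
    · exact ((continuous_norm_P x).mul continuous_const).integrableOn_Icc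
    · simp only [Pi.zero_apply]; positivity
  calc P₀ x y r * nodeMass x * r = (P₀ x y r * r) * nodeMass x := by ring
    _ ≤ 12 * (∫ t in ball y r, ‖P x t‖) * nodeMass x := by gcongr
    _ ≤ _ := by linarith

/-- Testing a family of functions represented by the localised Cauchy kernel against a partition
of unity. -/
theorem sum_integral_re_le (h : ScaleConfig x a b y δ CL r ε η H E X)
    {φ : ℤ → ℝ → ℝ} {s : ℤ → ℝ} {L Cφ : ℝ} {N : ℕ} (hφ : IsBumpPartition φ s L Cφ N)
    {G : Finset ℤ} (hsupp : ∀ j ∈ G, ∀ t, φ j t ≠ 0 → |t - y| ≤ (1 - 4 * ε) * r)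
    {ν : Measure ℝ} [SFinite ν] {w : ℝ → ℝ} (hw : Integrable w ν) (hw0 : ∀ t, 0 ≤ w t)
    {F g : ℤ → ℝ → ℂ} (hF : ∀ j ∈ G, Continuous (F j)) (hg : ∀ j ∈ G, Measurable (g j))
    (hgw : ∀ j ∈ G, ∀ t, ‖g j t‖ ≤ w t) {e : ℝ} (he : 0 ≤ e)
    (hrep : ∀ j ∈ G, ∀ p, |p - y| ≤ (1 - 4 * ε) * r →
      ‖F j p - ∫ t, g j t * cauchyKernel η H (p - t) ∂ν‖ ≤ e) :
    ∑ j ∈ G, ∫ p, φ j p * (F j p).re ≤ ∑ j ∈ G, (∫ t, (φ j t : ℂ) * g j t ∂ν).re +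
      (2 * N * (Cφ / L) * (8 * π * η) + 38 / η * exp (-X)) * (∫ t, w t ∂ν) + e * (2 * r) := by
  have hη := h.η_pos
  have hr := h.r_pos
  have hηH : η ≤ H := by linarith [h.η_le]
  have hbm : MeasurableSet (ball y r) := measurableSet_Icc
  have hKb : ∀ u, ‖cauchyKernel η H u‖ ≤ 8 / η := fun u =>
    (h.norm_cauchyKernel_le' u).trans (mul_le_of_le_one_right (by positivity)
      (exp_le_one_iff.mpr (neg_nonpos.mpr (by positivity))))
  have hKc := continuous_cauchyKernel hη H
  obtain ⟨hki, -, hk1, hM₁⟩ := integral_norm_cauchyKernel_le hη hηH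
  have htr := sum_norm_transfer_le hKc hKb hki hk1 hM₁ h.norm_integral_cauchyKernel_sub_one_le
    hw hw0 hφ G hg hgw
  set R : ℤ → ℝ → ℂ := fun j p => ∫ t, g j t * cauchyKernel η H (p - t) ∂ν with hR
  have hRc : ∀ j ∈ G, Continuous (R j) := fun j hj => by
    refine continuous_of_dominated (bound := fun t => w t * (8 / η)) (fun p => ?_)
      (fun p => Filter.Eventually.of_forall fun t => ?_) (hw.mul_const _)
      (Filter.Eventually.of_forall fun t => ?_)
    · exact ((hg j hj).mul (hKc.measurable.comp (by fun_prop))).aestronglyMeasurable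
    · rw [norm_mul]
      exact mul_le_mul (hgw j hj t) (hKb _) (norm_nonneg _) (hw0 t)
    · exact continuous_const.mul (hKc.comp (by fun_prop))
  have hsup : ∀ j, HasCompactSupport (φ j) := fun j =>
    HasCompactSupport.of_support_subset_isCompact isCompact_Icc (hφ.support_subset j)
  have hint : ∀ j, ∀ f : ℝ → ℂ, Continuous f → Integrable fun p => (φ j p : ℂ) * f p :=
    fun j f hf => by
      refine ((Complex.continuous_ofReal.comp (hφ.continuous j)).mul hf).integrable_of_hasCompactSupport
        ?_
      refine HasCompactSupport.mul_right ?_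
      exact (hsup j).comp_left (g := fun r : ℝ => (r : ℂ)) (by simp)
  have hball : ∀ j ∈ G, ∀ t, φ j t ≤ Set.indicator (ball y r) (fun _ => φ j t) t := by
    intro j hj t
    by_cases ht : t ∈ ball y r
    · rw [Set.indicator_of_mem ht]
    · rw [Set.indicator_of_notMem ht]
      by_contra hc
      push Not at hc
      have h1 := abs_le.mp (hsupp j hj t hc.ne')
      have : (1 - 4 * ε) * r ≤ r := by nlinarith [h.ε_pos]
      exact ht ⟨by linarith [h1.1], by linarith [h1.2]⟩
  have hterm : ∀ j ∈ G, ∫ p, φ j p * (F j p).re ≤ (∫ t, (φ j t : ℂ) * g j t ∂ν).re +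
      ‖(∫ p, (φ j p : ℂ) * R j p) - ∫ t, (φ j t : ℂ) * g j t ∂ν‖ + ∫ p, φ j p * e := by
    intro j hj
    have hFi := hint j (F j) (hF j hj)
    have hRi := hint j (R j) (hRc j hj)
    have e1 : ∫ p, φ j p * (F j p).re = (∫ p, (φ j p : ℂ) * F j p).re := by
      rw [← RCLike.re_eq_complex_re, ← integral_re hFi]
      simp
    have e2 : ‖(∫ p, (φ j p : ℂ) * F j p) - ∫ p, (φ j p : ℂ) * R j p‖ ≤ ∫ p, φ j p * e := by
      rw [← integral_sub hFi hRi]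
      refine norm_integral_le_of_norm_le ((hφ.integrable j).mul_const e)
        (Filter.Eventually.of_forall fun p => ?_)
      rw [← mul_sub, norm_mul, Complex.norm_real, norm_eq_abs, abs_of_nonneg (hφ.nonneg j p)]
      by_cases h0 : φ j p = 0
      · simp [h0]
      · exact mul_le_mul_of_nonneg_left (hrep j hj p (hsupp j hj p h0)) (hφ.nonneg j p)
    rw [e1]
    set A := ∫ p, (φ j p : ℂ) * F j p
    set B := ∫ p, (φ j p : ℂ) * R j p
    set C := ∫ t, (φ j t : ℂ) * g j t ∂ν
    have e3 : A.re = C.re + (B - C).re + (A - B).re := by simp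
    rw [e3]
    exact add_le_add (add_le_add le_rfl (Complex.re_le_norm _)) ((Complex.re_le_norm _).trans e2)
  have hsum : ∑ j ∈ G, ∫ p, φ j p * e ≤ e * (2 * r) := by
    rw [← integral_finsetSum _ fun j _ => (hφ.integrable j).mul_const e]
    simp_rw [← Finset.sum_mul]
    rw [integral_mul_const, mul_comm]
    refine mul_le_mul_of_nonneg_left ?_ he
    calc ∫ p, ∑ j ∈ G, φ j p ≤ ∫ p, Set.indicator (ball y r) (fun _ => (1 : ℝ)) p := by
          refine integral_mono (integrable_finsetSum _ fun j _ => hφ.integrable j) ?_ fun t => ?_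
          · rw [integrable_indicator_iff hbm, integrableOn_const_iff]
            right; simp [ball]
          · simp only
            by_cases ht : t ∈ ball y r
            · rw [Set.indicator_of_mem ht]; exact hφ.sum_le_one G t
            · rw [Set.indicator_of_notMem ht]
              refine Finset.sum_nonpos fun j hj => ?_
              have := hball j hj t
              rwa [Set.indicator_of_notMem ht] at this
      _ = 2 * r := by
          rw [integral_indicator hbm]
          simp [ball]
          rw [max_eq_left (by linarith)]; ring
  calc _ ≤ _ := Finset.sum_le_sum hterm
    _ = ∑ j ∈ G, (∫ t, (φ j t : ℂ) * g j t ∂ν).re +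
        ∑ j ∈ G, ‖(∫ p, (φ j p : ℂ) * R j p) - ∫ t, (φ j t : ℂ) * g j t ∂ν‖ +
        ∑ j ∈ G, ∫ p, φ j p * e := by
        rw [Finset.sum_add_distrib, Finset.sum_add_distrib]
    _ ≤ _ := add_le_add (add_le_add le_rfl htr) hsum

end ScaleConfig

/-! ### Phase alignment on good intervals. -/

/-- A configuration together with a bump partition at the scale `L = η / lam` and a finite set `G`
of indices on whose intervals the logarithmic derivative of `P` at height `η` is within `lam² / η`
of that of the plane wave. -/
structure WaveConfig {n : ℕ} (x : Fin n → ℝ) (a b y δ CL r ε η H E X lam : ℝ) (φ : ℤ → ℝ → ℝ)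
    (s : ℤ → ℝ) (Cφ : ℝ) (N : ℕ) (CJ : ℝ) (G : Finset ℤ) : Prop
    extends ScaleConfig x a b y δ CL r ε η H E X where
  mono : StrictMono x
  loc : localIntegral x y r ≤ CJ * (2 * r) ^ 2
  lam_pos : 0 < lam
  lam_le : lam ≤ 1
  lam_small : (8 + 2 / ε) * lam ≤ 1 / 4
  small : (100 + 10336 * CL * log n) / (r * η ^ 2) * exp (-X) ≤ lam
  wave_small : exp (-(freq x a b y * η)) ≤ lam
  bump : IsBumpPartition φ s (η / lam) Cφ N
  supp : ∀ j ∈ G, ∀ t ∈ Set.Icc (s j) (s j + η / lam), |t - y| ≤ (1 - 4 * ε) * r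
  defect : ∀ j ∈ G, ∀ t ∈ Set.Icc (s j) (s j + η / lam), waveDefect x a b y t η ≤ lam ^ 2 / η

theorem hasDerivAt_wave {n : ℕ} (x : Fin n → ℝ) {η : ℝ} (hη : η ≠ 0) (om t : ℝ) :
    HasDerivAt (fun t : ℝ => P x (t + η * Complex.I) *
        Complex.exp (Complex.I * om * (t + η * Complex.I)))
      ((P' x (t + η * Complex.I) / P x (t + η * Complex.I) + Complex.I * om) *
        (P x (t + η * Complex.I) * Complex.exp (Complex.I * om * (t + η * Complex.I)))) t ∧
    HasDerivAt (fun t : ℝ => Complex.exp (-(Complex.I * om * (t + η * Complex.I))) *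
        (P x (t + η * Complex.I))⁻¹)
      (-(P' x (t + η * Complex.I) / P x (t + η * Complex.I) + Complex.I * om) *
        (Complex.exp (-(Complex.I * om * (t + η * Complex.I))) * (P x (t + η * Complex.I))⁻¹)) t := by
  have him : ((t : ℂ) + η * Complex.I).im ≠ 0 := by simpa using hη
  have hP := P_ne_zero (ne_node_of_im_ne_zero (x := x) him)
  have h1 : HasDerivAt (fun t : ℝ => (t : ℂ) + η * Complex.I) 1 t :=
    (Complex.ofRealCLM.hasDerivAt (x := t)).add_const _
  have h2 := (hasDerivAt_P x (t + η * Complex.I)).comp t h1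
  have h3 := (h1.const_mul (Complex.I * om)).cexp
  have h4 := (h1.const_mul (Complex.I * om)).neg.cexp
  constructor
  · refine (h2.mul h3).congr_deriv ?_
    simp only [Function.comp]
    field_simp
  · refine (h4.mul (h2.inv hP)).congr_deriv ?_
    simp only [Function.comp, Pi.neg_apply, Pi.inv_apply]
    generalize P x (t + η * Complex.I) = u at hP ⊢
    generalize P' x (t + η * Complex.I) = v
    field_simp
    ring

namespace WaveConfig

variable {n : ℕ} {x : Fin n → ℝ} {a b y δ CL r ε η H E X lam : ℝ} {φ : ℤ → ℝ → ℝ}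
  {s : ℤ → ℝ} {Cφ : ℝ} {N : ℕ} {CJ : ℝ} {G : Finset ℤ}

theorem supp_of_ne_zero (h : WaveConfig x a b y δ CL r ε η H E X lam φ s Cφ N CJ G) {j : ℤ}
    (hj : j ∈ G) {t : ℝ} (ht : φ j t ≠ 0) : |t - y| ≤ (1 - 4 * ε) * r :=
  h.supp j hj t (h.bump.support_subset j ht)

theorem norm_logDeriv_le (h : WaveConfig x a b y δ CL r ε η H E X lam φ s Cφ N CJ G) {j : ℤ}
    (hj : j ∈ G) {t : ℝ} (ht : t ∈ Set.Icc (s j) (s j + η / lam)) :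
    ‖P' x (t + η * Complex.I) / P x (t + η * Complex.I) + Complex.I * freq x a b y‖ ≤
      lam ^ 2 / η := by
  refine le_trans (le_of_eq ?_) (h.defect j hj t ht)
  rw [waveDefect, freq]
  congr 2
  push_cast; ring

theorem six_lam_le (h : WaveConfig x a b y δ CL r ε η H E X lam φ s Cφ N CJ G) :
    6 * lam ≤ 1 / 4 := by
  have h1 := h.lam_small
  have h2 := h.lam_pos
  have h3 := h.ε_pos
  have : 0 ≤ 2 / ε * lam := by positivity
  nlinarith

/-- The defect `lam²/η` times the length `η/lam` is `lam`, so both the wave and its reciprocal have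
almost constant phase on each good interval. -/
theorem exists_phase (h : WaveConfig x a b y δ CL r ε η H E X lam φ s Cφ N CJ G) {j : ℤ}
    (hj : j ∈ G) :
    (∃ τ : ℂ, ‖τ‖ = 1 ∧ ∀ t ∈ Set.Icc (s j) (s j + η / lam),
      (1 - 6 * lam) * ‖P x (t + η * Complex.I) *
        Complex.exp (Complex.I * freq x a b y * (t + η * Complex.I))‖ ≤
      (τ * (P x (t + η * Complex.I) *
        Complex.exp (Complex.I * freq x a b y * (t + η * Complex.I)))).re) ∧
    (∃ τ : ℂ, ‖τ‖ = 1 ∧ ∀ t ∈ Set.Icc (s j) (s j + η / lam),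
      (1 - 6 * lam) * ‖Complex.exp (-(Complex.I * freq x a b y * (t + η * Complex.I))) *
        (P x (t + η * Complex.I))⁻¹‖ ≤
      (τ * (Complex.exp (-(Complex.I * freq x a b y * (t + η * Complex.I))) *
        (P x (t + η * Complex.I))⁻¹)).re) := by
  have hη := h.η_pos
  have hl := h.lam_pos
  have e : lam ^ 2 / η * (η / lam) = lam := by field_simp
  have h6 := h.six_lam_le
  have hw := fun t => hasDerivAt_wave x hη.ne' (freq x a b y) t
  constructor
  · have := exists_unit_mul_re_ge (L := η / lam) (κ := lam ^ 2 / η) (a := s j) (by positivity)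
      (by positivity) (fun t _ => (hw t).1) (fun t ht => by
        rw [norm_mul]
        exact mul_le_mul_of_nonneg_right (h.norm_logDeriv_le hj ht) (norm_nonneg _))
      (by rw [e]; linarith)
    rwa [e] at this
  · have := exists_unit_mul_re_ge (L := η / lam) (κ := lam ^ 2 / η) (a := s j) (by positivity)
      (by positivity) (fun t _ => (hw t).2) (fun t ht => by
        rw [norm_mul, norm_neg]
        exact mul_le_mul_of_nonneg_right (h.norm_logDeriv_le hj ht) (norm_nonneg _))
      (by rw [e]; linarith)
    rwa [e] at this

theorem CJ_nonneg (h : WaveConfig x a b y δ CL r ε η H E X lam φ s Cφ N CJ G) : 0 ≤ CJ := by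
  obtain ⟨h1, -, h3, -, -⟩ := h.normalisation h.mono h.loc
  have h4 := (mul_nonneg h1.le (localMass_nonneg x (ball y r))).trans h3
  have hr := h.r_pos
  by_contra hc
  push Not at hc
  nlinarith

/-- The total error of the smoothing step. -/
theorem transfer_const_le (h : WaveConfig x a b y δ CL r ε η H E X lam φ s Cφ N CJ G) :
    2 * N * (Cφ / (η / lam)) * (8 * π * η) + 38 / η * exp (-X) ≤
      (16 * π * N * Cφ + 1) * lam := by
  have hη := h.η_pos
  have hη1 := h.η_le_one
  have hr := h.r_pos
  have hl := h.lam_pos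
  have hr1 : r ≤ 1 := by linarith [h.r_le, h.δ_le_one]
  have hCL := mul_nonneg h.CL_nonneg (zero_le_one.trans h.one_le_log)
  -- The bump scale `η/lam` exceeds the kernel's first moment `O(η)` by the factor `1/lam`.
  have e : 2 * N * (Cφ / (η / lam)) * (8 * π * η) = 16 * π * N * Cφ * lam := by
    field_simp; ring
  have h2 : 38 / η * exp (-X) ≤ lam := by
    refine le_trans (mul_le_mul_of_nonneg_right ?_ (exp_pos _).le) h.small
    rw [div_le_div_iff₀ hη (by positivity)]
    have : r * η ≤ 1 := mul_le_one₀ hr1 hη.le hη1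
    have h3 : r * η ^ 2 ≤ η := by nlinarith
    nlinarith
  rw [e]; linarith

end WaveConfig

/-! ### The nodal sum, inequality (ii). -/

open Classical in
/-- The counting measure of the nodes in `J`. -/
noncomputable def nodeMeasure {n : ℕ} (x : Fin n → ℝ) (J : Set ℝ) : Measure ℝ :=
  ∑ k with x k ∈ J, Measure.dirac (x k)

instance {n : ℕ} (x : Fin n → ℝ) (J : Set ℝ) : IsFiniteMeasure (nodeMeasure x J) := by
  refine ⟨?_⟩
  rw [nodeMeasure, Measure.finsetSum_apply]
  exact ENNReal.sum_lt_top.mpr fun k _ => measure_lt_top _ _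

section

variable {V : Type*} [NormedAddCommGroup V]

theorem integrable_nodeMeasure {n : ℕ} (x : Fin n → ℝ) (J : Set ℝ) (f : ℝ → V) :
    Integrable f (nodeMeasure x J) := by
  rw [nodeMeasure, integrable_finsetSum_measure]
  exact fun k _ => integrable_dirac (by simp)

open Classical in
theorem integral_nodeMeasure [NormedSpace ℝ V] [CompleteSpace V] {n : ℕ} (x : Fin n → ℝ) (J : Set ℝ)
    (f : ℝ → V) : ∫ t, f t ∂nodeMeasure x J = ∑ k with x k ∈ J, f (x k) := by
  rw [nodeMeasure, integral_finsetSum_measure fun k _ => integrable_dirac (by simp)]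
  simp

end

namespace WaveConfig

variable {n : ℕ} {x : Fin n → ℝ} {a b y δ CL r ε η H E X lam : ℝ} {φ : ℤ → ℝ → ℝ}
  {s : ℤ → ℝ} {Cφ : ℝ} {N : ℕ} {CJ : ℝ} {G : Finset ℤ}

/-- The lower bound for the nodal sum. -/
theorem nodal_sum_ge (h : WaveConfig x a b y δ CL r ε η H E X lam φ s Cφ N CJ G) {K : ℝ}
    (hK : K = (16 * π * N * Cφ + 1) * (96 * π * CJ) + 2) :
    P₀ x y r * (∑ j ∈ G, ∫ t, φ j t * (exp (freq x a b y * η) / ‖P x (t + η * Complex.I)‖)) -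
      (K + 12 * (96 * π * CJ + K)) * lam * r ≤
    2 * π * (P₀ x y r * ∑ j ∈ G, ∑ k, φ j (x k) / ‖P' x (x k)‖) := by
  classical
  have hη := h.η_pos
  have hr := h.r_pos
  have hl := h.lam_pos
  have hS := h.nodeMass_pos'
  have hCL := mul_nonneg h.CL_nonneg (zero_le_one.trans h.one_le_log)
  obtain ⟨hP0, -, hB1, hB2, hB3⟩ := h.normalisation h.mono h.loc
  have hφ := h.bump
  set om := freq x a b y with hom
  have hex : ∀ j, ∃ τ : ℂ, j ∈ G → ‖τ‖ = 1 ∧ ∀ t ∈ Set.Icc (s j) (s j + η / lam),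
      (1 - 6 * lam) * ‖Complex.exp (-(Complex.I * om * (t + η * Complex.I))) *
        (P x (t + η * Complex.I))⁻¹‖ ≤
      (τ * (Complex.exp (-(Complex.I * om * (t + η * Complex.I))) *
        (P x (t + η * Complex.I))⁻¹)).re := fun j => by
    by_cases hj : j ∈ G
    · obtain ⟨τ, hτ⟩ := (h.exists_phase hj).2
      exact ⟨τ, fun _ => hτ⟩
    · exact ⟨0, fun h => absurd h hj⟩
  choose τ hτ using hex
  have hPne : ∀ t : ℝ, P x (t + η * Complex.I) ≠ 0 := fun t =>
    P_ne_zero (ne_node_of_im_ne_zero (by simpa using hη.ne'))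
  have hf : Continuous fun t : ℝ => Complex.exp (-(Complex.I * om * (t + η * Complex.I))) *
      (P x (t + η * Complex.I))⁻¹ := by
    refine Continuous.mul (by fun_prop) (Continuous.inv₀ ((continuous_P x).comp (by fun_prop)) hPne)
  have hfn : ∀ t : ℝ, ‖Complex.exp (-(Complex.I * om * (t + η * Complex.I))) *
      (P x (t + η * Complex.I))⁻¹‖ = exp (om * η) / ‖P x (t + η * Complex.I)‖ := fun t => by
    rw [norm_mul, ScaleConfig.norm_exp_neg_I_mul, norm_inv, div_eq_mul_inv]
    simp
  -- The density against the counting measure of the nodes. The minus sign is there because the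
  -- residues at the nodes and the value at height `η` nearly cancel.
  set g₀ : ℝ → ℂ := fun t => -(2 * π * Complex.I) *
    (Complex.exp (-(Complex.I * om * t)) * (P' x t)⁻¹) with hg₀
  have hg₀m : Measurable g₀ := by
    have h1 : Continuous fun t : ℝ => P' x t :=
      ((Polynomial.derivative (nodePoly x)).continuous_aeval).comp Complex.continuous_ofReal
    have h2 : Continuous fun t : ℝ => Complex.exp (-(Complex.I * om * t)) := by fun_prop
    exact (h2.measurable.mul h1.measurable.inv).const_mul _
  have hg₀n : ∀ t, ‖g₀ t‖ = 2 * π * (1 / ‖P' x t‖) := fun t => by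
    rw [hg₀]
    simp only
    rw [norm_mul, norm_neg, norm_two_pi_I, norm_mul, ScaleConfig.norm_exp_neg_I_mul, norm_inv]
    simp
  have hmain := h.sum_integral_re_le hφ (G := G) (fun j hj t ht => h.supp_of_ne_zero hj ht)
    (ν := nodeMeasure x (ball y r)) (w := fun t => ‖g₀ t‖) (integrable_nodeMeasure _ _ _)
    (fun t => norm_nonneg _)
    (F := fun j t => τ j * (Complex.exp (-(Complex.I * om * (t + η * Complex.I))) *
      (P x (t + η * Complex.I))⁻¹)) (g := fun j t => τ j * g₀ t)
    (fun j _ => continuous_const.mul hf) (fun j _ => hg₀m.const_mul _)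
    (fun j hj t => by rw [norm_mul, (hτ j hj).1, one_mul])
    (e := 430 * nodeMass x / η ^ 2 * exp (-X)) (by positivity) (fun j hj p hp => by
      refine le_trans (le_of_eq ?_) (h.norm_inv_add_sum_le hp)
      rw [integral_nodeMeasure, Finset.mul_sum]
      have e1 : ∀ k, τ j * g₀ (x k) * cauchyKernel η H (p - x k) =
          -(τ j * (2 * π * Complex.I * (Complex.exp (-(Complex.I * om * x k)) * (P' x (x k))⁻¹ *
            cauchyKernel η H (p - x k)))) := fun k => by
        rw [hg₀]; ring
      simp_rw [e1]
      rw [Finset.sum_neg_distrib, ← Finset.mul_sum, sub_neg_eq_add, ← mul_add, norm_mul,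
        (hτ j hj).1, one_mul])
  have hwint : ∫ t, ‖g₀ t‖ ∂nodeMeasure x (ball y r) = 2 * π * localMass x (ball y r) := by
    rw [integral_nodeMeasure, localMass, Finset.mul_sum]
    exact Finset.sum_congr rfl fun k _ => hg₀n _
  rw [hwint] at hmain
  set B := ∑ j ∈ G, ∑ k, φ j (x k) / ‖P' x (x k)‖ with hB
  set F := ∑ j ∈ G, ∫ t, φ j t * (exp (om * η) / ‖P x (t + η * Complex.I)‖) with hF
  have hball : ∀ j ∈ G, ∀ k, x k ∉ ball y r → φ j (x k) = 0 := fun j hj k hk => by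
    by_contra hc
    have h1 := abs_le.mp (h.supp_of_ne_zero hj hc)
    have : (1 - 4 * ε) * r ≤ r := by nlinarith [h.ε_pos]
    exact hk ⟨by linarith [h1.1], by linarith [h1.2]⟩
  have hBeq : B = ∑ j ∈ G, ∑ k with x k ∈ ball y r, φ j (x k) / ‖P' x (x k)‖ := by
    refine Finset.sum_congr rfl fun j hj => ?_
    rw [Finset.sum_filter]
    refine Finset.sum_congr rfl fun k _ => ?_
    split_ifs with hk
    · rfl
    · rw [hball j hj k hk, zero_div]
  have hright : ∑ j ∈ G, (∫ t, (φ j t : ℂ) * (τ j * g₀ t) ∂nodeMeasure x (ball y r)).re ≤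
      2 * π * B := by
    rw [hBeq, Finset.mul_sum]
    refine Finset.sum_le_sum fun j hj => (Complex.re_le_norm _).trans ?_
    rw [integral_nodeMeasure, Finset.mul_sum]
    refine (norm_sum_le _ _).trans (Finset.sum_le_sum fun k _ => le_of_eq ?_)
    rw [norm_mul, norm_mul, (hτ j hj).1, hg₀n, Complex.norm_real, norm_eq_abs,
      abs_of_nonneg (hφ.nonneg j _)]
    ring
  have hleft : (1 - 6 * lam) * F ≤ ∑ j ∈ G, ∫ p, φ j p *
      (τ j * (Complex.exp (-(Complex.I * om * (p + η * Complex.I))) *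
        (P x (p + η * Complex.I))⁻¹)).re := by
    rw [hF, Finset.mul_sum]
    refine Finset.sum_le_sum fun j hj => ?_
    rw [← integral_const_mul]
    have hsup : HasCompactSupport (φ j) :=
      HasCompactSupport.of_support_subset_isCompact isCompact_Icc (hφ.support_subset j)
    refine integral_mono ?_ ?_ fun t => ?_
    · simp_rw [← hfn]
      exact (((hφ.continuous j).mul hf.norm).integrable_of_hasCompactSupport
        hsup.mul_right).const_mul _
    · exact ((hφ.continuous j).mul (Complex.continuous_re.comp
        (continuous_const.mul hf))).integrable_of_hasCompactSupport hsup.mul_right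
    · simp only
      by_cases ht : t ∈ Set.Icc (s j) (s j + η / lam)
      · have h1 := (hτ j hj).2 t ht
        rw [hfn] at h1
        calc _ = φ j t * ((1 - 6 * lam) * (exp (om * η) / ‖P x (t + η * Complex.I)‖)) := by ring
          _ ≤ _ := mul_le_mul_of_nonneg_left h1 (hφ.nonneg j t)
      · rw [hφ.eq_zero ht]; simp
  have hBle : B ≤ localMass x (ball y r) := by
    rw [hBeq, Finset.sum_comm, localMass]
    refine Finset.sum_le_sum fun k _ => ?_
    rw [← Finset.sum_div]
    gcongr
    exact hφ.sum_le_one G _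
  have hB0 : 0 ≤ B := Finset.sum_nonneg fun j _ => Finset.sum_nonneg fun k _ =>
    div_nonneg (hφ.nonneg j _) (norm_nonneg _)
  have hF0 : 0 ≤ F := Finset.sum_nonneg fun j _ => integral_nonneg fun t =>
    mul_nonneg (hφ.nonneg j t) (by positivity)
  have htc := h.transfer_const_le
  have hT0 : 0 ≤ (16 * π * N * Cφ + 1) * lam := by
    refine le_trans ?_ htc
    have := hφ.const_nonneg
    positivity
  -- The error is relative to `nodeMass`, and `P₀ · nodeMass ≪ log n / r`. The factor `430 · 24 =
  -- 10320` is covered by the constant in `small`.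
  have he : P₀ x y r * (430 * nodeMass x / η ^ 2 * exp (-X)) ≤ lam := by
    refine le_trans ?_ h.small
    have h1 : P₀ x y r * nodeMass x ≤ (24 * CL * log n) / r := by
      rw [le_div_iff₀ hr]; exact hB3
    calc _ = 430 * (P₀ x y r * nodeMass x) / η ^ 2 * exp (-X) := by ring
      _ ≤ 430 * ((24 * CL * log n) / r) / η ^ 2 * exp (-X) := by gcongr
      _ = (10320 * (CL * log n)) / (r * η ^ 2) * exp (-X) := by field_simp; ring
      _ ≤ _ := by
        gcongr
        linarith
  have hineq : (1 - 6 * lam) * F ≤ 2 * π * B + ((16 * π * N * Cφ + 1) * lam *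
      (2 * π * localMass x (ball y r)) + 430 * nodeMass x / η ^ 2 * exp (-X) * (2 * r)) := by
    have h1 := hleft.trans hmain
    have h2 := mul_le_mul_of_nonneg_right htc
      (mul_nonneg two_pi_pos.le (localMass_nonneg x (ball y r)))
    linarith
  have hineq2 : (1 - 6 * lam) * (P₀ x y r * F) ≤ 2 * π * (P₀ x y r * B) + K * lam * r := by
    have h1 := mul_le_mul_of_nonneg_left hineq hP0.le
    have h2 := mul_le_mul_of_nonneg_left hB1 (mul_nonneg hT0 two_pi_pos.le)
    have h3 := mul_le_mul_of_nonneg_right he (by positivity : 0 ≤ 2 * r)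
    rw [hK]
    linarith
  have h6 := h.six_lam_le
  have hPB : P₀ x y r * B ≤ 48 * CJ * r := (mul_le_mul_of_nonneg_left hBle hP0.le).trans hB1
  have hPF0 : 0 ≤ P₀ x y r * F := by positivity
  -- An a priori bound for the left side, from the inequality just shown and `1 - 6 lam ≥ 1/2`. It
  -- converts the lost factor `1 - 6 lam` into an additive error.
  have hPF : P₀ x y r * F ≤ 2 * (96 * π * CJ * r + K * r) := by
    have h7 : 2 * π * (P₀ x y r * B) ≤ 96 * π * CJ * r := by
      have := mul_le_mul_of_nonneg_left hPB two_pi_pos.le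
      linarith
    have h8 : K * lam * r ≤ K * r := by
      have hK0 : 0 ≤ K := by
        rw [hK]
        have h9 : 0 ≤ 16 * π * N * Cφ + 1 := nonneg_of_mul_nonneg_left hT0 hl
        have := h.CJ_nonneg
        positivity
      nlinarith [h.lam_le, mul_nonneg hK0 hr.le]
    nlinarith
  have := mul_le_mul_of_nonneg_left hPF (by positivity : 0 ≤ 6 * lam)
  linarith

end WaveConfig

/-! ### The integral of `|P|`, inequality (i). -/

theorem norm_mul_exp_I_mul {ρ : ℝ} (hρ : 0 ≤ ρ) {τ : ℂ} (hτ : ‖τ‖ = 1) (om : ℝ) (z : ℂ) :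
    ‖(ρ : ℂ) * τ * Complex.exp (Complex.I * om * z)‖ = ρ * exp (-(om * z.im)) := by
  rw [norm_mul, norm_mul, hτ, mul_one, Complex.norm_real, norm_eq_abs, abs_of_nonneg hρ,
    Complex.norm_exp]
  simp

namespace WaveConfig

variable {n : ℕ} {x : Fin n → ℝ} {a b y δ CL r ε η H E X lam : ℝ} {φ : ℤ → ℝ → ℝ}
  {s : ℤ → ℝ} {Cφ : ℝ} {N : ℕ} {CJ : ℝ} {G : Finset ℤ}

set_option maxHeartbeats 1600000 in
/-- The lower bound for the integral of `|P|`. -/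
theorem real_integral_ge (h : WaveConfig x a b y δ CL r ε η H E X lam φ s Cφ N CJ G) {K : ℝ}
    (hK : K = (16 * π * N * Cφ + 1) * (16 * CJ / ε) + 8 / ε) :
    4 / π * (1 - ε) * (∑ j ∈ G, ∫ t, φ j t *
        (‖P x (t + η * Complex.I)‖ * exp (-(freq x a b y * η)))) -
      (K + (16 + 4 / ε) * (4 * CJ + K)) * lam * r * P₀ x y r ≤
    ∑ j ∈ G, ∫ t, φ j t * ‖P x (t : ℝ)‖ := by
  have hη := h.η_pos
  have hη1 := h.η_le_one
  have hr := h.r_pos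
  have hl := h.lam_pos
  have hS := h.nodeMass_pos'
  have hε := h.ε_pos
  have hε1 := h.ε_lt
  have hω := h.freq_nonneg
  have hCL := mul_nonneg h.CL_nonneg (zero_le_one.trans h.one_le_log)
  obtain ⟨hP0, hA1, -, hA2, -⟩ := h.normalisation h.mono h.loc
  have hφ := h.bump
  set om := freq x a b y with hom
  -- The default phase 1 outside `G` keeps `‖τ j‖ = 1` for every `j`, so that the waves below are
  -- controlled for all indices.
  have hex : ∀ j, ∃ τ : ℂ, ‖τ‖ = 1 ∧ (j ∈ G → ∀ t ∈ Set.Icc (s j) (s j + η / lam),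
      (1 - 6 * lam) * ‖P x (t + η * Complex.I) *
        Complex.exp (Complex.I * om * (t + η * Complex.I))‖ ≤
      (τ * (P x (t + η * Complex.I) *
        Complex.exp (Complex.I * om * (t + η * Complex.I)))).re) := fun j => by
    by_cases hj : j ∈ G
    · obtain ⟨τ, hτ⟩ := (h.exists_phase hj).1
      exact ⟨τ, hτ.1, fun _ => hτ.2⟩
    · exact ⟨1, norm_one, fun h => absurd h hj⟩
  choose τ hτ1 hτ using hex
  -- The damping `1 - ε` keeps `q` away from the unit circle on the real line, where the square wave
  -- would have singularities. It is the source of the loss `O(ε)` in the main constant.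
  set q : ℤ → ℂ → ℂ := fun j z => ((1 - ε : ℝ) : ℂ) * τ j * Complex.exp (Complex.I * om * z) with hq
  have hqn : ∀ j z, ‖q j z‖ = (1 - ε) * exp (-(om * z.im)) := fun j z =>
    norm_mul_exp_I_mul (by linarith) (hτ1 j) om z
  have hqle : ∀ j z, 0 ≤ z.im → ‖q j z‖ ≤ 1 - ε := fun j z hz => by
    rw [hqn]
    exact mul_le_of_le_one_right (by linarith)
      (exp_le_one_iff.mpr (neg_nonpos.mpr (mul_nonneg hω hz)))
  set Gf : ℤ → ℂ → ℂ := fun j z => P x z * squareWave (q j z) with hGf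
  -- Down to depth `ε/(ω + 1)` one has `|q| < (1 - ε) e^ε ≤ 1`, so the square wave is analytic
  -- across the real line.
  have hy₀ : 0 < ε / (om + 1) := by positivity
  have hGd : ∀ j, DifferentiableOn ℂ (Gf j) {z | -(ε / (om + 1)) < z.im} := by
    intro j z hz
    simp only [Set.mem_ofPred_eq] at hz
    have hlt : ‖q j z‖ < 1 := by
      rw [hqn]
      have h1 : -(om * z.im) < ε := by
        have h2 : om * (ε / (om + 1)) < ε := by
          rw [mul_div_assoc', div_lt_iff₀ (by linarith)]; nlinarith
        nlinarith
      have h3 : 1 - ε ≤ exp (-ε) := by linarith [add_one_le_exp (-ε)]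
      calc (1 - ε) * exp (-(om * z.im)) < (1 - ε) * exp ε := by
            have : 0 < 1 - ε := by linarith
            gcongr
        _ ≤ exp (-ε) * exp ε := by gcongr
        _ = 1 := by rw [← exp_add]; simp
    have hqd : DifferentiableAt ℂ (q j) z := by rw [hq]; fun_prop
    exact ((hasDerivAt_P x z).differentiableAt.mul
      ((hasDerivAt_squareWave hlt).differentiableAt.comp z hqd)).differentiableWithinAt
  have hGc : ∀ j (c : ℝ), 0 ≤ c → Continuous fun t : ℝ => Gf j (t + c * Complex.I) := by
    intro j c hc
    refine (hGd j).continuousOn.comp_continuous (by fun_prop) fun t => ?_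
    simp only [Set.mem_ofPred_eq]
    simp
    linarith
  have hGr : ∀ j, Continuous fun t : ℝ => Gf j t := fun j => by
    simpa using hGc j 0 le_rfl
  have hM : ∀ j z, 0 ≤ z.im → ‖Gf j z‖ ≤ 4 / ε * (‖P x z‖ * exp (-(om * z.im))) := by
    intro j z hz
    have h1 := norm_squareWave_le (by linarith : 1 - ε < 1) (hqle j z hz)
    rw [hqn, sub_sub_cancel] at h1
    rw [hGf]
    simp only
    rw [norm_mul]
    calc _ ≤ ‖P x z‖ * (4 / ε * ((1 - ε) * exp (-(om * z.im)))) := by gcongr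
      _ ≤ ‖P x z‖ * (4 / ε * (1 * exp (-(om * z.im)))) := by gcongr; linarith
      _ = _ := by ring
  have hMr : ∀ j (t : ℝ), ‖Gf j t‖ ≤ 4 / ε * ‖P x t‖ := fun j t => by
    simpa using hM j t (by simp)
  -- Here the reality of `P` on the real line enters: only the real part of the square wave matters,
  -- and that is at most 1 in modulus.
  have hre : ∀ j (t : ℝ), (Gf j t).re ≤ ‖P x t‖ := by
    intro j t
    have h1 := abs_re_squareWave_le ((hqle j t (by simp)).trans_lt (by linarith))
    rw [hGf]
    simp only
    rw [P_ofReal, Complex.re_ofReal_mul, Complex.norm_real, norm_eq_abs]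
    refine (le_abs_self _).trans ?_
    rw [abs_mul]
    exact mul_le_of_le_one_right (abs_nonneg _) h1
  have hmain := h.sum_integral_re_le hφ (G := G) (fun j hj t ht => h.supp_of_ne_zero hj ht)
    (ν := volume.restrict (ball y r)) (w := fun t : ℝ => 4 / ε * ‖P x t‖)
    (((continuous_norm_P x).integrableOn_Icc).const_mul _)
    (fun t => by positivity)
    (F := fun j t => Gf j (t + η * Complex.I)) (g := fun j t => Gf j t)
    (fun j _ => hGc j η hη.le) (fun j _ => (hGr j).measurable)
    (fun j _ t => hMr j t)
    (e := 4 / ε * (60 + 16 * CL * log n) / (η * nodeMass x) * exp (-X))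
    (by
      have : 0 ≤ 60 + 16 * CL * log n := by linarith
      positivity)
    (fun j hj p hp => h.norm_sub_integral_le (by positivity) hy₀ (hGd j) (hM j) hp)
  rw [integral_const_mul] at hmain
  set A := ∑ j ∈ G, ∫ t, φ j t * ‖P x (t : ℝ)‖ with hA
  set F := ∑ j ∈ G, ∫ t, φ j t * (‖P x (t + η * Complex.I)‖ * exp (-(om * η))) with hF
  have hball : ∀ j ∈ G, ∀ t, t ∉ ball y r → φ j t = 0 := fun j hj t ht => by
    by_contra hc
    have h1 := abs_le.mp (h.supp_of_ne_zero hj hc)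
    have : (1 - 4 * ε) * r ≤ r := by nlinarith
    exact ht ⟨by linarith [h1.1], by linarith [h1.2]⟩
  have hsup : ∀ j, HasCompactSupport (φ j) := fun j =>
    HasCompactSupport.of_support_subset_isCompact isCompact_Icc (hφ.support_subset j)
  have hAj : ∀ j ∈ G, ∫ t, φ j t * ‖P x (t : ℝ)‖ = ∫ t in ball y r, φ j t * ‖P x (t : ℝ)‖ :=
    fun j hj => (setIntegral_eq_integral_of_forall_compl_eq_zero fun t ht => by
      rw [hball j hj t ht, zero_mul]).symm
  have hφP : ∀ j, Integrable fun t : ℝ => φ j t * ‖P x (t : ℝ)‖ := fun j =>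
    ((hφ.continuous j).mul (continuous_norm_P x)).integrable_of_hasCompactSupport
      (hsup j).mul_right
  have hright : ∑ j ∈ G, (∫ t in ball y r, (φ j t : ℂ) * Gf j t).re ≤ A := by
    refine Finset.sum_le_sum fun j hj => ?_
    have hi : Integrable (fun t : ℝ => (φ j t : ℂ) * Gf j t) (volume.restrict (ball y r)) :=
      (((Complex.continuous_ofReal.comp (hφ.continuous j)).mul (hGr j)).integrableOn_Icc)
    rw [hAj j hj, ← RCLike.re_eq_complex_re, ← integral_re hi]
    refine integral_mono hi.re (hφP j).integrableOn fun t => ?_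
    simp only [RCLike.re_eq_complex_re]
    rw [Complex.re_ofReal_mul]
    exact mul_le_mul_of_nonneg_left (hre j t) (hφ.nonneg j t)
  have hAle : A ≤ ∫ t in ball y r, ‖P x (t : ℝ)‖ := by
    rw [hA, Finset.sum_congr rfl hAj, ← integral_finsetSum _ fun j _ => (hφP j).integrableOn]
    refine integral_mono (integrable_finsetSum _ fun j _ => (hφP j).integrableOn)
      (continuous_norm_P x).integrableOn_Icc fun t => ?_
    simp only
    rw [← Finset.sum_mul]
    exact mul_le_of_le_one_left (norm_nonneg _) (hφ.sum_le_one G t)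
  have hπ4 : 4 / π ≤ 4 / 3 := by
    gcongr; exact pi_gt_three.le
  have hπ0 : 0 < 4 / π := by positivity
  have hπ1 : 1 ≤ 4 / π := by
    rw [le_div_iff₀ pi_pos]; linarith [pi_le_four]
  set c := 4 / π * (1 - ε) * (1 - 6 * lam) - 2 / ε * lam with hc
  have hleft : c * F ≤ ∑ j ∈ G, ∫ p, φ j p * (Gf j (p + η * Complex.I)).re := by
    rw [hF, Finset.mul_sum]
    refine Finset.sum_le_sum fun j hj => ?_
    rw [← integral_const_mul]
    refine integral_mono ?_ ?_ fun t => ?_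
    · refine (((hφ.continuous j).mul (Continuous.mul ?_ continuous_const))
        |>.integrable_of_hasCompactSupport (hsup j).mul_right).const_mul _
      exact ((continuous_P x).comp (by fun_prop)).norm
    · exact ((hφ.continuous j).mul (Complex.continuous_re.comp
        (hGc j η hη.le))).integrable_of_hasCompactSupport (hsup j).mul_right
    · simp only
      by_cases ht : t ∈ Set.Icc (s j) (s j + η / lam)
      · rw [mul_left_comm]
        refine mul_le_mul_of_nonneg_left ?_ (hφ.nonneg j t)
        set z : ℂ := t + η * Complex.I with hz
        have him : z.im = η := by simp [hz]
        have h1 := hτ j hj t ht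
        have hexp : ‖Complex.exp (Complex.I * om * z)‖ = exp (-(om * η)) := by
          rw [Complex.norm_exp]; simp [hz]
        rw [norm_mul, hexp] at h1
        have h2 := norm_squareWave_sub_le (by linarith : 1 - ε < 1)
          (hqle j z (by rw [him]; exact hη.le))
        rw [sub_sub_cancel, hqn, him] at h2
        -- The nonlinear part of the square wave is quadratic in `q`; the extra factor `e^{-ωη} ≤
        -- lam` makes it negligible at height `η`.
        have h3 : 2 / ε * ((1 - ε) * exp (-(om * η))) ^ 2 ≤ 2 / ε * (lam * exp (-(om * η))) := by
          gcongr
          calc ((1 - ε) * exp (-(om * η))) ^ 2 ≤ (1 * exp (-(om * η))) ^ 2 := by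
                have : 0 ≤ 1 - ε := by linarith
                gcongr; linarith
            _ = exp (-(om * η)) * exp (-(om * η)) := by ring
            _ ≤ _ := by gcongr; exact h.wave_small
        have e1 : Gf j z = ((4 / π * (1 - ε) : ℝ) : ℂ) *
            (τ j * (P x z * Complex.exp (Complex.I * om * z))) +
            P x z * (squareWave (q j z) - (4 / π : ℝ) * q j z) := by
          rw [hGf, hq]; push_cast; ring
        have h4 := Complex.re_le_norm (-(P x z * (squareWave (q j z) - (4 / π : ℝ) * q j z)))
        rw [norm_neg, norm_mul, Complex.neg_re] at h4
        have h5 := mul_le_mul_of_nonneg_left (h2.trans h3) (norm_nonneg (P x z))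
        have h6 := mul_le_mul_of_nonneg_left h1 (by nlinarith : 0 ≤ 4 / π * (1 - ε))
        rw [e1, Complex.add_re, Complex.re_ofReal_mul, hc]
        linarith
      · rw [hφ.eq_zero ht]; simp
  have hF0 : 0 ≤ F := Finset.sum_nonneg fun j _ => integral_nonneg fun t =>
    mul_nonneg (hφ.nonneg j t) (by positivity)
  have htc := h.transfer_const_le
  have hT0 : 0 ≤ (16 * π * N * Cφ + 1) * lam := by
    refine le_trans ?_ htc
    have := hφ.const_nonneg
    positivity
  have hCJ := h.CJ_nonneg
  have hK0 : 0 ≤ K := by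
    rw [hK]
    have h9 : 0 ≤ 16 * π * N * Cφ + 1 := nonneg_of_mul_nonneg_left hT0 hl
    positivity
  -- Here the error carries `1/nodeMass`, which is at most `P₀/r` by the normalisation bounds.
  have he : 4 / ε * (60 + 16 * CL * log n) / (η * nodeMass x) * exp (-X) ≤
      4 / ε * (P₀ x y r * lam) := by
    have h1 : 1 / nodeMass x ≤ P₀ x y r / r := by
      rw [div_le_div_iff₀ hS hr]; linarith
    have h60 : 0 ≤ 60 + 16 * CL * log n := by linarith
    have h2 : (60 + 16 * CL * log n) / (r * η) * exp (-X) ≤ lam := by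
      refine le_trans (mul_le_mul_of_nonneg_right ?_ (exp_pos _).le) h.small
      rw [div_le_div_iff₀ (by positivity) (by positivity)]
      have h3 : r * η ^ 2 ≤ r * η := by nlinarith [mul_pos hr hη]
      have h4 : 60 + 16 * CL * log n ≤ 100 + 10336 * CL * log n := by linarith
      exact mul_le_mul h4 h3 (by positivity) (by linarith)
    calc _ = 4 / ε * ((60 + 16 * CL * log n) / η * exp (-X) * (1 / nodeMass x)) := by
          field_simp
      _ ≤ 4 / ε * ((60 + 16 * CL * log n) / η * exp (-X) * (P₀ x y r / r)) := by gcongr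
      _ = 4 / ε * (P₀ x y r * ((60 + 16 * CL * log n) / (r * η) * exp (-X))) := by field_simp
      _ ≤ _ := by gcongr
  have hineq : c * F ≤ A + K * lam * r * P₀ x y r := by
    have h1 := hleft.trans hmain
    have hI0 : 0 ≤ ∫ t in ball y r, ‖P x (t : ℝ)‖ := integral_nonneg fun t => norm_nonneg _
    have h2 := mul_le_mul_of_nonneg_right htc
      (mul_nonneg (by positivity : 0 ≤ 4 / ε) hI0)
    have h3 := mul_le_mul_of_nonneg_left hA1
      (mul_nonneg hT0 (by positivity : 0 ≤ 4 / ε))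
    have h4 := mul_le_mul_of_nonneg_right he (by positivity : 0 ≤ 2 * r)
    have e : K * lam * r * P₀ x y r = (16 * π * N * Cφ + 1) * lam * (4 / ε) *
        (4 * CJ * r * P₀ x y r) + 4 / ε * (P₀ x y r * lam) * (2 * r) := by
      rw [hK]; ring
    rw [e]
    linarith
  have hsm := h.lam_small
  have hθ0 : 0 ≤ (8 + 2 / ε) * lam := by positivity
  -- `8 lam` bounds the loss `6 lam · 4/π` from phase alignment, and `(2/ε) lam` is the
  -- nonlinearity. Since `c ≥ 1/2`, the a priori bound for `F` makes these losses additive.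
  have hcθ : 4 / π * (1 - ε) - (8 + 2 / ε) * lam ≤ c := by
    have h1 : 4 / π * (1 - ε) ≤ 4 / 3 := by nlinarith
    have h2 := mul_le_mul_of_nonneg_right h1 (by positivity : 0 ≤ 6 * lam)
    rw [hc]
    linarith
  have hc2 : 1 / 2 ≤ c := by nlinarith
  have hA2' : A ≤ 4 * CJ * r * P₀ x y r := hAle.trans hA1
  have hFle : F ≤ 2 * ((4 * CJ + K) * r * P₀ x y r) := by
    have h1 : K * lam * r * P₀ x y r ≤ K * 1 * r * P₀ x y r := by
      gcongr; exact h.lam_le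
    nlinarith
  have h7 := mul_le_mul_of_nonneg_left hFle hθ0
  have h8 := mul_le_mul_of_nonneg_right hcθ hF0
  have e : (K + (16 + 4 / ε) * (4 * CJ + K)) * lam * r * P₀ x y r = K * lam * r * P₀ x y r +
      (8 + 2 / ε) * lam * (2 * ((4 * CJ + K) * r * P₀ x y r)) := by ring
  rw [e]
  linarith

end WaveConfig

/-! ### Choice of the scales. -/

/-- How large `n ^ (ε ^ 3 / 2)` has to be, relative to `1 + log n`, for the scales to separate. -/
noncomputable def scaleConst (δ CL ε : ℝ) : ℝ :=
  2 / δ + 10800 / δ ^ 2 +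
    800 * (18 * (2 * NodeConfig.waveConst δ CL + NodeConfig.waveConst δ CL ^ 2) + 15) +
    (2 / δ ^ 2 * NodeConfig.potConst δ CL + 16 + (3 + (8 * π + 2 * CL) / (2 * δ))) * (16 / δ ^ 2) +
    3 / ε ^ 2 + 2 * (100 + 10336 * CL)

set_option maxHeartbeats 1000000 in
-- Everything is measured against `v = n^{ε³/2}`, which beats any constant multiple of `log n`. With
-- `H = n^{ε/2 - 1}`, the given range of `η` from `v/n` to `v²/n` yields `H/η ≥ v`, `ωη ≫ v` and
-- `H/η ≤ n^{ε/2}/v`, the last far below `ωH`. The choice `X = 10 log n` makes `e^{-X}` a power of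
-- `n` small enough to absorb all polynomial losses.
theorem scaleConfig_of_large {n : ℕ} {x : Fin n → ℝ} {a b y δ CL r ε η : ℝ}
    (h : NodeConfig x a b y δ CL) (hε : 0 < ε) (hε1 : ε < 1 / 4)
    (hlarge : scaleConst δ CL ε * (1 + log n) ≤ (n : ℝ) ^ (ε ^ 3 / 2))
    (hr1 : (n : ℝ) ^ (ε - 1) ≤ 2 * r) (hr2 : 2 * r ≤ (n : ℝ) ^ (-ε))
    (hη1 : (n : ℝ) ^ (ε ^ 3 / 2 - 1) ≤ η) (hη2 : η ≤ (n : ℝ) ^ (ε ^ 3 - 1)) :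
    ScaleConfig x a b y δ CL r ε η ((n : ℝ) ^ (ε / 2 - 1))
      (NodeConfig.waveConst δ CL * (2 + log n) + NodeConfig.waveConst δ CL ^ 2) (10 * log n) ∧
    (100 + 10336 * CL * log n) / (r * η ^ 2) * exp (-(10 * log n)) ≤ 1 / log n ∧
    exp (-(freq x a b y * η)) ≤ 1 / log n := by
  have hδ := h.δ_pos
  have hCL := h.CL_nonneg
  have hpc := h.potConst_pos
  have hl := h.one_le_log
  have hn : (0 : ℝ) < n := by exact_mod_cast h.pos
  have hn1 : (1 : ℝ) ≤ n := by exact_mod_cast h.pos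
  have hln := h.log_le
  set W := NodeConfig.waveConst δ CL with hW
  have hW0 : 0 ≤ W := by rw [hW, NodeConfig.waveConst]; positivity
  set l := log n with hl_def
  set v := (n : ℝ) ^ (ε ^ 3 / 2) with hv
  set B := 2 / δ ^ 2 * NodeConfig.potConst δ CL with hB
  set A := 3 + (8 * π + 2 * CL) / (2 * δ) with hA
  have hB0 : 0 ≤ B := by rw [hB]; positivity
  have hA0 : 0 ≤ A := by rw [hA]; positivity
  have hexp : scaleConst δ CL ε = 2 / δ + 10800 / δ ^ 2 + 800 * (18 * (2 * W + W ^ 2) + 15) +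
    (B + 16 + A) * (16 / δ ^ 2) + 3 / ε ^ 2 + 2 * (100 + 10336 * CL) := rfl
  rw [hexp] at hlarge
  clear hexp
  have hω1' : n / 300 - 9 / δ ^ 2 * l ≤ freq x a b y := h.le_freq
  have hω2 : freq x a b y ≤ B * n := (le_abs_self _).trans h.freq_le
  clear_value l v B A W
  have t1 : 0 ≤ 2 / δ := by positivity
  have t2 : 0 ≤ 10800 / δ ^ 2 := by positivity
  have t3 : 0 ≤ 800 * (18 * (2 * W + W ^ 2) + 15) := by positivity
  have t4 : 0 ≤ (B + 16 + A) * (16 / δ ^ 2) := by positivity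
  have t5 : 0 ≤ 3 / ε ^ 2 := by positivity
  have t6 : 0 ≤ 2 * (100 + 10336 * CL) := by positivity
  have hl1 : 0 ≤ 1 + l := by linarith
  have c1 : 2 / δ ≤ v := by
    refine le_trans ?_ hlarge
    calc 2 / δ ≤ 2 / δ * (1 + l) := le_mul_of_one_le_right t1 (by linarith)
      _ ≤ _ := by gcongr; linarith
  have c2 : 10800 / δ ^ 2 * l ≤ v := by
    refine le_trans ?_ hlarge
    exact mul_le_mul (by linarith) (by linarith) (by linarith) (by linarith)
  have c3 : 800 * (18 * (2 * W + W ^ 2) + 15) * (1 + l) ≤ v := by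
    refine le_trans ?_ hlarge
    gcongr; linarith
  have c4 : (B + 16 + A) * (16 / δ ^ 2) ≤ v := by
    refine le_trans ?_ hlarge
    refine (le_mul_of_one_le_right t4 (by linarith : 1 ≤ 1 + l)).trans ?_
    gcongr; linarith
  have c5 : 3 / ε ^ 2 * l ≤ v := by
    refine le_trans ?_ hlarge
    exact mul_le_mul (by linarith) (by linarith) (by linarith) (by linarith)
  have c6 : 2 * (100 + 10336 * CL) * l ≤ v := by
    refine le_trans ?_ hlarge
    exact mul_le_mul (by linarith) (by linarith) (by linarith) (by linarith)
  have c3' : 12000 * (1 + l) ≤ v := by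
    refine le_trans ?_ c3
    gcongr
    linarith [sq_nonneg W]
  have hv0 : 0 < v := by linarith
  have hε3 : ε ^ 3 ≤ ε / 16 := by
    calc ε ^ 3 = ε * (ε * ε) := by ring
      _ ≤ ε * (1 / 4 * (1 / 4)) := by gcongr
      _ = ε / 16 := by ring
  have hε3p : 0 < ε ^ 3 := by positivity
  have hmono : ∀ {p q : ℝ}, p ≤ q → (n : ℝ) ^ p ≤ (n : ℝ) ^ q := fun hpq =>
    rpow_le_rpow_of_exponent_le hn1 hpq
  have hone : ∀ {p : ℝ}, p ≤ 0 → (n : ℝ) ^ p ≤ 1 := fun hp =>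
    rpow_le_one_of_one_le_of_nonpos hn1 hp
  set H := (n : ℝ) ^ (ε / 2 - 1) with hHd
  have hH0 : 0 < H := by positivity
  clear_value H
  have hη0 : 0 < η := lt_of_lt_of_le (by positivity) hη1
  have hr0 : 0 < r := by
    have : 0 < (n : ℝ) ^ (ε - 1) := by positivity
    linarith
  have hnH : n * H = (n : ℝ) ^ (ε / 2) := by
    rw [hHd, rpow_sub_one hn.ne']; field_simp
  have hH1 : H ≤ 1 := by rw [hHd]; exact hone (by linarith)
  have hvu : v * 800 ≤ (n : ℝ) ^ (ε / 2) := by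
    calc v * 800 ≤ v * v := mul_le_mul_of_nonneg_left (by linarith) hv0.le
      _ = (n : ℝ) ^ (ε ^ 3) := by rw [hv, ← rpow_add hn]; ring_nf
      _ ≤ _ := hmono (by linarith)
  have hvn : v ≤ n := by
    calc v ≤ (n : ℝ) ^ (1 : ℝ) := by rw [hv]; exact hmono (by linarith)
      _ = n := rpow_one _
  have hvvn : v * v ≤ n := by
    calc v * v = (n : ℝ) ^ (ε ^ 3) := by rw [hv, ← rpow_add hn]; ring_nf
      _ ≤ (n : ℝ) ^ (1 : ℝ) := hmono (by linarith)
      _ = n := rpow_one _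
  -- The logarithmic loss is at most `n/1200`, and `1/300 - 1/1200 = 1/400`.
  have hω1 : (n : ℝ) / 400 ≤ freq x a b y := by
    have h2 : 9 / δ ^ 2 * l ≤ n / 1200 := by
      have : 10800 / δ ^ 2 * l = 1200 * (9 / δ ^ 2 * l) := by ring
      linarith
    linarith
  have hω0 : 0 ≤ freq x a b y := le_trans (by positivity) hω1
  have hHη1 : v ≤ H / η := by
    rw [le_div_iff₀ hη0]
    calc v * η ≤ v * (n : ℝ) ^ (ε ^ 3 - 1) := by gcongr
      _ = (n : ℝ) ^ (ε ^ 3 / 2 + (ε ^ 3 - 1)) := by rw [hv, ← rpow_add hn]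
      _ ≤ H := by rw [hHd]; exact hmono (by linarith)
  have hHη2 : H / η * v ≤ (n : ℝ) ^ (ε / 2) := by
    rw [div_mul_eq_mul_div, div_le_iff₀ hη0]
    calc H * v = (n : ℝ) ^ (ε / 2) * (n : ℝ) ^ (ε ^ 3 / 2 - 1) := by
          rw [hHd, hv, ← rpow_add hn, ← rpow_add hn]; ring_nf
      _ ≤ _ := by gcongr
  have hHη0 : 0 ≤ H / η := by positivity
  have hωη : v / 400 ≤ freq x a b y * η := by
    calc v / 400 = n / 400 * (n : ℝ) ^ (ε ^ 3 / 2 - 1) := by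
          rw [hv, rpow_sub_one hn.ne']; field_simp
      _ ≤ _ := by gcongr
  have hωH : (n : ℝ) ^ (ε / 2) / 400 ≤ freq x a b y * H := by
    rw [← hnH]
    calc n * H / 400 = n / 400 * H := by ring
      _ ≤ _ := by gcongr
  have hun : (n : ℝ) ^ (ε / 2) ≤ n := by
    calc (n : ℝ) ^ (ε / 2) ≤ (n : ℝ) ^ (1 : ℝ) := hmono (by linarith)
      _ = n := rpow_one _
  have hEb : 800 * (18 * (W * (2 + l) + W ^ 2) + 5 + 10 * l) ≤ v := by
    refine le_trans ?_ c3
    have p0 : 0 ≤ l := by linarith only [hl]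
    have p1 := mul_nonneg hW0 p0
    have p2 := mul_nonneg (sq_nonneg W) p0
    linarith only [p0, p1, p2]
  have hE0 : 0 ≤ W * (2 + l) + W ^ 2 := by positivity
  refine ⟨?_, ?_, ?_⟩
  · refine
      { toNodeConfig := h
        ε_pos := hε
        ε_lt := hε1
        r_pos := hr0
        r_le := ?_
        H_le_r := ?_
        le_H := ?_
        le_η := ?_
        η_le := ?_
        H_le := hH1
        X_nonneg := by linarith
        freq_nonneg := hω0
        le_E := ?_
        top := ?_
        bottom := ?_
        interior := ?_
        outer := ?_
        gauss := ?_ }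
    · have h1 : (n : ℝ) ^ (-ε) ≤ δ / 2 := by
        rw [rpow_neg hn.le]
        refine inv_le_of_inv_le₀ (by positivity) ?_
        calc (δ / 2)⁻¹ = 2 / δ := by rw [inv_div]
          _ ≤ v := c1
          _ ≤ _ := by rw [hv]; exact hmono (by linarith)
      linarith
    · have h1 : 8 * H ≤ (n : ℝ) ^ (ε - 1) := by
        calc 8 * H ≤ (n : ℝ) ^ (ε / 2) * H := by gcongr; linarith
          _ = (n : ℝ) ^ (ε - 1) := by rw [hHd, ← rpow_add hn]; ring_nf
      linarith
    · rw [div_le_iff₀ hn, mul_comm, hnH]; linarith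
    · refine le_trans ?_ hη1
      rw [one_div, ← rpow_neg_one]
      exact hmono (by linarith)
    · rw [le_div_iff₀ hη0] at hHη1
      exact (mul_le_mul_of_nonneg_right (by linarith only [c3', hl]) hη0.le).trans hHη1
    · rw [← hW, ← hl_def]
      have d1 : n * H * r ≤ 1 := by
        rw [hnH]
        calc (n : ℝ) ^ (ε / 2) * r ≤ (n : ℝ) ^ (ε / 2) * (n : ℝ) ^ (-ε) := by gcongr; linarith
          _ = (n : ℝ) ^ (ε / 2 + -ε) := (rpow_add hn _ _).symm
          _ ≤ 1 := hone (by linarith)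
      have d2 : n * H ^ 2 ≤ 1 := by
        calc n * H ^ 2 = (n * H) * H := by ring
          _ = (n : ℝ) ^ (ε / 2 + (ε / 2 - 1)) := by rw [hnH, hHd, ← rpow_add hn]
          _ ≤ 1 := hone (by linarith)
      have d3 : n * H ^ 3 ≤ 1 := by
        calc n * H ^ 3 = n * H ^ 2 * H := by ring
          _ ≤ 1 * 1 := by gcongr
          _ = 1 := one_mul 1
      have d4 : W * n * H ^ 2 ≤ W := by
        rw [mul_assoc]; exact mul_le_of_le_one_right hW0 d2
      have d5 : (W * n * H ^ 2) ^ 2 ≤ W ^ 2 := by gcongr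
      have d6 : W * (n * H * r + n * H ^ 3 + l) ≤ W * (2 + l) := by gcongr; linarith
      linarith only [d5, d6, sq_nonneg W]
    · linarith
    -- `ωH ≥ n^{ε/2}/400` is shared equally between `H/η` and the remaining terms.
    · have h1 : H / η ≤ (n : ℝ) ^ (ε / 2) / 800 := by
        rw [le_div_iff₀ (by norm_num)]
        refine le_trans ?_ hHη2
        gcongr
        linarith
      have h2 : 18 * (W * (2 + l) + W ^ 2) + 5 + 10 * l ≤ (n : ℝ) ^ (ε / 2) / 800 := by
        linarith
      linarith
    · linarith
    · rw [← hA]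
      have e1 : freq x a b y * H ≤ B * n := by
        calc freq x a b y * H ≤ freq x a b y * 1 := by gcongr
          _ ≤ _ := by rw [mul_one]; exact hω2
      have e2 : H / η ≤ n := by
        refine le_trans ?_ (hHη2.trans hun)
        exact le_mul_of_one_le_right hHη0 (by linarith)
      have e3 : (B + 16 + A) * n ≤ δ ^ 2 / (16 * H ^ 2) := by
        rw [le_div_iff₀ (by positivity)]
        have e4 : n * H ^ 2 * v ≤ 1 := by
          calc n * H ^ 2 * v = (n * H) * H * v := by ring
            _ = (n : ℝ) ^ (ε / 2 + (ε / 2 - 1) + ε ^ 3 / 2) := by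
                rw [hnH, hHd, hv, ← rpow_add hn, ← rpow_add hn]
            _ ≤ 1 := hone (by linarith)
        have e5 : n * H ^ 2 * ((B + 16 + A) * (16 / δ ^ 2)) ≤ 1 :=
          le_trans (by gcongr) e4
        calc (B + 16 + A) * n * (16 * H ^ 2)
            = n * H ^ 2 * ((B + 16 + A) * (16 / δ ^ 2)) * δ ^ 2 := by field_simp
          _ ≤ 1 * δ ^ 2 := by gcongr
          _ = _ := one_mul _
      have e6 : l ≤ n := hln
      linarith
    · rw [le_div_iff₀ (by positivity)]
      have g1 : (n : ℝ) ^ (ε / 2) * H ≤ 2 * r := by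
        refine le_trans (le_of_eq ?_) hr1
        rw [hHd, ← rpow_add hn]; ring_nf
      have g2 : v * H ^ 2 ≤ 4 * r ^ 2 := by
        calc v * H ^ 2 ≤ (n : ℝ) ^ (ε / 2) * (n : ℝ) ^ (ε / 2) * H ^ 2 := by
              gcongr
              have : v ≤ (n : ℝ) ^ (ε / 2) := by linarith only [hvu, hv0]
              exact this.trans (le_mul_of_one_le_left (by positivity) (by linarith only [this, c3', hl]))
          _ = ((n : ℝ) ^ (ε / 2) * H) ^ 2 := by ring
          _ ≤ (2 * r) ^ 2 := by gcongr
          _ = _ := by ring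
      have g3 : 3 * l ≤ ε ^ 2 * v := by
        rw [div_mul_eq_mul_div, div_le_iff₀ (by positivity)] at c5
        linarith
      calc 10 * l * H ^ 2 ≤ 4 * (ε ^ 2 * v) * H ^ 2 :=
            mul_le_mul_of_nonneg_right (by linarith) (sq_nonneg H)
        _ = 4 * ε ^ 2 * (v * H ^ 2) := by ring
        _ ≤ 4 * ε ^ 2 * (4 * r ^ 2) := by gcongr
        _ = _ := by ring
  · have hl0 : 0 < l := by linarith
    have f1 : exp (-(10 * l)) = 1 / (n : ℝ) ^ 10 := by
      rw [exp_neg, hl_def, mul_comm, exp_mul, exp_log hn, one_div]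
      norm_cast
    have f2 : 1 / (2 * (n : ℝ)) ≤ r := by
      have : 1 / (n : ℝ) ≤ (n : ℝ) ^ (ε - 1) := by
        rw [one_div, ← rpow_neg_one]; exact hmono (by linarith)
      have e : 1 / (2 * (n : ℝ)) = 1 / n / 2 := by field_simp
      linarith
    have f3 : 1 / (n : ℝ) ≤ η := by
      refine le_trans ?_ hη1
      rw [one_div, ← rpow_neg_one]; exact hmono (by linarith)
    have f4 : 1 / (2 * (n : ℝ) ^ 3) ≤ r * η ^ 2 := by
      calc 1 / (2 * (n : ℝ) ^ 3) = 1 / (2 * n) * (1 / n) ^ 2 := by field_simp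
        _ ≤ _ := by gcongr
    have f5 : 2 * (100 + 10336 * CL * l) * l ≤ n := by
      calc 2 * (100 + 10336 * CL * l) * l ≤ 2 * (100 + 10336 * CL) * l * l := by
            have : 2 * (100 + 10336 * CL * l) ≤ 2 * (100 + 10336 * CL) * l := by linarith only [hl]
            gcongr
        _ ≤ v * v := by
            gcongr
            linarith
        _ ≤ n := hvvn
    have f0 : 0 ≤ 100 + 10336 * CL * l := by positivity
    calc _ ≤ (100 + 10336 * CL * l) / (1 / (2 * (n : ℝ) ^ 3)) * exp (-(10 * l)) := by
          gcongr
      _ = 2 * (100 + 10336 * CL * l) / (n : ℝ) ^ 7 := by rw [f1]; field_simp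
      _ ≤ 2 * (100 + 10336 * CL * l) / n := by
          gcongr
          exact le_self_pow₀ hn1 (by norm_num)
      _ ≤ 1 / l := by
          rw [div_le_div_iff₀ hn hl0]; linarith
  · have hl0 : 0 < l := by linarith
    calc exp (-(freq x a b y * η)) ≤ exp (-l) := by gcongr; linarith
      _ = 1 / n := by rw [exp_neg, hl_def, exp_log hn, one_div]
      _ ≤ 1 / l := by gcongr

theorem eventually_large (Λ M β : ℝ) (hβ : 0 < β) :
    ∃ n₀ : ℕ, ∀ n : ℕ, n₀ ≤ n → 3 ≤ n ∧ Λ * (1 + log n) ≤ (n : ℝ) ^ β ∧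
      M ≤ log n ^ (1 / 6 : ℝ) := by
  have h1 : (fun t : ℝ => Λ * (1 + log t)) =o[Filter.atTop] fun t => t ^ β := by
    refine Asymptotics.IsLittleO.const_mul_left ?_ _
    refine Asymptotics.IsLittleO.add ?_ (isLittleO_log_rpow_atTop hβ)
    exact Asymptotics.isLittleO_const_left.mpr
      (Or.inr (tendsto_norm_atTop_atTop.comp (tendsto_rpow_atTop hβ)))
  have h2 := (h1.bound (c := 1) one_pos)
  have h3 := ((tendsto_rpow_atTop (by norm_num : (0 : ℝ) < 1 / 6)).comp
    tendsto_log_atTop).eventually_ge_atTop M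
  have h4 := (tendsto_natCast_atTop_atTop (R := ℝ)).eventually (h2.and h3)
  obtain ⟨n₀, hn₀⟩ := Filter.eventually_atTop.mp (h4.and (Filter.eventually_ge_atTop 3))
  refine ⟨n₀, fun n hn => ?_⟩
  obtain ⟨⟨h5, h6⟩, h7⟩ := hn₀ n hn
  refine ⟨h7, ?_, h6⟩
  rw [one_mul, norm_eq_abs, norm_eq_abs, abs_of_nonneg (by positivity : (0 : ℝ) ≤ (n : ℝ) ^ β)] at h5
  exact (le_abs_self _).trans h5

/-- The choice `lam = log^{-1/6} n` matches both hypotheses on good indices: the interval length is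
`η/lam` and the defect `1/(η log^{1/3} n)` is `lam²/η`. -/
theorem waveConfig_of_large {n : ℕ} {x : Fin n → ℝ} {a b y δ CL r ε η CJ Cη Cφ : ℝ} {N : ℕ}
    (h : NodeConfig x a b y δ CL) (hx : StrictMono x) (hε : 0 < ε) (hε1 : ε < 1 / 4)
    (hlarge : scaleConst δ CL ε * (1 + log n) ≤ (n : ℝ) ^ (ε ^ 3 / 2))
    (hlog : 4 * (8 + 2 / ε) ≤ log n ^ (1 / 6 : ℝ))
    (hr1 : (n : ℝ) ^ (ε - 1) ≤ 2 * r) (hr2 : 2 * r ≤ (n : ℝ) ^ (-ε))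
    (hloc : localIntegral x y r ≤ CJ * (2 * r) ^ 2) (hη : IsGoodOrdinate x a b y r ε Cη η)
    {φ : ℤ → ℝ → ℝ} {s : ℤ → ℝ} (hφ : IsBumpPartition φ s (η * log n ^ (1 / 6 : ℝ)) Cφ N) :
    ∃ G : Finset ℤ, (G : Set ℤ) = goodIndices x a b y r ε η s (η * log n ^ (1 / 6 : ℝ)) ∧
    WaveConfig x a b y δ CL r ε η ((n : ℝ) ^ (ε / 2 - 1))
      (NodeConfig.waveConst δ CL * (2 + log n) + NodeConfig.waveConst δ CL ^ 2) (10 * log n)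
      (log n ^ (-(1 / 6) : ℝ)) φ s Cφ N CJ G := by
  obtain ⟨h1, h2, h3⟩ := scaleConfig_of_large h hε hε1 hlarge hr1 hr2 hη.lower hη.upper
  have hl := h.one_le_log
  have hl0 : 0 < log n := by linarith
  have hη0 := h1.η_pos
  have hlam : 0 < log n ^ (-(1 / 6) : ℝ) := by positivity
  have hlam1 : log n ^ (-(1 / 6) : ℝ) = (log n ^ (1 / 6 : ℝ))⁻¹ := rpow_neg hl0.le _
  have hL : η / log n ^ (-(1 / 6) : ℝ) = η * log n ^ (1 / 6 : ℝ) := by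
    rw [hlam1, div_inv_eq_mul]
  have hle : 1 / log n ≤ log n ^ (-(1 / 6) : ℝ) := by
    rw [one_div, ← rpow_neg_one]
    exact rpow_le_rpow_of_exponent_le hl (by norm_num)
  have hint : ∀ j ∈ goodIndices x a b y r ε η s (η * log n ^ (1 / 6 : ℝ)),
      Set.Icc (s j) (s j + η * log n ^ (1 / 6 : ℝ)) ⊆
        Set.Icc (y - (1 - 4 * ε) * r) (y + (1 - 4 * ε) * r) := fun j hj =>
    hj.1.trans interior_subset
  have hfin := hφ.finite_of_subset (by positivity) hint
  have hφ' : IsBumpPartition φ s (η / log n ^ (-(1 / 6) : ℝ)) Cφ N := by rw [hL]; exact hφ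
  refine ⟨hfin.toFinset, hfin.coe_toFinset, ⟨h1, hx, hloc, hlam, ?_, ?_, h2.trans hle,
    h3.trans hle, hφ', ?_, ?_⟩⟩
  · exact rpow_le_one_of_one_le_of_nonpos hl (by norm_num)
  · rw [hlam1, ← div_eq_mul_inv, div_le_iff₀ (by positivity)]
    linarith
  · intro j hj t ht
    rw [hL] at ht
    have := hint j (hfin.mem_toFinset.mp hj) ht
    rw [abs_le]
    constructor <;> linarith [this.1, this.2]
  · intro j hj t ht
    rw [hL] at ht
    refine ((hfin.mem_toFinset.mp hj).2 t ht).le.trans (le_of_eq ?_)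
    rw [← rpow_natCast, ← rpow_mul hl0.le, one_div, mul_inv, ← rpow_neg hl0.le, mul_comm,
      ← div_eq_mul_inv]
    norm_num

end LebesgueInterp

theorem mainTheorem9
    -- `I₀ = [a, b] ⊆ [-1, 1]` and `I₁ = [c, d]` in the interior of `I₀`
    (a b c d : ℝ) (ha : -1 ≤ a) (hac : a < c) (hcd : c < d) (hdb : d < b) (hb : b ≤ 1)
    -- the implied constants in the standing bounds
    (CL CJ Cφ : ℝ) (N : ℕ) :
    ∃ C ε₀ : ℝ, 0 < ε₀ ∧ ∀ ε : ℝ, 0 < ε → ε < ε₀ → ∀ Cη : ℝ,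
    ∃ (Cε : ℝ) (n₀ : ℕ), ∀ n : ℕ, n₀ ≤ n →
    ∀ x : Fin n → ℝ, StrictMono x → (∀ i, x i ∈ Set.Icc (-1 : ℝ) 1) →
    (∫ t in Set.Icc a b, LebesgueInterp.lebesgueFun x t) ≤ CL * Real.log n →
    -- `J₀ = [y - r, y + r]`
    ∀ y r : ℝ, y ∈ Set.Icc c d → (n : ℝ) ^ (ε - 1) ≤ 2 * r → 2 * r ≤ (n : ℝ) ^ (-ε) →
    LebesgueInterp.localIntegral x y r ≤ CJ * (2 * r) ^ 2 →
    ∀ η : ℝ, LebesgueInterp.IsGoodOrdinate x a b y r ε Cη η →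
    ∀ (φ : ℤ → ℝ → ℝ) (s : ℤ → ℝ),
    LebesgueInterp.IsBumpPartition φ s (η * Real.log n ^ (1 / 6 : ℝ)) Cφ N →
    ∀ G : Set ℤ,
    G = LebesgueInterp.goodIndices x a b y r ε η s (η * Real.log n ^ (1 / 6 : ℝ)) →
    G.Finite ∧
    (4 - C * ε) / Real.pi *
        (∫ t : ℝ, ‖LebesgueInterp.P x (t + η * Complex.I)‖ /
          (LebesgueInterp.P₀ x y r *
            Real.exp (Real.pi * n * η * LebesgueInterp.rho x a b y)) * ∑ᶠ j ∈ G, φ j t)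
        - Cε * (2 * r) * Real.log n ^ (-(1 / 6) : ℝ)
      ≤ ∑ᶠ j ∈ G, ∫ t : ℝ, ‖LebesgueInterp.P x t‖ / LebesgueInterp.P₀ x y r * φ j t ∧
    1 / (2 * Real.pi) *
        (∫ t : ℝ, Real.exp (Real.pi * n * η * LebesgueInterp.rho x a b y) *
          LebesgueInterp.P₀ x y r / ‖LebesgueInterp.P x (t + η * Complex.I)‖ *
          ∑ᶠ j ∈ G, φ j t)
        - Cε * (2 * r) * Real.log n ^ (-(1 / 6) : ℝ)
      ≤ ∑ᶠ j ∈ G, ∑ k : Fin n,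
          LebesgueInterp.P₀ x y r / ‖LebesgueInterp.P' x (x k)‖ * φ j (x k) := by
  set δ := min (c - a) (b - d) with hδ
  -- `C = 4` since the square wave gives exactly `(4/π)(1 - ε)`. The bound `ε < 1/4` keeps `J₄`
  -- nondegenerate.
  refine ⟨4, 1 / 4, by norm_num, fun ε hε hε1 Cη => ?_⟩
  set K₁ := (16 * Real.pi * N * Cφ + 1) * (16 * CJ / ε) + 8 / ε with hK₁
  set K₂ := (16 * Real.pi * N * Cφ + 1) * (96 * Real.pi * CJ) + 2 with hK₂
  set M₁ := K₁ + (16 + 4 / ε) * (4 * CJ + K₁) with hM₁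
  set M₂ := K₂ + 12 * (96 * Real.pi * CJ + K₂) with hM₂
  -- `max CL 0` supplies the nonnegativity that the configuration requires, whatever the sign of
  -- `CL`.
  obtain ⟨n₀, hn₀⟩ := LebesgueInterp.eventually_large
    (LebesgueInterp.scaleConst δ (max CL 0) ε) (4 * (8 + 2 / ε)) (ε ^ 3 / 2) (by positivity)
  refine ⟨|M₁| + |M₂|, n₀, ?_⟩
  intro n hn x hx hx1 hL y r hy hr1 hr2 hloc η hη φ s hφ G hG
  obtain ⟨hn3, hlarge, hlog⟩ := hn₀ n hn
  have hlog0 : 0 ≤ Real.log n := Real.log_natCast_nonneg n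
  have hcfg : LebesgueInterp.NodeConfig x a b y δ (max CL 0) :=
    { three_le := hn3, inj := hx.injective, mem := hx1, ha := ha, hb := hb
      δ_pos := lt_min (by linarith) (by linarith)
      left := by linarith [min_le_left (c - a) (b - d), hy.1]
      right := by linarith [min_le_right (c - a) (b - d), hy.2]
      CL_nonneg := le_max_right _ _
      lebesgue := hL.trans (mul_le_mul_of_nonneg_right (le_max_left _ _) hlog0) }
  obtain ⟨F, hF, h⟩ := LebesgueInterp.waveConfig_of_large hcfg hx hε hε1 hlarge hlog hr1 hr2 hloc
    hη hφ
  have hGF : G = F := hG.trans hF.symm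
  subst hGF
  have hP0 := (h.normalisation hx hloc).1
  have hr := h.r_pos
  have hlam := h.lam_pos
  have hη0 := h.η_pos
  have hpi := Real.pi_pos
  have hfreq : Real.pi * n * η * LebesgueInterp.rho x a b y = LebesgueInterp.freq x a b y * η := by
    rw [LebesgueInterp.freq]; ring
  have hcomp : ∀ j, HasCompactSupport (φ j) := fun j =>
    HasCompactSupport.of_support_subset_isCompact isCompact_Icc (hφ.support_subset j)
  have hcont : Continuous fun t : ℝ => ‖LebesgueInterp.P x (t + η * Complex.I)‖ :=
    ((LebesgueInterp.continuous_P x).comp (by fun_prop)).norm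
  have hPne : ∀ t : ℝ, ‖LebesgueInterp.P x (t + η * Complex.I)‖ ≠ 0 := fun t =>
    norm_ne_zero_iff.mpr (LebesgueInterp.P_ne_zero
      (LebesgueInterp.ne_node_of_im_ne_zero (by simpa using hη0.ne')))
  have hswap : ∀ g : ℝ → ℝ, Continuous g →
      ∫ t, g t * ∑ j ∈ F, φ j t = ∑ j ∈ F, ∫ t, φ j t * g t := by
    intro g hg
    have hi : ∀ j ∈ F, Integrable fun t => φ j t * g t := fun j _ =>
      ((hφ.continuous j).mul hg).integrable_of_hasCompactSupport (hcomp j).mul_right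
    rw [← integral_finsetSum _ hi]
    simp_rw [← Finset.sum_mul, mul_comm]
  have hbound : ∀ M : ℝ, M ≤ |M₁| + |M₂| →
      M * Real.log n ^ (-(1 / 6) : ℝ) * r ≤
        (|M₁| + |M₂|) * (2 * r) * Real.log n ^ (-(1 / 6) : ℝ) := by
    intro M hM
    have h1 : 0 ≤ |M₁| + |M₂| := by positivity
    calc M * Real.log n ^ (-(1 / 6) : ℝ) * r
        ≤ (|M₁| + |M₂|) * Real.log n ^ (-(1 / 6) : ℝ) * r := by gcongr
      _ ≤ (|M₁| + |M₂|) * Real.log n ^ (-(1 / 6) : ℝ) * (2 * r) := by gcongr; linarith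
      _ = _ := by ring
  simp_rw [finsum_mem_coe_finset, hfreq]
  refine ⟨F.finite_toSet, ?_, ?_⟩
  · have h1 := h.real_integral_ge hK₁
    rw [hswap (fun t => ‖LebesgueInterp.P x (t + η * Complex.I)‖ / (LebesgueInterp.P₀ x y r *
      Real.exp (LebesgueInterp.freq x a b y * η))) (hcont.div_const _)]
    have e1 : ∀ j, ∫ t : ℝ, φ j t * (‖LebesgueInterp.P x (t + η * Complex.I)‖ /
        (LebesgueInterp.P₀ x y r * Real.exp (LebesgueInterp.freq x a b y * η))) =
        (∫ t : ℝ, φ j t * (‖LebesgueInterp.P x (t + η * Complex.I)‖ *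
          Real.exp (-(LebesgueInterp.freq x a b y * η)))) / LebesgueInterp.P₀ x y r := fun j => by
      rw [← integral_div]
      congr 1; funext t
      rw [Real.exp_neg]; field_simp
    have e2 : ∀ j, ∫ t : ℝ, ‖LebesgueInterp.P x t‖ / LebesgueInterp.P₀ x y r * φ j t =
        (∫ t : ℝ, φ j t * ‖LebesgueInterp.P x t‖) / LebesgueInterp.P₀ x y r := fun j => by
      rw [← integral_div]
      congr 1; funext t
      ring
    simp_rw [e1, e2, ← Finset.sum_div]
    rw [le_div_iff₀ hP0]
    have h2 := mul_le_mul_of_nonneg_right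
      (hbound M₁ ((le_abs_self _).trans (le_add_of_nonneg_right (abs_nonneg _)))) hP0.le
    refine le_trans ?_ h1
    have e3 : ∀ S : ℝ, (4 - 4 * ε) / Real.pi * (S / LebesgueInterp.P₀ x y r) *
        LebesgueInterp.P₀ x y r = 4 / Real.pi * (1 - ε) * S := fun S => by
      field_simp
    rw [sub_mul, e3]
    linarith
  · have h1 := h.nodal_sum_ge hK₂
    rw [hswap (fun t => Real.exp (LebesgueInterp.freq x a b y * η) * LebesgueInterp.P₀ x y r /
      ‖LebesgueInterp.P x (t + η * Complex.I)‖) (continuous_const.div hcont hPne)]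
    have e1 : ∀ j, ∫ t : ℝ, φ j t * (Real.exp (LebesgueInterp.freq x a b y * η) *
        LebesgueInterp.P₀ x y r / ‖LebesgueInterp.P x (t + η * Complex.I)‖) =
        LebesgueInterp.P₀ x y r * ∫ t : ℝ, φ j t *
          (Real.exp (LebesgueInterp.freq x a b y * η) /
            ‖LebesgueInterp.P x (t + η * Complex.I)‖) := fun j => by
      rw [← integral_const_mul]
      congr 1; funext t
      ring
    have e2 : ∀ j, ∑ k, LebesgueInterp.P₀ x y r / ‖LebesgueInterp.P' x (x k)‖ * φ j (x k) =
        LebesgueInterp.P₀ x y r * ∑ k, φ j (x k) / ‖LebesgueInterp.P' x (x k)‖ := fun j => by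
      rw [Finset.mul_sum]
      exact Finset.sum_congr rfl fun k _ => by ring
    simp_rw [e1, e2, ← Finset.mul_sum]
    -- The error in `nodal_sum_ge` is still to be divided by `2π`; as `2π ≥ 1`, the same constant
    -- suffices.
    have h2 := hbound M₂ ((le_abs_self _).trans (le_add_of_nonneg_left (abs_nonneg _)))
    have h3 : 0 ≤ (|M₁| + |M₂|) * (2 * r) * Real.log n ^ (-(1 / 6) : ℝ) := by positivity
    have h4 : (|M₁| + |M₂|) * (2 * r) * Real.log n ^ (-(1 / 6) : ℝ) ≤
        2 * Real.pi * ((|M₁| + |M₂|) * (2 * r) * Real.log n ^ (-(1 / 6) : ℝ)) :=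
      le_mul_of_one_le_left h3 (by linarith [Real.pi_gt_three])
    rw [← mul_le_mul_iff_right₀ (by positivity : 0 < 2 * Real.pi), mul_sub, ← mul_assoc,
      mul_one_div_cancel (by positivity), one_mul]
    linarith
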